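/- Conventions. Operator spaces are complex and need not be complete. A matrix ordered operator space is an operator space $V$ with a conjugate-linear involution and convex cones $M_n(V)^+\subset M_n(V)_{sa}$ such that $\alpha^*M_m(V)^+\alpha\subset M_n(V)^+$ for all $\alpha\in M_{m,n}$, the involution $[x_{ij}]^*=[x_{ji}^*]$ is isometric on every $M_n(V)$, and every $M_n(V)^+$ is norm closed. It is a matrix regular operator space if for all $n$ and all $v\in M_n(V)_{sa}$: (1) $u\in M_n(V)^+$ and $-u\le v\le u$ imply $\|v\|\le\|u\|$; (2) $\|v\|<1$ implies that there is $u\in M_n(V)^+$ with $\|u\|<1$ and $-u\le v\le u$. The dual $V^*$ carries the matrix norms $M_n(V^*)=CB(V,M_n)$, the cones $M_n(V^*)^+=CB(V,M_n)\cap CP(V,M_n)$ and the involution $f^*(v)=\overline{f(v^*)}$. We write c.p. for completely positive and c.c.p. for completely positive and completely contractive. Let $V,W$ be matrix regular operator spaces and let $V\otimes W$ be their algebraic tensor product. The structure $V\otimes_\delta W$. Let $M_n(V\otimes_\delta W)_+$ be the set of $z=[z_{ij}]\in M_n(V\otimes W)$ such that $[(\varphi\otimes\psi)(z_{ij})]\in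 M_{nkl}^+$ for all $k,l\in\mathbb N$ and all continuous c.p. maps $\varphi:V\to M_k$, $\psi:W\to M_l$. For $z\in M_n(V\otimes_\delta W)_+$ let $|z|_\delta=\sup\|[(\varphi\otimes\psi)(z_{ij})]\|$ over all $k,l\in\mathbb N$ and all c.c.p. maps $\varphi:V\to M_k$, $\psi:W\to M_l$. For $z\in M_n(V\otimes W)$ let $$\|z\|_\delta=\inf\Big\{\max\{|u|_\delta,|u'|_\delta\}:\begin{pmatrix}u&z\\z^*&u'\end{pmatrix}\in M_{2n}(V\otimes_\delta W)_+\Big\}.$$ The structure $V\otimes_\Delta W$. Let $$M_n(V\otimes_\Delta W)_+=\{\alpha(v\otimes w)\alpha^*: k,l\in\mathbb N,\ v\in M_k(V)^+,\ w\in M_l(W)^+,\ \alpha\in M_{n,kl}\}.$$ For $z\in M_n(V\otimes_\Delta W)_+$ let $|z|_\Delta$ be the infimum of $\|\alpha\|^2\|v\|\|w\|$ over all such representations $z=\alpha(v\otimes w)\alpha^*$. For $z\in M_n(V\otimes W)$ let $$\|z\|_\Delta=\inf\Big\{\max\{|u|_\Delta,|u'|_\Delta\}:\begin{pmatrix}u&z\\z^*&u'\end{pmatrix}\in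 M_{2n}(V\otimes_\Delta W)_+\Big\}.$$ In both cases the positive cone $M_n(\cdot)^+$ is the closure of $M_n(\cdot)_+$ in the norm just defined, and the spaces are not completed. Statement. Suppose that $V$ and $W$ are matrix regular operator spaces and that one of them is finite dimensional. Then the canonical map $$V^*\otimes_\delta W^*\longrightarrow(V\otimes_\Delta W)^*,\qquad f\otimes g\longmapsto\big(v\otimes w\mapsto f(v)g(w)\big),$$ is a well-defined linear bijection, and it is completely isometric and completely order isomorphic: for every $n$ and every $z\in M_n(V^*\otimes W^*)$ it preserves the norm of $z$, and $z$ is positive if and only if its image is positive. -/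

import Mathlib

open scoped TensorProduct Kronecker Matrix ComplexOrder Matrix.Norms.L2Operator

noncomputable section

namespace OperatorSpaces

/-! ### Matrices over a complex vector space -/

/-- The product `α x β` of a matrix `x` over a complex vector space with scalar matrices. -/
def sandwich {ι κ E : Type*} [Fintype κ] [AddCommGroup E] [Module ℂ E]
    (α : Matrix ι κ ℂ) (x : Matrix κ κ E) (β : Matrix κ ι ℂ) : Matrix ι ι E :=
  Matrix.of fun i j => ∑ p, ∑ q, (α i p * β q j) • x p q

/-- The amplification `φ_n : M_n(E) → M_n(M_κ) = M_{n × κ}` of a linear map `φ : E → M_κ`. -/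
def amp {ι κ E : Type*} [AddCommGroup E] [Module ℂ E]
    (φ : E →ₗ[ℂ] Matrix κ κ ℂ) (x : Matrix ι ι E) : Matrix (ι × κ) (ι × κ) ℂ :=
  Matrix.comp ι ι κ κ ℂ (x.map φ)

/-- The tensor product `φ ⊗ ψ : E ⊗ F → M_κ ⊗ M_ν = M_{κ × ν}`. -/
def tensorMap {κ ν E F : Type*} [AddCommGroup E] [Module ℂ E] [AddCommGroup F] [Module ℂ F]
    (φ : E →ₗ[ℂ] Matrix κ κ ℂ) (ψ : F →ₗ[ℂ] Matrix ν ν ℂ) :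
    E ⊗[ℂ] F →ₗ[ℂ] Matrix (κ × ν) (κ × ν) ℂ :=
  TensorProduct.lift ((Matrix.kroneckerBilinear (R := ℂ) (α := ℂ)).compl₁₂ φ ψ)

/-! ### Matrix regular operator spaces -/

/-- A complex vector space with a function (the norm) and a set (the positive cone) on each
`M_n(V)`. No axioms are imposed here. -/
class MatrixStructure (V : Type*) [AddCommGroup V] [Module ℂ V] where
  matNorm (n : ℕ) : Matrix (Fin n) (Fin n) V → ℝ
  matCone (n : ℕ) : Set (Matrix (Fin n) (Fin n) V)

/-- The norm on `M_n(V)`. -/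
abbrev matNorm {V : Type*} [AddCommGroup V] [Module ℂ V] [MatrixStructure V] {n : ℕ}
    (x : Matrix (Fin n) (Fin n) V) : ℝ :=
  MatrixStructure.matNorm n x

/-- The positive cone `M_n(V)^+`. -/
abbrev matCone (V : Type*) [AddCommGroup V] [Module ℂ V] [MatrixStructure V] (n : ℕ) :
    Set (Matrix (Fin n) (Fin n) V) :=
  MatrixStructure.matCone n

/-- (Abstract, not necessarily complete) operator spaces: each `M_n(V)` is normed and the two
axioms of Ruan hold. -/
class OperatorSpace (V : Type*) [AddCommGroup V] [Module ℂ V] [MatrixStructure V] : Prop where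
  matNorm_nonneg {n : ℕ} (x : Matrix (Fin n) (Fin n) V) : 0 ≤ matNorm x
  matNorm_eq_zero_iff {n : ℕ} (x : Matrix (Fin n) (Fin n) V) : matNorm x = 0 ↔ x = 0
  matNorm_add_le {n : ℕ} (x y : Matrix (Fin n) (Fin n) V) :
    matNorm (x + y) ≤ matNorm x + matNorm y
  matNorm_smul {n : ℕ} (c : ℂ) (x : Matrix (Fin n) (Fin n) V) : matNorm (c • x) = ‖c‖ * matNorm x
  matNorm_directSum {m n : ℕ} (x : Matrix (Fin m) (Fin m) V) (y : Matrix (Fin n) (Fin n) V) :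
    matNorm (Matrix.reindex finSumFinEquiv finSumFinEquiv (Matrix.fromBlocks x 0 0 y)) =
      max (matNorm x) (matNorm y)
  matNorm_sandwich_le {m n : ℕ} (α : Matrix (Fin n) (Fin m) ℂ) (x : Matrix (Fin m) (Fin m) V)
    (β : Matrix (Fin m) (Fin n) ℂ) : matNorm (sandwich α x β) ≤ ‖α‖ * matNorm x * ‖β‖

/-- Matrix ordered operator spaces: operator spaces with an isometric involution and closed
(not necessarily proper) convex cones of self-adjoint elements, compatible with compressions by
scalar matrices. The involution on `M_n(V)` is `[x_ij]ᴴ = [x_ji^*]`. -/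
class MatrixOrderedOperatorSpace (V : Type*) [AddCommGroup V] [Module ℂ V] [StarAddMonoid V]
    [StarModule ℂ V] [MatrixStructure V] : Prop extends OperatorSpace V where
  matNorm_conjTranspose {n : ℕ} (x : Matrix (Fin n) (Fin n) V) : matNorm xᴴ = matNorm x
  conjTranspose_eq_of_mem {n : ℕ} {x : Matrix (Fin n) (Fin n) V} : x ∈ matCone V n → xᴴ = x
  zero_mem (n : ℕ) : (0 : Matrix (Fin n) (Fin n) V) ∈ matCone V n
  add_mem {n : ℕ} {x y : Matrix (Fin n) (Fin n) V} :
    x ∈ matCone V n → y ∈ matCone V n → x + y ∈ matCone V n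
  smul_mem {n : ℕ} {x : Matrix (Fin n) (Fin n) V} (t : ℝ) :
    0 ≤ t → x ∈ matCone V n → (t : ℂ) • x ∈ matCone V n
  sandwich_mem {m n : ℕ} (α : Matrix (Fin m) (Fin n) ℂ) {x : Matrix (Fin m) (Fin m) V} :
    x ∈ matCone V m → sandwich αᴴ x α ∈ matCone V n
  cone_closed {n : ℕ} (x : Matrix (Fin n) (Fin n) V) :
    (∀ ε > 0, ∃ y ∈ matCone V n, matNorm (x - y) < ε) → x ∈ matCone V n

/-- Matrix regular operator spaces; `-u ≤ v ≤ u` is written as `v + u ≥ 0`, `u - v ≥ 0`. -/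
class MatrixRegularOperatorSpace (V : Type*) [AddCommGroup V] [Module ℂ V] [StarAddMonoid V]
    [StarModule ℂ V] [MatrixStructure V] : Prop extends MatrixOrderedOperatorSpace V where
  matNorm_le {n : ℕ} (v u : Matrix (Fin n) (Fin n) V) : vᴴ = v → u ∈ matCone V n →
    v + u ∈ matCone V n → u - v ∈ matCone V n → matNorm v ≤ matNorm u
  exists_dominating {n : ℕ} (v : Matrix (Fin n) (Fin n) V) : vᴴ = v → matNorm v < 1 →
    ∃ u ∈ matCone V n, matNorm u < 1 ∧ v + u ∈ matCone V n ∧ u - v ∈ matCone V n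

/-! ### Maps into matrix algebras -/

section Maps

variable {V : Type*} [AddCommGroup V] [Module ℂ V] [MatrixStructure V] {k : ℕ}

/-- Continuity of a linear map `V → M_k`, in the form of boundedness. -/
def IsBoundedMap (φ : V →ₗ[ℂ] Matrix (Fin k) (Fin k) ℂ) : Prop :=
  ∃ C : ℝ, ∀ v : V, ‖φ v‖ ≤ C * matNorm (n := 1) (Matrix.of fun _ _ => v)

/-- Complete boundedness of a linear map `V → M_k`. -/
def IsCompletelyBounded (φ : V →ₗ[ℂ] Matrix (Fin k) (Fin k) ℂ) : Prop :=
  ∃ C : ℝ, ∀ (n : ℕ) (v : Matrix (Fin n) (Fin n) V), ‖amp φ v‖ ≤ C * matNorm v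

/-- The completely bounded norm of a linear map `V → M_k`. -/
def cbNorm (φ : V →ₗ[ℂ] Matrix (Fin k) (Fin k) ℂ) : ℝ :=
  sSup {r : ℝ | ∃ (n : ℕ) (v : Matrix (Fin n) (Fin n) V), matNorm v ≤ 1 ∧ r = ‖amp φ v‖}

/-- Complete contractivity of a linear map `V → M_k`. -/
def IsCompletelyContractive (φ : V →ₗ[ℂ] Matrix (Fin k) (Fin k) ℂ) : Prop :=
  ∀ (n : ℕ) (v : Matrix (Fin n) (Fin n) V), ‖amp φ v‖ ≤ matNorm v

/-- Complete positivity of a linear map `V → M_k`. -/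
def IsCompletelyPositive (φ : V →ₗ[ℂ] Matrix (Fin k) (Fin k) ℂ) : Prop :=
  ∀ (n : ℕ), ∀ v ∈ matCone V n, (amp φ v).PosSemidef

end Maps

/-! ### The operator space dual -/

/-- The dual space `V^*`: the linear functionals that are bounded for the norm of
`V = M_1(V)`. -/
def dualSpace (V : Type*) [AddCommGroup V] [Module ℂ V] [MatrixStructure V] :
    Submodule ℂ (V →ₗ[ℂ] ℂ) where
  carrier := {f | ∃ C : ℝ, ∀ v : V, ‖f v‖ ≤ C * matNorm (n := 1) (Matrix.of fun _ _ => v)}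
  zero_mem' := ⟨0, fun v => by simp⟩
  add_mem' := by
    rintro f g ⟨C, hC⟩ ⟨D, hD⟩
    refine ⟨C + D, fun v => (norm_add_le _ _).trans ?_⟩
    rw [add_mul]
    exact add_le_add (hC v) (hD v)
  smul_mem' := by
    rintro c f ⟨C, hC⟩
    refine ⟨‖c‖ * C, fun v => ?_⟩
    rw [LinearMap.smul_apply, norm_smul, mul_assoc]
    exact mul_le_mul_of_nonneg_left (hC v) (norm_nonneg c)

/-- The linear map `V → M_n`, `v ↦ [f_ij(v)]`, identified with `[f_ij] ∈ M_n(V^*)`. -/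
def dualMatrixMap {V : Type*} [AddCommGroup V] [Module ℂ V] [MatrixStructure V] {n : ℕ}
    (f : Matrix (Fin n) (Fin n) (dualSpace V)) : V →ₗ[ℂ] Matrix (Fin n) (Fin n) ℂ where
  toFun v := Matrix.of fun i j => (f i j : V →ₗ[ℂ] ℂ) v
  map_add' v w := by ext i j; simp
  map_smul' c v := by ext i j; simp

/-- The matrix norms `M_n(V^*) = CB(V, M_n)` and the cones
`M_n(V^*)^+ = CB(V, M_n) ∩ CP(V, M_n)`. -/
instance dualMatrixStructure (V : Type*) [AddCommGroup V] [Module ℂ V] [MatrixStructure V] :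
    MatrixStructure (dualSpace V) where
  matNorm _ f := cbNorm (dualMatrixMap f)
  matCone _ := {f | IsCompletelyBounded (dualMatrixMap f) ∧ IsCompletelyPositive (dualMatrixMap f)}

section DualStar

variable {V : Type*} [AddCommGroup V] [Module ℂ V] [StarAddMonoid V] [StarModule ℂ V]
  [MatrixStructure V] [MatrixOrderedOperatorSpace V]

/-- The involution `f^*(v) = conj (f (v^*))` on the dual of a matrix ordered operator space. -/
instance dualStar : Star (dualSpace V) where
  star f :=
    ⟨{ toFun := fun v => star ((f : V →ₗ[ℂ] ℂ) (star v))
       map_add' := fun v w => by simp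
       map_smul' := fun c v => by simp [star_smul] },
      by
        obtain ⟨C, hC⟩ := f.2
        refine ⟨C, fun v => ?_⟩
        have h := MatrixOrderedOperatorSpace.matNorm_conjTranspose (n := 1)
          (Matrix.of fun _ _ => v)
        have h2 : (Matrix.of fun _ _ => v : Matrix (Fin 1) (Fin 1) V)ᴴ
            = Matrix.of fun _ _ => star v := by
          ext i j; simp
        rw [h2] at h
        rw [← h]
        simpa using hC (star v)⟩

theorem dualStar_apply (f : dualSpace V) (v : V) :
    ((star f : dualSpace V) : V →ₗ[ℂ] ℂ) v = star ((f : V →ₗ[ℂ] ℂ) (star v)) := rfl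

instance dualStarAddMonoid : StarAddMonoid (dualSpace V) where
  star_involutive f := by
    apply Subtype.ext; ext v; simp [dualStar_apply]
  star_add f g := by
    apply Subtype.ext; ext v; simp [dualStar_apply]

instance dualStarModule : StarModule ℂ (dualSpace V) where
  star_smul c f := by
    apply Subtype.ext; ext v; simp [dualStar_apply]

end DualStar

/-! ### The two tensor products -/

section Tensor

variable (V W : Type*) [AddCommGroup V] [Module ℂ V] [StarAddMonoid V] [StarModule ℂ V]
  [MatrixStructure V] [AddCommGroup W] [Module ℂ W] [StarAddMonoid W] [StarModule ℂ W]
  [MatrixStructure W]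

/-- The cone `M_ι(V ⊗_δ W)_+`, before taking the closure. -/
def minPreCone (ι : Type) [Fintype ι] : Set (Matrix ι ι (V ⊗[ℂ] W)) :=
  {z | ∀ (k l : ℕ) (φ : V →ₗ[ℂ] Matrix (Fin k) (Fin k) ℂ) (ψ : W →ₗ[ℂ] Matrix (Fin l) (Fin l) ℂ),
    IsBoundedMap φ → IsCompletelyPositive φ → IsBoundedMap ψ → IsCompletelyPositive ψ →
    (amp (tensorMap φ ψ) z).PosSemidef}

/-- The cone `M_ι(V ⊗_Δ W)_+`, before taking the closure. -/
def maxPreCone (ι : Type) [Fintype ι] : Set (Matrix ι ι (V ⊗[ℂ] W)) :=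
  {z | ∃ (k l : ℕ) (v : Matrix (Fin k) (Fin k) V) (w : Matrix (Fin l) (Fin l) W)
    (α : Matrix ι (Fin k × Fin l) ℂ), v ∈ matCone V k ∧ w ∈ matCone W l ∧
    z = sandwich α (Matrix.kroneckerTMul ℂ v w) αᴴ}

variable {V W}

/-- The quantity `|z|_δ`, for `z ∈ M_n(V ⊗_δ W)_+`. -/
def minModulus {n : ℕ} (z : Matrix (Fin n) (Fin n) (V ⊗[ℂ] W)) : ℝ :=
  sSup {r : ℝ | ∃ (k l : ℕ) (φ : V →ₗ[ℂ] Matrix (Fin k) (Fin k) ℂ)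
    (ψ : W →ₗ[ℂ] Matrix (Fin l) (Fin l) ℂ),
    IsCompletelyPositive φ ∧ IsCompletelyContractive φ ∧
    IsCompletelyPositive ψ ∧ IsCompletelyContractive ψ ∧ r = ‖amp (tensorMap φ ψ) z‖}

/-- The quantity `|z|_Δ`, for `z ∈ M_n(V ⊗_Δ W)_+`. -/
def maxModulus {n : ℕ} (z : Matrix (Fin n) (Fin n) (V ⊗[ℂ] W)) : ℝ :=
  sInf {r : ℝ | ∃ (k l : ℕ) (v : Matrix (Fin k) (Fin k) V) (w : Matrix (Fin l) (Fin l) W)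
    (α : Matrix (Fin n) (Fin k × Fin l) ℂ), v ∈ matCone V k ∧ w ∈ matCone W l ∧
    z = sandwich α (Matrix.kroneckerTMul ℂ v w) αᴴ ∧ r = ‖α‖ ^ 2 * matNorm v * matNorm w}

/-- The norm `‖z‖_δ` on `M_n(V ⊗ W)`. -/
def minNorm {n : ℕ} (z : Matrix (Fin n) (Fin n) (V ⊗[ℂ] W)) : ℝ :=
  sInf {r : ℝ | ∃ u u' : Matrix (Fin n) (Fin n) (V ⊗[ℂ] W),
    Matrix.fromBlocks u z zᴴ u' ∈ minPreCone V W (Fin n ⊕ Fin n) ∧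
    r = max (minModulus u) (minModulus u')}

/-- The norm `‖z‖_Δ` on `M_n(V ⊗ W)`. -/
def maxNorm {n : ℕ} (z : Matrix (Fin n) (Fin n) (V ⊗[ℂ] W)) : ℝ :=
  sInf {r : ℝ | ∃ u u' : Matrix (Fin n) (Fin n) (V ⊗[ℂ] W),
    Matrix.fromBlocks u z zᴴ u' ∈ maxPreCone V W (Fin n ⊕ Fin n) ∧
    r = max (maxModulus u) (maxModulus u')}

/-- The algebraic tensor product `V ⊗ W`, to be equipped with the structure `V ⊗_δ W`. -/
def MinTensor (V W : Type*) [AddCommGroup V] [Module ℂ V] [AddCommGroup W] [Module ℂ W] : Type _ :=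
  V ⊗[ℂ] W

/-- The algebraic tensor product `V ⊗ W`, to be equipped with the structure `V ⊗_Δ W`. -/
def MaxTensor (V W : Type*) [AddCommGroup V] [Module ℂ V] [AddCommGroup W] [Module ℂ W] : Type _ :=
  V ⊗[ℂ] W

variable (V W)

instance : AddCommGroup (MinTensor V W) := inferInstanceAs (AddCommGroup (V ⊗[ℂ] W))
instance : Module ℂ (MinTensor V W) := inferInstanceAs (Module ℂ (V ⊗[ℂ] W))
instance : AddCommGroup (MaxTensor V W) := inferInstanceAs (AddCommGroup (V ⊗[ℂ] W))
instance : Module ℂ (MaxTensor V W) := inferInstanceAs (Module ℂ (V ⊗[ℂ] W))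

/-- The matrix norms of `V ⊗_δ W` and the closures of the cones in these norms. -/
instance minTensorMatrixStructure : MatrixStructure (MinTensor V W) where
  matNorm n z := minNorm (V := V) (W := W) (n := n) z
  matCone n := {z : Matrix (Fin n) (Fin n) (V ⊗[ℂ] W) | ∀ ε > 0, ∃ y ∈ minPreCone V W (Fin n),
    minNorm (V := V) (W := W) (n := n) (z - y) < ε}

/-- The matrix norms of `V ⊗_Δ W` and the closures of the cones in these norms. -/
instance maxTensorMatrixStructure : MatrixStructure (MaxTensor V W) where
  matNorm n z := maxNorm (V := V) (W := W) (n := n) z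
  matCone n := {z : Matrix (Fin n) (Fin n) (V ⊗[ℂ] W) | ∀ ε > 0, ∃ y ∈ maxPreCone V W (Fin n),
    maxNorm (V := V) (W := W) (n := n) (z - y) < ε}

variable {V W}

/-- The elementary tensor `v ⊗ w` in `V ⊗_δ W`. -/
def MinTensor.tmul (v : V) (w : W) : MinTensor V W := TensorProduct.tmul ℂ v w

/-- The elementary tensor `v ⊗ w` in `V ⊗_Δ W`. -/
def MaxTensor.tmul (v : V) (w : W) : MaxTensor V W := TensorProduct.tmul ℂ v w

end Tensor

end OperatorSpaces

end

open OperatorSpaces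

open scoped TensorProduct Kronecker Matrix ComplexOrder Matrix.Norms.L2Operator

namespace OperatorSpaces

/-! ### Scalar matrices -/

section Scalar

variable {ι κ : Type*} [Fintype ι] [Fintype κ]

/-! An element `z` of `M_n(V^* ⊗ W^*)` induces a map `F : V ⊗ W → M_n`. When one factor is finite
dimensional, a basis and its (automatically bounded) dual basis invert this correspondence, so the
real content is the comparison of cones and norms.

Order. A map on `V ⊗_Δ W` is completely positive on the generating cone exactly when it is positive
on all `v ⊗ w` with `v`, `w` positive. Evaluations at positive `v` and `w` are c.p. maps on the
duals, so δ-positivity of `z` makes `F` positive (`posMap_of_mem_minPreCone`). For the converse,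
arbitrary c.p. `φ`, `ψ` on the duals are removed one variable at a time: `(φ ⊗ ψ)(z)` is `ψ` applied
to a matrix over `W^*`, whose positivity as a map on `W` is a statement about `φ` applied to a
matrix over `V^*`, whose positivity as a map on `V` is that of `F` at `v ⊗ w`
(`mem_minPreCone_of_posMap`). The same slicing with complete contractions (`norm_amp_tensorMap_le`)
shows that, for positive `u`, `|u|_δ` is the least bound of the induced map on the positive ball.

Norm. The norms of `V`, `W` and `V ⊗_Δ W` are all gauges of domination by `2 × 2` positive matrices
(`gauge_posBall`, `gauge_maxBall`). A δ-positive matrix with corner `z` gives a c.p. block map, and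
its corner is controlled by its diagonal (`PosMap.norm_amp_corner_le`); hence the cb norm is at most
the δ-norm. The other inequality completes a map of cb norm at most `r` to a c.p. block map with
diagonal bounded by `r`. This off-diagonal extension theorem of Wittstock–Paulsen type
(`exists_posMap_corner`) follows from the M. Riesz extension theorem, once maps `X → M_κ` are
identified with functionals on `M_κ(X)`. The diagonal entries live in the dual of `V ⊗_Δ W`, and
surjectivity of the canonical map brings them back to `V^* ⊗ W^*`; finite dimension enters here.

Ball systems keep only what the extension theorem needs, contractive compressions and direct sums,
so that it applies to `V`, `W` and `V ⊗_Δ W` alike, and the operator space axioms need not be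
verified for the tensor product. -/

theorem star_dotProduct_self (ξ : ι → ℂ) : star ξ ⬝ᵥ ξ = ((∑ i, ‖ξ i‖ ^ 2 : ℝ) : ℂ) := by
  simp only [dotProduct, Pi.star_apply, RCLike.star_def, Complex.conj_mul']
  push_cast
  rfl

theorem star_dotProduct_conjTranspose_mulVec (B : Matrix ι κ ℂ) (ξ : ι → ℂ) (η : κ → ℂ) :
    star η ⬝ᵥ Bᴴ *ᵥ ξ = star (star ξ ⬝ᵥ B *ᵥ η) := by
  rw [← Matrix.star_dotProduct, Matrix.star_mulVec, ← Matrix.dotProduct_mulVec]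

theorem norm_dotProduct_mulVec_le [DecidableEq ι] (A : Matrix ι ι ℂ) (ξ η : ι → ℂ) :
    ‖star ξ ⬝ᵥ A *ᵥ η‖ ≤ ‖A‖ * (√(∑ i, ‖ξ i‖ ^ 2) * √(∑ i, ‖η i‖ ^ 2)) := by
  have h1 := norm_inner_le_norm (𝕜 := ℂ) (WithLp.toLp 2 ξ) (WithLp.toLp 2 (A *ᵥ η))
  have h2 := Matrix.l2_opNorm_mulVec A (WithLp.toLp 2 η)
  rw [EuclideanSpace.inner_eq_star_dotProduct, dotProduct_comm] at h1
  have e : (EuclideanSpace.equiv ι ℂ).symm (A *ᵥ (WithLp.toLp 2 η)) = WithLp.toLp 2 (A *ᵥ η) := rfl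
  rw [e] at h2
  rw [EuclideanSpace.norm_eq (WithLp.toLp 2 ξ)] at h1
  rw [EuclideanSpace.norm_eq (WithLp.toLp 2 η)] at h2
  calc _ ≤ _ := h1
    _ ≤ _ := mul_le_mul_of_nonneg_left h2 (Real.sqrt_nonneg _)
    _ = _ := by ring

/-- Cauchy–Schwarz followed by the arithmetic-geometric mean inequality. The bound is additive in
the squared norms, which is what convexity arguments and block matrices need. -/
theorem two_mul_norm_dotProduct_mulVec_le [DecidableEq ι] {A : Matrix ι ι ℂ} {r : ℝ}
    (hA : ‖A‖ ≤ r) (ξ η : ι → ℂ) :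
    2 * ‖star ξ ⬝ᵥ A *ᵥ η‖ ≤ r * (∑ i, ‖ξ i‖ ^ 2 + ∑ i, ‖η i‖ ^ 2) := by
  have h := norm_dotProduct_mulVec_le A ξ η
  have h0 : 0 ≤ r := (norm_nonneg _).trans hA
  have hξ : 0 ≤ ∑ i, ‖ξ i‖ ^ 2 := Finset.sum_nonneg fun i _ => by positivity
  have hη : 0 ≤ ∑ i, ‖η i‖ ^ 2 := Finset.sum_nonneg fun i _ => by positivity
  have h3 := two_mul_le_add_sq (√(∑ i, ‖ξ i‖ ^ 2)) (√(∑ i, ‖η i‖ ^ 2))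
  rw [Real.sq_sqrt hξ, Real.sq_sqrt hη] at h3
  have h4 : ‖star ξ ⬝ᵥ A *ᵥ η‖ ≤ r * (√(∑ i, ‖ξ i‖ ^ 2) * √(∑ i, ‖η i‖ ^ 2)) :=
    h.trans (mul_le_mul_of_nonneg_right hA (by positivity))
  nlinarith [mul_le_mul_of_nonneg_left h3 h0]

/-- Converse of the additive bound: inserting real multiples of `A x` for `ξ` and optimising the
multiple recovers the operator norm. Real parts suffice because the form is then real. -/
theorem norm_le_of_form [DecidableEq ι] {A : Matrix ι ι ℂ} {r : ℝ} (hr : 0 ≤ r)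
    (h : ∀ ξ η : ι → ℂ,
      2 * (star ξ ⬝ᵥ A *ᵥ η).re ≤ r * (∑ i, ‖ξ i‖ ^ 2 + ∑ i, ‖η i‖ ^ 2)) : ‖A‖ ≤ r := by
  rw [Matrix.l2_opNorm_def]
  refine ContinuousLinearMap.opNorm_le_bound _ hr fun x => ?_
  change ‖(WithLp.toLp 2 (A *ᵥ x.ofLp) : EuclideanSpace ℂ ι)‖ ≤ _
  set a := ‖(WithLp.toLp 2 (A *ᵥ x.ofLp) : EuclideanSpace ℂ ι)‖ with ha
  have ha2 : ∑ i, ‖(A *ᵥ x.ofLp) i‖ ^ 2 = a ^ 2 := by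
    rw [ha, EuclideanSpace.norm_sq_eq]
  have hx2 : ∑ i, ‖x.ofLp i‖ ^ 2 = ‖x‖ ^ 2 := (EuclideanSpace.norm_sq_eq _).symm
  have key : ∀ s : ℝ, 2 * (s * a ^ 2) ≤ r * (s ^ 2 * a ^ 2 + ‖x‖ ^ 2) := by
    intro s
    have h1 := h ((s : ℂ) • (A *ᵥ x.ofLp)) x.ofLp
    have e : star ((s : ℂ) • (A *ᵥ x.ofLp)) ⬝ᵥ A *ᵥ x.ofLp = ((s * a ^ 2 : ℝ) : ℂ) := by
      rw [star_smul, smul_dotProduct, star_dotProduct_self, ha2]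
      simp
    rw [e, Complex.ofReal_re, hx2] at h1
    simpa [mul_pow, ← Finset.mul_sum, ha2] using h1
  rcases (norm_nonneg (WithLp.toLp 2 (A *ᵥ x.ofLp) : EuclideanSpace ℂ ι)).eq_or_lt with h0 | h0
  · rw [← ha] at h0; rw [← h0]; positivity
  · rw [← ha] at h0
    -- This multiple gives `s • A x` the same norm as `x`, so nothing is lost in the mean
    -- inequality.
    have h1 := key (‖x‖ / a)
    have e1 : ‖x‖ / a * a ^ 2 = ‖x‖ * a := by field_simp
    have e2 : (‖x‖ / a) ^ 2 * a ^ 2 = ‖x‖ ^ 2 := by field_simp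
    rw [e1, e2] at h1
    rcases (norm_nonneg x).eq_or_lt with hx | hx
    · have := key 1
      rw [← hx] at this ⊢
      -- For `x = 0` any multiple `s` with `r * s < 2` contradicts `a > 0`.
      have h5 := key (1 / (r + 1))
      rw [← hx] at h5
      have hr1 : 0 < r + 1 := by linarith
      have h6 : 2 * (1 / (r + 1) * a ^ 2) * (r + 1) ^ 2
          ≤ r * ((1 / (r + 1)) ^ 2 * a ^ 2 + 0 ^ 2) * (r + 1) ^ 2 :=
        mul_le_mul_of_nonneg_right h5 (by positivity)
      have e3 : 2 * (1 / (r + 1) * a ^ 2) * (r + 1) ^ 2 = 2 * (r + 1) * a ^ 2 := by field_simp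
      have e4 : r * ((1 / (r + 1)) ^ 2 * a ^ 2 + 0 ^ 2) * (r + 1) ^ 2 = r * a ^ 2 := by
        field_simp; ring
      rw [e3, e4] at h6
      nlinarith [sq_nonneg a, pow_pos h0 2]
    · nlinarith

theorem PosSemidef.norm_le_iff [DecidableEq ι] {A : Matrix ι ι ℂ} (hA : A.PosSemidef) {r : ℝ}
    (hr : 0 ≤ r) : ‖A‖ ≤ r ↔ ((r : ℂ) • (1 : Matrix ι ι ℂ) - A).PosSemidef := by
  have e : ∀ x : ι → ℂ, star x ⬝ᵥ ((r : ℂ) • (1 : Matrix ι ι ℂ) - A) *ᵥ x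
      = ((r * ∑ i, ‖x i‖ ^ 2 : ℝ) : ℂ) - star x ⬝ᵥ A *ᵥ x := by
    intro x
    rw [Matrix.sub_mulVec, dotProduct_sub, Matrix.smul_mulVec, Matrix.one_mulVec, dotProduct_smul,
      star_dotProduct_self]
    simp
  constructor
  · intro h
    refine Matrix.PosSemidef.of_dotProduct_mulVec_nonneg ?_ fun x => ?_
    · refine Matrix.IsHermitian.sub ?_ hA.1
      simp [Matrix.IsHermitian, Matrix.conjTranspose_smul]
    · rw [e]
      have h1 := hA.dotProduct_mulVec_nonneg x
      have h2 := two_mul_norm_dotProduct_mulVec_le h x x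
      have h3 := Complex.re_le_norm (star x ⬝ᵥ A *ᵥ x)
      rw [Complex.le_def] at h1 ⊢
      refine ⟨?_, ?_⟩
      · rw [Complex.sub_re, Complex.ofReal_re]; simp only [Complex.zero_re]; linarith
      · rw [Complex.sub_im, Complex.ofReal_im, ← h1.2]; simp
  · intro h
    refine norm_le_of_form hr fun ξ η => ?_
    -- Positivity at `ξ - η` bounds twice the real part of the mixed term by the two diagonal terms.
    have h1 := (hA.dotProduct_mulVec_nonneg (ξ - η))
    have h2 := h.dotProduct_mulVec_nonneg ξ
    have h3 := h.dotProduct_mulVec_nonneg η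
    rw [e] at h2 h3
    have h4 : star η ⬝ᵥ A *ᵥ ξ = star (star ξ ⬝ᵥ A *ᵥ η) := by
      rw [← star_dotProduct_conjTranspose_mulVec, hA.1.eq]
    rw [star_sub, sub_dotProduct, Matrix.mulVec_sub, dotProduct_sub, dotProduct_sub, h4] at h1
    have h1 := (Complex.le_def.1 h1).1
    have h2 := (Complex.le_def.1 h2).1
    have h3 := (Complex.le_def.1 h3).1
    simp only [Complex.zero_re, Complex.sub_re, Complex.ofReal_re, RCLike.star_def,
      Complex.conj_re] at h1 h2 h3
    linarith

/-- A rectangular matrix is contractive if and only if `1 - γᴴ γ ≥ 0`. -/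
theorem norm_le_one_iff_posSemidef [DecidableEq ι] (γ : Matrix κ ι ℂ) :
    ‖γ‖ ≤ 1 ↔ (1 - γᴴ * γ).PosSemidef := by
  have h := PosSemidef.norm_le_iff (Matrix.posSemidef_conjTranspose_mul_self γ) zero_le_one
  rw [Matrix.l2_opNorm_conjTranspose_mul_self] at h
  simp only [Complex.ofReal_one, one_smul] at h
  rw [← h]
  constructor
  · intro h; nlinarith [norm_nonneg γ]
  · intro h; nlinarith [norm_nonneg γ]

/-- Test the positive form at `(ξ, -η)`: the mixed term is dominated by the diagonal blocks. -/
theorem norm_le_of_posSemidef_fromBlocks [DecidableEq ι] {A B D : Matrix ι ι ℂ} {r : ℝ}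
    (hr : 0 ≤ r) (h : (Matrix.fromBlocks A B Bᴴ D).PosSemidef)
    (hA : ‖A‖ ≤ r) (hD : ‖D‖ ≤ r) : ‖B‖ ≤ r := by
  refine norm_le_of_form hr fun ξ η => ?_
  have h1 := h.dotProduct_mulVec_nonneg (Sum.elim ξ (-η))
  rw [Matrix.fromBlocks_mulVec] at h1
  have es : star (Sum.elim ξ (-η)) = Sum.elim (star ξ) (-star η) := by
    ext i; rcases i with i | i <;> simp
  have h4 : star η ⬝ᵥ Bᴴ *ᵥ ξ = star (star ξ ⬝ᵥ B *ᵥ η) :=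
    star_dotProduct_conjTranspose_mulVec B ξ η
  rw [es, sumElim_dotProduct_sumElim] at h1
  simp only [Sum.elim_comp_inl, Sum.elim_comp_inr, Matrix.mulVec_neg, dotProduct_add,
    dotProduct_neg, neg_dotProduct, h4] at h1
  have h1 := (Complex.le_def.1 h1).1
  have h2 := two_mul_norm_dotProduct_mulVec_le hA ξ ξ
  have h3 := two_mul_norm_dotProduct_mulVec_le hD η η
  have h5 := Complex.re_le_norm (star ξ ⬝ᵥ A *ᵥ ξ)
  have h6 := Complex.re_le_norm (star η ⬝ᵥ D *ᵥ η)
  simp only [Complex.zero_re, Complex.add_re, Complex.neg_re, RCLike.star_def,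
      Complex.conj_re] at h1
  linarith

theorem norm_submatrix_equiv_le {ι κ : Type*} [Fintype ι] [Fintype κ] [DecidableEq ι]
    [DecidableEq κ] (e : κ ≃ ι) (A : Matrix ι ι ℂ) : ‖A.submatrix e e‖ ≤ ‖A‖ := by
  refine norm_le_of_form (norm_nonneg _) fun ξ η => ?_
  have h := two_mul_norm_dotProduct_mulVec_le (le_refl ‖A‖) (ξ ∘ e.symm) (η ∘ e.symm)
  have e1 : ∀ ξ : κ → ℂ, ∑ i, ‖(ξ ∘ e.symm) i‖ ^ 2 = ∑ i, ‖ξ i‖ ^ 2 := fun ξ =>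
    Equiv.sum_comp e.symm fun i => ‖ξ i‖ ^ 2
  have e2 : star ξ ⬝ᵥ A.submatrix e e *ᵥ η = star (ξ ∘ e.symm) ⬝ᵥ A *ᵥ (η ∘ e.symm) := by
    simp only [dotProduct, Matrix.mulVec]
    rw [← Equiv.sum_comp e]
    refine Finset.sum_congr rfl fun i _ => ?_
    rw [← Equiv.sum_comp e]
    simp
  rw [e1, e1] at h
  rw [e2]
  linarith [Complex.re_le_norm (star (ξ ∘ e.symm) ⬝ᵥ A *ᵥ (η ∘ e.symm))]

theorem norm_reindex_self [DecidableEq ι] [DecidableEq κ] (e : ι ≃ κ) (A : Matrix ι ι ℂ) :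
    ‖A.submatrix e.symm e.symm‖ = ‖A‖ :=
  le_antisymm (norm_submatrix_equiv_le e.symm A) (by
    simpa using norm_submatrix_equiv_le e (A.submatrix e.symm e.symm))

end Scalar

/-! ### Products with scalar matrices -/

section Sand

variable {ι κ μ ν ρ σ E : Type*} [Fintype κ] [Fintype μ] [AddCommGroup E] [Module ℂ E]

/-- The product `α x β` of a matrix over a vector space with rectangular scalar matrices. -/
def sand (α : Matrix ι κ ℂ) (x : Matrix κ μ E) (β : Matrix μ ν ℂ) : Matrix ι ν E :=
  Matrix.of fun i j => ∑ p, ∑ q, (α i p * β q j) • x p q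

theorem sandwich_eq_sand (α : Matrix ι κ ℂ) (x : Matrix κ κ E) (β : Matrix κ ι ℂ) :
    sandwich α x β = sand α x β := rfl

theorem sand_apply (α : Matrix ι κ ℂ) (x : Matrix κ μ E) (β : Matrix μ ν ℂ) (i : ι) (j : ν) :
    sand α x β i j = ∑ p, ∑ q, (α i p * β q j) • x p q := rfl

theorem sand_smul (α : Matrix ι κ ℂ) (c : ℂ) (x : Matrix κ μ E) (β : Matrix μ ν ℂ) :
    sand α (c • x) β = c • sand α x β := by
  ext i j; simp [sand_apply, Finset.smul_sum, smul_comm c]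

theorem sand_zero (α : Matrix ι κ ℂ) (β : Matrix μ ν ℂ) :
    sand α (0 : Matrix κ μ E) β = 0 := by
  ext i j; simp [sand_apply]

theorem sand_zero_right (α : Matrix ι κ ℂ) (x : Matrix κ μ E) :
    sand α x (0 : Matrix μ ν ℂ) = 0 := by
  ext i j; simp [sand_apply]

theorem smul_sand (c : ℂ) (α : Matrix ι κ ℂ) (x : Matrix κ μ E) (β : Matrix μ ν ℂ) :
    sand (c • α) x β = c • sand α x β := by
  ext i j; simp [sand_apply, Finset.smul_sum, smul_smul, mul_assoc]

theorem sand_smul_right (c : ℂ) (α : Matrix ι κ ℂ) (x : Matrix κ μ E) (β : Matrix μ ν ℂ) :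
    sand α x (c • β) = c • sand α x β := by
  ext i j; simp [sand_apply, Finset.smul_sum, smul_smul, mul_left_comm]

theorem one_sand_one [DecidableEq κ] [DecidableEq μ] (x : Matrix κ μ E) : sand 1 x 1 = x := by
  ext i j
  simp [sand_apply, Matrix.one_apply, Finset.sum_ite_eq]

theorem sand_sand [Fintype ι] [Fintype ν] (α' : Matrix ρ ι ℂ) (α : Matrix ι κ ℂ) (x : Matrix κ μ E)
    (β : Matrix μ ν ℂ) (β' : Matrix ν σ ℂ) :
    sand α' (sand α x β) β' = sand (α' * α) x (β * β') := by
  ext i j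
  simp only [sand_apply, Matrix.mul_apply, Finset.smul_sum, smul_smul, Finset.sum_mul_sum,
    Finset.sum_smul]
  calc _ = ∑ a : ι × ν, ∑ p : κ × μ,
        (α' i a.1 * β' a.2 j * (α a.1 p.1 * β p.2 a.2)) • x p.1 p.2 := by
        simp only [Fintype.sum_prod_type]
    _ = ∑ p : κ × μ, ∑ a : ι × ν,
        (α' i a.1 * β' a.2 j * (α a.1 p.1 * β p.2 a.2)) • x p.1 p.2 := Finset.sum_comm
    _ = _ := by
        simp only [Fintype.sum_prod_type]
        refine Finset.sum_congr rfl fun p _ => Finset.sum_congr rfl fun q _ =>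
          Finset.sum_congr rfl fun a _ => Finset.sum_congr rfl fun b _ => ?_
        congr 1
        ring

theorem conjTranspose_sand [StarAddMonoid E] [StarModule ℂ E] (α : Matrix ι κ ℂ)
    (x : Matrix κ μ E) (β : Matrix μ ν ℂ) : (sand α x β)ᴴ = sand βᴴ xᴴ αᴴ := by
  ext i j
  simp only [Matrix.conjTranspose_apply, sand_apply, star_sum, star_smul, star_mul']
  rw [Finset.sum_comm]
  simp [mul_comm]

/-- Selecting rows and columns is multiplication by 0-1 matrices, so closure under compressions
covers reindexing and principal submatrices. -/
theorem submatrix_eq_sand [DecidableEq κ] [DecidableEq μ] (x : Matrix κ μ E) (f : ι → κ)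
    (g : ν → μ) :
    x.submatrix f g = sand ((1 : Matrix κ κ ℂ).submatrix f id) x
      ((1 : Matrix μ μ ℂ).submatrix id g) := by
  ext i j
  simp [sand_apply, Matrix.one_apply, Finset.sum_ite_eq]

theorem sand_fromBlocks {κ' μ' : Type*} [Fintype κ'] [Fintype μ']
    (α : Matrix ι κ ℂ) (α' : Matrix ι κ' ℂ) (a : Matrix κ μ E) (b : Matrix κ μ' E)
    (c : Matrix κ' μ E) (d : Matrix κ' μ' E) (β : Matrix μ ν ℂ) (β' : Matrix μ' ν ℂ) :
    sand (Matrix.fromCols α α') (Matrix.fromBlocks a b c d) (Matrix.fromRows β β')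
      = sand α a β + sand α b β' + sand α' c β + sand α' d β' := by
  ext i j
  simp only [sand_apply, Fintype.sum_sum_type, Matrix.fromCols_apply_inl, Matrix.fromCols_apply_inr,
    Matrix.fromRows_apply_inl, Matrix.fromRows_apply_inr, Matrix.fromBlocks_apply₁₁,
    Matrix.fromBlocks_apply₁₂, Matrix.fromBlocks_apply₂₁, Matrix.fromBlocks_apply₂₂,
    Finset.sum_add_distrib, Matrix.add_apply]
  abel

theorem fromRows_sand_fromCols {ι' ν' : Type*}
    (α : Matrix ι κ ℂ) (α' : Matrix ι' κ ℂ) (x : Matrix κ μ E) (β : Matrix μ ν ℂ)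
    (β' : Matrix μ ν' ℂ) :
    sand (Matrix.fromRows α α') x (Matrix.fromCols β β')
      = Matrix.fromBlocks (sand α x β) (sand α x β') (sand α' x β) (sand α' x β') := by
  ext (i | i) (j | j) <;> simp [sand_apply]

theorem fromBlocks_sand_fromBlocks {ι' κ' μ' ν' : Type*} [Fintype κ'] [Fintype μ']
    (α : Matrix ι κ ℂ) (α' : Matrix ι' κ' ℂ) (a : Matrix κ μ E) (b : Matrix κ μ' E)
    (c : Matrix κ' μ E) (d : Matrix κ' μ' E) (β : Matrix μ ν ℂ) (β' : Matrix μ' ν' ℂ) :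
    sand (Matrix.fromBlocks α 0 0 α') (Matrix.fromBlocks a b c d) (Matrix.fromBlocks β 0 0 β')
      = Matrix.fromBlocks (sand α a β) (sand α b β') (sand α' c β) (sand α' d β') := by
  ext (i | i) (j | j) <;> simp [sand_apply]

end Sand

/-! ### Amplifications and scalar matrix products. -/

section Amp

variable {ι κ ν E : Type*} [AddCommGroup E] [Module ℂ E]

theorem amp_apply (φ : E →ₗ[ℂ] Matrix κ κ ℂ) (x : Matrix ι ι E) (p q : ι × κ) :
    amp φ x p q = φ (x p.1 q.1) p.2 q.2 := rfl

theorem amp_sub (φ : E →ₗ[ℂ] Matrix κ κ ℂ) (x y : Matrix ι ι E) :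
    amp φ (x - y) = amp φ x - amp φ y := by
  ext p q; simp [amp_apply]

theorem amp_smul (φ : E →ₗ[ℂ] Matrix κ κ ℂ) (c : ℂ) (x : Matrix ι ι E) :
    amp φ (c • x) = c • amp φ x := by
  ext p q; simp [amp_apply]

theorem smul_amp (φ : E →ₗ[ℂ] Matrix κ κ ℂ) (c : ℂ) (x : Matrix ι ι E) :
    amp (c • φ) x = c • amp φ x := by
  ext p q; simp [amp_apply]

theorem amp_sand [Fintype ι] [Fintype κ] [DecidableEq κ] (φ : E →ₗ[ℂ] Matrix κ κ ℂ)
    (α : Matrix ν ι ℂ) (x : Matrix ι ι E) (β : Matrix ι ν ℂ) :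
    amp φ (sand α x β) = (α ⊗ₖ (1 : Matrix κ κ ℂ)) * amp φ x * (β ⊗ₖ (1 : Matrix κ κ ℂ)) := by
  ext ⟨i, a⟩ ⟨j, b⟩
  simp only [amp_apply, sand_apply, map_sum, map_smul, Matrix.sum_apply, Matrix.smul_apply,
    Matrix.mul_apply, Fintype.sum_prod_type, Matrix.kroneckerMap_apply, Matrix.one_apply, mul_ite,
    ite_mul, mul_one, mul_zero, zero_mul, Finset.sum_ite_eq, Finset.sum_ite_eq', Finset.mem_univ,
    if_true, smul_eq_mul, Finset.sum_mul]
  rw [Finset.sum_comm]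
  refine Finset.sum_congr rfl fun p _ => Finset.sum_congr rfl fun q _ => ?_
  ring

end Amp

set_option linter.unusedSectionVars false

/-! ### Systems of positive balls -/

/-- Sets of self-adjoint matrices (the positive parts of the unit balls) that are closed under
compressions by contractive scalar matrices and under direct sums. -/
structure BallSystem (X : Type*) [AddCommGroup X] [Module ℂ X] [StarAddMonoid X] where
  ball : ∀ (ι : Type) [Fintype ι] [DecidableEq ι], Set (Matrix ι ι X)
  conjTranspose_eq : ∀ {ι : Type} [Fintype ι] [DecidableEq ι] {a : Matrix ι ι X},
    a ∈ ball ι → aᴴ = a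
  compress : ∀ {ι κ : Type} [Fintype ι] [DecidableEq ι] [Fintype κ] [DecidableEq κ]
    (γ : Matrix κ ι ℂ) {a : Matrix κ κ X}, (1 - γᴴ * γ).PosSemidef → a ∈ ball κ →
    sand γᴴ a γ ∈ ball ι
  directSum : ∀ {ι κ : Type} [Fintype ι] [DecidableEq ι] [Fintype κ] [DecidableEq κ]
    {a : Matrix ι ι X} {b : Matrix κ κ X}, a ∈ ball ι → b ∈ ball κ →
    Matrix.fromBlocks a 0 0 b ∈ ball (ι ⊕ κ)

namespace BallSystem

variable {X : Type*} [AddCommGroup X] [Module ℂ X] [StarAddMonoid X] [StarModule ℂ X]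
  (S : BallSystem X) {ι κ : Type} [Fintype ι] [DecidableEq ι] [Fintype κ] [DecidableEq κ]

/-- The cone generated by the ball. -/
def cone (ι : Type) [Fintype ι] [DecidableEq ι] : Set (Matrix ι ι X) :=
  {x | ∃ t : ℝ, 0 ≤ t ∧ ∃ a ∈ S.ball ι, x = (t : ℂ) • a}

/-- `x` is dominated by `t` times the ball. -/
def Dom (t : ℝ) (x : Matrix ι ι X) : Prop :=
  ∃ a ∈ S.ball ι, ∃ b ∈ S.ball ι, Matrix.fromBlocks ((t : ℂ) • a) x xᴴ ((t : ℂ) • b) ∈ S.cone (ι ⊕ ι)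

/-- Every element is dominated by a multiple of the ball. -/
def Absorbing : Prop := ∀ x : X, ∃ t : ℝ, 0 ≤ t ∧ S.Dom t (Matrix.of fun _ _ : Unit => x)

variable {S}

theorem mem_cone_of_mem_ball {a : Matrix ι ι X} (ha : a ∈ S.ball ι) : a ∈ S.cone ι :=
  ⟨1, zero_le_one, a, ha, by simp⟩

theorem smul_mem_cone {x : Matrix ι ι X} {t : ℝ} (ht : 0 ≤ t) (hx : x ∈ S.cone ι) :
    (t : ℂ) • x ∈ S.cone ι := by
  obtain ⟨s, hs, a, ha, rfl⟩ := hx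
  exact ⟨t * s, mul_nonneg ht hs, a, ha, by rw [smul_smul]; push_cast; rfl⟩

theorem conjTranspose_eq_of_mem_cone {x : Matrix ι ι X} (hx : x ∈ S.cone ι) : xᴴ = x := by
  obtain ⟨s, hs, a, ha, rfl⟩ := hx
  rw [Matrix.conjTranspose_smul, S.conjTranspose_eq ha]
  simp

theorem sand_mem_cone (γ : Matrix κ ι ℂ) {x : Matrix κ κ X} (hx : x ∈ S.cone κ) :
    sand γᴴ x γ ∈ S.cone ι := by
  obtain ⟨s, hs, a, ha, rfl⟩ := hx
  -- Dividing by `‖γ‖ + 1` makes `γ` contractive, also when `γ = 0`.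
  set c : ℝ := ‖γ‖ + 1 with hc
  have hc0 : 0 < c := by positivity
  have hcc : (c : ℂ) ≠ 0 := by exact_mod_cast hc0.ne'
  have h1 : ‖((c⁻¹ : ℝ) : ℂ) • γ‖ ≤ 1 := by
    rw [norm_smul, Complex.norm_real, Real.norm_of_nonneg (by positivity), inv_mul_le_iff₀ hc0]
    linarith
  refine ⟨s * c ^ 2, by positivity, _,
    S.compress _ ((norm_le_one_iff_posSemidef _).1 h1) ha, ?_⟩
  rw [Matrix.conjTranspose_smul, smul_sand, sand_smul_right, sand_smul, smul_smul, smul_smul]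
  congr 1
  simp only [Complex.ofReal_mul, Complex.ofReal_pow, Complex.ofReal_inv, RCLike.star_def, map_inv₀,
    Complex.conj_ofReal]
  field_simp

theorem fromBlocks_mem_cone {x : Matrix ι ι X} {y : Matrix κ κ X} (hx : x ∈ S.cone ι)
    (hy : y ∈ S.cone κ) : Matrix.fromBlocks x 0 0 y ∈ S.cone (ι ⊕ κ) := by
  obtain ⟨s, hs, a, ha, rfl⟩ := hx
  obtain ⟨t, ht, b, hb, rfl⟩ := hy
  have h := sand_mem_cone (Matrix.fromBlocks ((√s : ℂ) • (1 : Matrix ι ι ℂ)) 0 0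
    ((√t : ℂ) • (1 : Matrix κ κ ℂ))) (mem_cone_of_mem_ball (S.directSum ha hb))
  have e1 : (√s : ℂ) * √s = s := by exact_mod_cast Real.mul_self_sqrt hs
  have e2 : (√t : ℂ) * √t = t := by exact_mod_cast Real.mul_self_sqrt ht
  simp only [Matrix.fromBlocks_conjTranspose, Matrix.conjTranspose_zero,
    fromBlocks_sand_fromBlocks] at h
  simpa [smul_sand, sand_smul_right, one_sand_one, sand_zero, smul_smul, e1, e2, -Complex.coe_smul] using h

/-- The sum is the compression of the direct sum by the column `(1, 1)`. Convexity of the cone thus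
needs no axiom of its own. -/
theorem add_mem_cone {x y : Matrix ι ι X} (hx : x ∈ S.cone ι) (hy : y ∈ S.cone ι) :
    x + y ∈ S.cone ι := by
  have h := sand_mem_cone (Matrix.fromRows (1 : Matrix ι ι ℂ) (1 : Matrix ι ι ℂ))
    (fromBlocks_mem_cone hx hy)
  rw [Matrix.conjTranspose_fromRows_eq_fromCols_conjTranspose, sand_fromBlocks] at h
  simpa [one_sand_one, sand_zero] using h

theorem submatrix_mem_cone {x : Matrix κ κ X} (hx : x ∈ S.cone κ) (f : ι → κ) :
    x.submatrix f f ∈ S.cone ι := by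
  rw [submatrix_eq_sand]
  convert sand_mem_cone ((1 : Matrix κ κ ℂ).submatrix id f) hx using 2
  simp

theorem submatrix_mem_ball {x : Matrix κ κ X} (hx : x ∈ S.ball κ) (e : ι ≃ κ) :
    x.submatrix e e ∈ S.ball ι := by
  rw [submatrix_eq_sand]
  have h := S.compress ((1 : Matrix κ κ ℂ).submatrix id e) ?_ hx
  · convert h using 2
    simp
  · have e1 : ((1 : Matrix κ κ ℂ).submatrix id e)ᴴ * (1 : Matrix κ κ ℂ).submatrix id e = 1 := by
      rw [Matrix.conjTranspose_submatrix, Matrix.conjTranspose_one]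
      ext i j
      simp [Matrix.mul_apply, Matrix.one_apply]
    rw [e1, sub_self]
    exact Matrix.PosSemidef.zero

theorem smul_mem_ball {a : Matrix ι ι X} (ha : a ∈ S.ball ι) {t : ℝ} (h0 : 0 ≤ t) (h1 : t ≤ 1) :
    (t : ℂ) • a ∈ S.ball ι := by
  have e1 : (√t : ℂ) * √t = t := by exact_mod_cast Real.mul_self_sqrt h0
  have h := S.compress ((√t : ℂ) • (1 : Matrix ι ι ℂ)) ?_ ha
  · simpa [smul_sand, sand_smul_right, one_sand_one, smul_smul, e1, -Complex.coe_smul] using h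
  · rw [← norm_le_one_iff_posSemidef, ← Matrix.diagonal_one, ← Matrix.diagonal_smul,
      Matrix.l2_opNorm_diagonal]
    refine (pi_norm_le_iff_of_nonneg zero_le_one).2 fun i => ?_
    simp only [Pi.smul_apply, smul_eq_mul, mul_one, Complex.norm_real]
    rw [Real.norm_of_nonneg (Real.sqrt_nonneg _)]
    exact Real.sqrt_le_one.2 h1

/-- A multiple of the ball, in terms of a cone element. -/
theorem exists_eq_smul_of_le {x : Matrix ι ι X} {s t : ℝ} (hs : 0 ≤ s) (hst : s ≤ t)
    {a : Matrix ι ι X} (ha : a ∈ S.ball ι) (hx : x = (s : ℂ) • a) :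
    ∃ b ∈ S.ball ι, x = (t : ℂ) • b := by
  rcases (hs.trans hst).eq_or_lt with h | h
  · have : s = 0 := le_antisymm (hst.trans h.ge) hs
    exact ⟨a, ha, by rw [hx, this, ← h]⟩
  · refine ⟨_, smul_mem_ball ha (div_nonneg hs h.le) ((div_le_one h).2 hst), ?_⟩
    rw [hx, smul_smul]
    congr 1
    have : (t : ℂ) ≠ 0 := by exact_mod_cast h.ne'
    push_cast
    field_simp

/-- The diagonal blocks are principal submatrices, hence multiples of ball elements, and the larger
of the two multiples serves both. -/
theorem exists_dom_of_mem_cone {x c d : Matrix ι ι X}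
    (h : Matrix.fromBlocks c x xᴴ d ∈ S.cone (ι ⊕ ι)) : ∃ t : ℝ, 0 ≤ t ∧ S.Dom t x := by
  have hc : c ∈ S.cone ι := submatrix_mem_cone h Sum.inl
  have hd : d ∈ S.cone ι := submatrix_mem_cone h Sum.inr
  obtain ⟨s, hs, a, ha, hca⟩ := hc
  obtain ⟨t, ht, b, hb, hdb⟩ := hd
  obtain ⟨a', ha', hca'⟩ := exists_eq_smul_of_le hs (le_max_left s t) ha hca
  obtain ⟨b', hb', hdb'⟩ := exists_eq_smul_of_le ht (le_max_right s t) hb hdb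
  exact ⟨max s t, hs.trans (le_max_left _ _), a', ha', b', hb', by rw [← hca', ← hdb']; exact h⟩

theorem Dom.smul {x : Matrix ι ι X} {s : ℝ} (h : S.Dom s x) {t : ℝ} (ht : 0 ≤ t) :
    S.Dom (t * s) ((t : ℂ) • x) := by
  obtain ⟨a, ha, b, hb, h⟩ := h
  refine ⟨a, ha, b, hb, ?_⟩
  have h := smul_mem_cone ht h
  simpa [Matrix.fromBlocks_smul, smul_smul, Matrix.conjTranspose_smul, -Complex.coe_smul] using h

/-- Compress the dominating block matrix by `α ⊕ β`; the two sides may therefore use different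
contractions. -/
theorem Dom.sand {x : Matrix κ κ X} {s : ℝ} (h : S.Dom s x) (α β : Matrix κ ι ℂ)
    (hα : (1 - αᴴ * α).PosSemidef) (hβ : (1 - βᴴ * β).PosSemidef) :
    S.Dom s (sand αᴴ x β) := by
  obtain ⟨a, ha, b, hb, h⟩ := h
  refine ⟨_, S.compress α hα ha, _, S.compress β hβ hb, ?_⟩
  have h := sand_mem_cone (Matrix.fromBlocks α 0 0 β) h
  simp only [Matrix.fromBlocks_conjTranspose, Matrix.conjTranspose_zero,
    fromBlocks_sand_fromBlocks] at h
  simpa [sand_smul, conjTranspose_sand, -Complex.coe_smul] using h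

theorem Dom.submatrix {x : Matrix κ κ X} {s : ℝ} (h : S.Dom s x) (e : ι ≃ κ) :
    S.Dom s (x.submatrix e e) := by
  obtain ⟨a, ha, b, hb, h⟩ := h
  refine ⟨_, submatrix_mem_ball ha e, _, submatrix_mem_ball hb e, ?_⟩
  convert submatrix_mem_cone h (Sum.map e e) using 1
  ext (i | i) (j | j) <;> rfl

/-- In an absorbing system every matrix is dominated. -/
theorem Absorbing.exists_dom (hS : S.Absorbing) (x : Matrix ι ι X) :
    ∃ t : ℝ, 0 ≤ t ∧ S.Dom t x := by
  suffices h : ∃ c d, Matrix.fromBlocks c x xᴴ d ∈ S.cone (ι ⊕ ι) by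
    obtain ⟨c, d, h⟩ := h
    exact exists_dom_of_mem_cone h
  -- A ball system may be empty. Absorption supplies some element, and its compression by `0` puts
  -- `0` in the cone.
  have hzero : ∃ c d, Matrix.fromBlocks c (0 : Matrix ι ι X) 0ᴴ d ∈ S.cone (ι ⊕ ι) := by
    obtain ⟨t, ht, a, ha, b, hb, h⟩ := hS 0
    have h0 := sand_mem_cone (0 : Matrix _ (ι ⊕ ι) ℂ) h
    refine ⟨0, 0, ?_⟩
    rw [sand_zero_right] at h0
    simpa using h0
  have hadd : ∀ x y : Matrix ι ι X, (∃ c d, Matrix.fromBlocks c x xᴴ d ∈ S.cone (ι ⊕ ι)) →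
      (∃ c d, Matrix.fromBlocks c y yᴴ d ∈ S.cone (ι ⊕ ι)) →
      ∃ c d, Matrix.fromBlocks c (x + y) (x + y)ᴴ d ∈ S.cone (ι ⊕ ι) := by
    rintro x y ⟨c, d, h⟩ ⟨c', d', h'⟩
    refine ⟨c + c', d + d', ?_⟩
    have := add_mem_cone h h'
    rwa [Matrix.fromBlocks_add, ← Matrix.conjTranspose_add] at this
  have hsingle : ∀ (i j : ι) (y : X),
      ∃ c d, Matrix.fromBlocks c (Matrix.single i j y) (Matrix.single i j y)ᴴ d
        ∈ S.cone (ι ⊕ ι) := by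
    intro i j y
    obtain ⟨t, ht, a, ha, b, hb, h⟩ := hS y
    have h := sand_mem_cone (Matrix.fromBlocks (Matrix.single () i (1 : ℂ)) 0 0
      (Matrix.single () j (1 : ℂ))) h
    simp only [Matrix.fromBlocks_conjTranspose, Matrix.conjTranspose_zero,
      fromBlocks_sand_fromBlocks] at h
    -- A matrix with one nonzero entry is a compression of the `1 × 1` matrix of that entry, with
    -- different unit vectors on the two sides.
    have e : sand (Matrix.single () i (1 : ℂ))ᴴ (Matrix.of fun _ _ : Unit => y)
        (Matrix.single () j (1 : ℂ)) = Matrix.single i j y := by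
      ext k l
      simp [sand_apply, Matrix.single_apply, ite_and]
      split_ifs <;> simp
    have e' := congrArg Matrix.conjTranspose e
    rw [conjTranspose_sand, Matrix.conjTranspose_conjTranspose] at e'
    rw [e, e'] at h
    exact ⟨_, _, h⟩
  rw [Matrix.matrix_eq_sum_single x]
  refine Finset.sum_induction _
    (fun x => ∃ c d, Matrix.fromBlocks c x xᴴ d ∈ S.cone (ι ⊕ ι)) hadd hzero fun i _ => ?_
  exact Finset.sum_induction _
    (fun x => ∃ c d, Matrix.fromBlocks c x xᴴ d ∈ S.cone (ι ⊕ ι)) hadd hzero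
    fun j _ => hsingle i j _

/-- Compressing the dominating block matrix by the column `(1, 1)` gives `t a + 2 y + t b ≥ 0`.
Halve this and absorb `t a + t b` into a single multiple of the ball. -/
theorem Absorbing.exists_mem_ball (hS : S.Absorbing) (y : Matrix ι ι X) (hy : yᴴ = y) :
    ∃ t : ℝ, 0 ≤ t ∧ ∃ a ∈ S.ball ι, (t : ℂ) • a + y ∈ S.cone ι := by
  obtain ⟨t, ht, a, ha, b, hb, h⟩ := hS.exists_dom y
  have h1 := sand_mem_cone (Matrix.fromRows (1 : Matrix ι ι ℂ) (1 : Matrix ι ι ℂ)) h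
  rw [Matrix.conjTranspose_fromRows_eq_fromCols_conjTranspose, sand_fromBlocks] at h1
  simp only [Matrix.conjTranspose_one, one_sand_one, hy] at h1
  have h2 := smul_mem_cone (t := 2⁻¹) (by norm_num) h1
  obtain ⟨s, hs, c, hc, hcc⟩ := add_mem_cone (smul_mem_cone ht (mem_cone_of_mem_ball ha))
    (smul_mem_cone ht (mem_cone_of_mem_ball hb))
  refine ⟨2⁻¹ * s, by positivity, c, hc, ?_⟩
  convert h2 using 1
  push_cast
  rw [← smul_smul, ← hcc]
  simp only [smul_add]
  have : y = (2⁻¹ : ℂ) • y + (2⁻¹ : ℂ) • y := by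
    rw [← add_smul]; norm_num
  nth_rewrite 1 [this]
  abel

theorem Absorbing.zero_mem_cone (hS : S.Absorbing) : (0 : Matrix ι ι X) ∈ S.cone ι := by
  obtain ⟨t, ht, a, ha, h⟩ := hS.exists_mem_ball (0 : Matrix ι ι X) (by simp)
  exact ⟨0, le_rfl, a, ha, by simp⟩

end BallSystem

/-- Over `ℂ` a form with real values is Hermitian, by polarisation. -/
theorem posSemidef_of_form {ι : Type*} [Fintype ι] [DecidableEq ι] {A : Matrix ι ι ℂ}
    (h : ∀ x : ι → ℂ, 0 ≤ star x ⬝ᵥ A *ᵥ x) : A.PosSemidef := by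
  refine Matrix.PosSemidef.of_dotProduct_mulVec_nonneg ?_ h
  rw [← Matrix.isSymmetric_toEuclideanLin_iff, LinearMap.isSymmetric_iff_inner_map_self_real]
  intro v
  have h1 := h v.ofLp
  have e : inner ℂ (Matrix.toEuclideanLin A v) v = star (star v.ofLp ⬝ᵥ A *ᵥ v.ofLp) := by
    rw [EuclideanSpace.inner_eq_star_dotProduct, dotProduct_comm, ← Matrix.star_dotProduct]
    rfl
  have him : (star v.ofLp ⬝ᵥ A *ᵥ v.ofLp).im = 0 := (Complex.le_def.1 h1).2.symm
  rw [e, Complex.conj_eq_iff_im]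
  simp [him]

/-! ### Block maps -/

section BlockMap

variable {X : Type*} [AddCommGroup X] [Module ℂ X] {κ : Type*}

/-- The map `x ↦ [[U x, F x], [G x, U' x]]`. -/
def blockMap (U F G U' : X →ₗ[ℂ] Matrix κ κ ℂ) : X →ₗ[ℂ] Matrix (κ ⊕ κ) (κ ⊕ κ) ℂ where
  toFun x := Matrix.fromBlocks (U x) (F x) (G x) (U' x)
  map_add' x y := by simp [Matrix.fromBlocks_add]
  map_smul' c x := by simp [Matrix.fromBlocks_smul]

theorem blockMap_apply (U F G U' : X →ₗ[ℂ] Matrix κ κ ℂ) (x : X) :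
    blockMap U F G U' x = Matrix.fromBlocks (U x) (F x) (G x) (U' x) := rfl

variable [StarAddMonoid X] [StarModule ℂ X]

/-- The adjoint map `x ↦ (F x^*)^*`. -/
def adjMap (F : X →ₗ[ℂ] Matrix κ κ ℂ) : X →ₗ[ℂ] Matrix κ κ ℂ where
  toFun x := (F (star x))ᴴ
  map_add' x y := by simp
  map_smul' c x := by simp [star_smul, Matrix.conjTranspose_smul]

theorem adjMap_apply (F : X →ₗ[ℂ] Matrix κ κ ℂ) (x : X) : adjMap F x = (F (star x))ᴴ := rfl

theorem amp_adjMap {ι : Type*} (F : X →ₗ[ℂ] Matrix κ κ ℂ) (x : Matrix ι ι X) :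
    amp (adjMap F) xᴴ = (amp F x)ᴴ := by
  ext p q; simp [amp_apply, adjMap_apply]

end BlockMap

namespace BallSystem

/-! ### Complete positivity and bounds relative to a ball system. -/

section Maps

variable {X : Type*} [AddCommGroup X] [Module ℂ X] [StarAddMonoid X] [StarModule ℂ X]
  (S : BallSystem X) {κ : Type*} [Fintype κ] [DecidableEq κ]

/-- Complete positivity with respect to a ball system. -/
def PosMap (F : X →ₗ[ℂ] Matrix κ κ ℂ) : Prop :=
  ∀ (ι : Type) [Fintype ι] [DecidableEq ι], ∀ a ∈ S.cone ι, (amp F a).PosSemidef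

/-- `F` is at most `r` on the balls. -/
def BoundedBy (r : ℝ) (F : X →ₗ[ℂ] Matrix κ κ ℂ) : Prop :=
  ∀ (ι : Type) [Fintype ι] [DecidableEq ι], ∀ a ∈ S.ball ι,
    ((r : ℂ) • (1 : Matrix (ι × κ) (ι × κ) ℂ) - amp F a).PosSemidef

variable {S}

theorem PosMap.of_ball {F : X →ₗ[ℂ] Matrix κ κ ℂ}
    (h : ∀ (ι : Type) [Fintype ι] [DecidableEq ι], ∀ a ∈ S.ball ι, (amp F a).PosSemidef) :
    S.PosMap F := by
  rintro ι _ _ _ ⟨t, ht, a, ha, rfl⟩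
  rw [amp_smul]
  exact (h ι a ha).smul (by exact_mod_cast ht)

theorem PosMap.blockMap_left {U F G U' : X →ₗ[ℂ] Matrix κ κ ℂ}
    (h : S.PosMap (blockMap U F G U')) : S.PosMap U := fun ι _ _ a ha =>
  (h ι a ha).submatrix (Prod.map id Sum.inl : ι × κ → ι × (κ ⊕ κ))

theorem PosMap.blockMap_right {U F G U' : X →ₗ[ℂ] Matrix κ κ ℂ}
    (h : S.PosMap (blockMap U F G U')) : S.PosMap U' := fun ι _ _ a ha =>
  (h ι a ha).submatrix (Prod.map id Sum.inr : ι × κ → ι × (κ ⊕ κ))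

theorem PosMap.norm_amp_le {F : X →ₗ[ℂ] Matrix κ κ ℂ} (h : S.PosMap F) {r : ℝ} (hr : 0 ≤ r)
    (hF : S.BoundedBy r F) {ι : Type} [Fintype ι] [DecidableEq ι] {a : Matrix ι ι X}
    (ha : a ∈ S.ball ι) : ‖amp F a‖ ≤ r :=
  (PosSemidef.norm_le_iff (h ι a (mem_cone_of_mem_ball ha)) hr).2 (hF ι a ha)

/-- The off-diagonal corner of a completely positive map is bounded by the diagonal. -/
theorem PosMap.norm_amp_corner_le {U F U' : X →ₗ[ℂ] Matrix κ κ ℂ}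
    (h : S.PosMap (blockMap U F (adjMap F) U')) {r : ℝ} (hr : 0 ≤ r) (hU : S.BoundedBy r U)
    (hU' : S.BoundedBy r U') {ι : Type} [Fintype ι] [DecidableEq ι] {x : Matrix ι ι X} {t : ℝ}
    (ht : 0 ≤ t) (hx : S.Dom t x) : ‖amp F x‖ ≤ r * t := by
  obtain ⟨a, ha, b, hb, hab⟩ := hx
  -- Of the four-fold block matrix only the indices on which the two block decompositions agree are
  -- kept. What remains is `[[t U a, F x], [(F x)ᴴ, t U' b]]`.
  have h1 := (h _ _ hab).submatrix
    (Sum.elim (Prod.map Sum.inl Sum.inl) (Prod.map Sum.inr Sum.inr) :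
      (ι × κ) ⊕ (ι × κ) → (ι ⊕ ι) × (κ ⊕ κ))
  have e : (amp (blockMap U F (adjMap F) U')
      (Matrix.fromBlocks ((t : ℂ) • a) x xᴴ ((t : ℂ) • b))).submatrix
      (Sum.elim (Prod.map Sum.inl Sum.inl) (Prod.map Sum.inr Sum.inr) :
      (ι × κ) ⊕ (ι × κ) → (ι ⊕ ι) × (κ ⊕ κ))
      (Sum.elim (Prod.map Sum.inl Sum.inl) (Prod.map Sum.inr Sum.inr) :
      (ι × κ) ⊕ (ι × κ) → (ι ⊕ ι) × (κ ⊕ κ)) =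
      Matrix.fromBlocks ((t : ℂ) • amp U a) (amp F x) (amp F x)ᴴ ((t : ℂ) • amp U' b) := by
    rw [← amp_adjMap, ← amp_smul, ← amp_smul]
    ext (p | p) (q | q) <;> rfl
  rw [e] at h1
  refine norm_le_of_posSemidef_fromBlocks (mul_nonneg hr ht) h1 ?_ ?_
  · rw [norm_smul, Complex.norm_real, Real.norm_of_nonneg ht, mul_comm]
    exact mul_le_mul_of_nonneg_right (h.blockMap_left.norm_amp_le hr hU ha) ht
  · rw [norm_smul, Complex.norm_real, Real.norm_of_nonneg ht, mul_comm]
    exact mul_le_mul_of_nonneg_right (h.blockMap_right.norm_amp_le hr hU' hb) ht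

end Maps

/-! ### The pairing of maps with matrices -/

section Pairing

variable {X : Type*} [AddCommGroup X] [Module ℂ X] {κ : Type*} [Fintype κ]

/-- The pairing of `F : X → M_κ` with `x ∈ M_κ(X)`. -/
def pairing (F : X →ₗ[ℂ] Matrix κ κ ℂ) : Matrix κ κ X →ₗ[ℂ] ℂ where
  toFun x := ∑ i, ∑ j, F (x i j) i j
  map_add' x y := by simp [Finset.sum_add_distrib]
  map_smul' c x := by simp [Finset.mul_sum]

theorem pairing_apply (F : X →ₗ[ℂ] Matrix κ κ ℂ) (x : Matrix κ κ X) :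
    pairing F x = ∑ i, ∑ j, F (x i j) i j := rfl

/-- The form of `amp F x` at two vectors is the pairing of `F` with a compression of `x`, the
vectors being read as matrices. Complete positivity and norm bounds thereby become conditions on one
functional on `M_κ(X)`. -/
theorem pairing_sand {ι : Type*} [Fintype ι] (F : X →ₗ[ℂ] Matrix κ κ ℂ) (α β : Matrix ι κ ℂ)
    (x : Matrix ι ι X) :
    pairing F (sand αᴴ x β) =
      star (fun p : ι × κ => α p.1 p.2) ⬝ᵥ amp F x *ᵥ (fun p : ι × κ => β p.1 p.2) := by
  simp only [pairing_apply, sand_apply, dotProduct, Matrix.mulVec, map_sum, map_smul,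
    Matrix.sum_apply, Matrix.smul_apply, smul_eq_mul, Fintype.sum_prod_type, Finset.mul_sum,
    amp_apply, Pi.star_apply, Matrix.conjTranspose_apply]
  calc _ = ∑ a : κ, ∑ p : ι, ∑ q : ι, ∑ b : κ, star (α p a) * β q b * F (x p q) a b := by
        refine Finset.sum_congr rfl fun a _ => ?_
        rw [Finset.sum_comm]
        refine Finset.sum_congr rfl fun p _ => ?_
        rw [Finset.sum_comm]
    _ = _ := by
        rw [Finset.sum_comm]
        refine Finset.sum_congr rfl fun a _ => Finset.sum_congr rfl fun p _ =>
          Finset.sum_congr rfl fun q _ => Finset.sum_congr rfl fun b _ => ?_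
        ring

theorem pairing_adjMap [StarAddMonoid X] [StarModule ℂ X] (F : X →ₗ[ℂ] Matrix κ κ ℂ)
    (x : Matrix κ κ X) : pairing (adjMap F) xᴴ = star (pairing F x) := by
  simp only [pairing_apply, adjMap_apply, Matrix.conjTranspose_apply, star_star, star_sum]
  rw [Finset.sum_comm]

theorem exists_pairing_eq [DecidableEq κ] (u : Matrix κ κ X →ₗ[ℂ] ℂ) :
    ∃ U : X →ₗ[ℂ] Matrix κ κ ℂ, pairing U = u := by
  refine ⟨{ toFun := fun x => Matrix.of fun i j => u (Matrix.single i j x)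
            map_add' := fun x y => by ext i j; simp [Matrix.single_add]
            map_smul' := fun c x => by ext i j; simp [← Matrix.smul_single] }, ?_⟩
  ext x
  conv_rhs => rw [Matrix.matrix_eq_sum_single x]
  simp [pairing_apply]

end Pairing

/-! ### Hilbert–Schmidt norms and factorization. -/

theorem sum_norm_sq_eq_trace {m κ : Type*} [Fintype m] [Fintype κ] (A : Matrix m κ ℂ) :
    ((∑ p : m × κ, ‖A p.1 p.2‖ ^ 2 : ℝ) : ℂ) = (Aᴴ * A).trace := by
  simp only [Matrix.trace, Matrix.diag_apply, Matrix.mul_apply, Matrix.conjTranspose_apply,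
    Fintype.sum_prod_type]
  rw [Finset.sum_comm]
  push_cast
  simp only [RCLike.star_def, Complex.conj_mul']

open scoped MatrixOrder in
theorem exists_eq_conjTranspose_mul_self {κ : Type*} [Fintype κ] [DecidableEq κ]
    {A : Matrix κ κ ℂ} (hA : A.PosSemidef) : ∃ g : Matrix κ κ ℂ, A = gᴴ * g :=
  CStarAlgebra.nonneg_iff_eq_star_mul_self.1 hA.nonneg

/-- A rectangular matrix factors as a contraction times an invertible matrix with almost the same
Hilbert-Schmidt norm. -/
theorem exists_factorization {m κ : Type*} [Fintype m] [Fintype κ] [DecidableEq κ]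
    (γ : Matrix m κ ℂ) {ε : ℝ} (hε : 0 < ε) :
    ∃ g h : Matrix κ κ ℂ, h * g = 1 ∧ g * h = 1 ∧ (1 - (γ * h)ᴴ * (γ * h)).PosSemidef ∧
      ∑ p : κ × κ, ‖g p.1 p.2‖ ^ 2 = ∑ p : m × κ, ‖γ p.1 p.2‖ ^ 2 + ε * Fintype.card κ := by
  -- An approximate polar decomposition: the perturbation makes `g` invertible even if `γ` has a
  -- kernel, and costs `ε` times the trace of the identity in the Hilbert–Schmidt norm.
  have hpd : (γᴴ * γ + (ε : ℂ) • (1 : Matrix κ κ ℂ)).PosDef :=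
    Matrix.PosDef.posSemidef_add (Matrix.posSemidef_conjTranspose_mul_self γ)
      (Matrix.PosDef.one.smul (by exact_mod_cast hε))
  obtain ⟨g, hg⟩ : ∃ g : Matrix κ κ ℂ, γᴴ * γ + (ε : ℂ) • (1 : Matrix κ κ ℂ) = gᴴ * g :=
    exists_eq_conjTranspose_mul_self hpd.posSemidef
  have hdet : IsUnit g.det := by
    have h1 := hpd.det_pos
    rw [hg, Matrix.det_mul] at h1
    exact isUnit_iff_ne_zero.2 (right_ne_zero_of_mul h1.ne')
  refine ⟨g, g⁻¹, Matrix.nonsing_inv_mul g hdet, Matrix.mul_nonsing_inv g hdet, ?_, ?_⟩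
  · have e : 1 - (γ * g⁻¹)ᴴ * (γ * g⁻¹) = (ε : ℂ) • ((g⁻¹)ᴴ * g⁻¹) := by
      have h1 : γᴴ * γ = gᴴ * g - (ε : ℂ) • (1 : Matrix κ κ ℂ) := by rw [← hg]; abel
      have h2 : (g⁻¹)ᴴ * (gᴴ * g) * g⁻¹ = 1 := by
        rw [← mul_assoc, ← Matrix.conjTranspose_mul, mul_assoc, Matrix.mul_nonsing_inv g hdet]
        simp
      rw [Matrix.conjTranspose_mul, Matrix.mul_assoc, ← Matrix.mul_assoc γᴴ, h1, Matrix.sub_mul,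
        Matrix.mul_sub, ← Matrix.mul_assoc, h2]
      simp
    rw [e]
    exact (Matrix.posSemidef_conjTranspose_mul_self _).smul (by exact_mod_cast hε.le)
  · have h1 := sum_norm_sq_eq_trace g
    rw [← hg, Matrix.trace_add, ← sum_norm_sq_eq_trace γ, Matrix.trace_smul, Matrix.trace_one] at h1
    simp only [smul_eq_mul] at h1
    exact_mod_cast h1

end BallSystem

namespace BallSystem

variable {X : Type*} [AddCommGroup X] [Module ℂ X] [StarAddMonoid X] [StarModule ℂ X]
  {S : BallSystem X} {κ : Type} [Fintype κ] [DecidableEq κ]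

/-! ### The extension theorem -/

variable (S) in
/-- The elements `γᴴ a γ` with `a` in the ball and `‖γ‖_HS² ≤ t`. -/
def HSBall (t : ℝ) (c : Matrix κ κ X) : Prop :=
  ∃ (m : Type) (_ : Fintype m) (_ : DecidableEq m) (γ : Matrix m κ ℂ), ∃ a ∈ S.ball m,
    c = sand γᴴ a γ ∧ ∑ p : m × κ, ‖γ p.1 p.2‖ ^ 2 ≤ t

/-- Stacking the factors adds squared Hilbert–Schmidt norms, and the direct sum of the ball elements
stays in the ball. -/
theorem HSBall.add {s t : ℝ} {c d : Matrix κ κ X} (hc : S.HSBall s c) (hd : S.HSBall t d) :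
    S.HSBall (s + t) (c + d) := by
  obtain ⟨m, _, _, γ, a, ha, rfl, hγ⟩ := hc
  obtain ⟨n, _, _, δ, b, hb, rfl, hδ⟩ := hd
  refine ⟨m ⊕ n, inferInstance, inferInstance, Matrix.fromRows γ δ, _, S.directSum ha hb, ?_, ?_⟩
  · rw [Matrix.conjTranspose_fromRows_eq_fromCols_conjTranspose, sand_fromBlocks]
    simp [sand_zero]
  · rw [Fintype.sum_prod_type] at *
    simp only [Fintype.sum_sum_type, Matrix.fromRows_apply_inl, Matrix.fromRows_apply_inr]
    exact add_le_add hγ hδ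

theorem HSBall.smul {s t : ℝ} (hs : 0 ≤ s) {c : Matrix κ κ X} (hc : S.HSBall t c) :
    S.HSBall (s * t) ((s : ℂ) • c) := by
  obtain ⟨m, _, _, γ, a, ha, rfl, hγ⟩ := hc
  have e1 : (√s : ℂ) * √s = s := by exact_mod_cast Real.mul_self_sqrt hs
  refine ⟨m, inferInstance, inferInstance, (√s : ℂ) • γ, a, ha, ?_, ?_⟩
  · rw [Matrix.conjTranspose_smul, smul_sand, sand_smul_right, smul_smul, RCLike.star_def,
      Complex.conj_ofReal, e1]
  · simp only [Matrix.smul_apply, norm_smul, mul_pow, ← Finset.mul_sum, Complex.norm_real,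
      Real.norm_of_nonneg (Real.sqrt_nonneg s), Real.sq_sqrt hs]
    exact mul_le_mul_of_nonneg_left hγ hs

theorem hsBall_zero (hS : S.Absorbing) {t : ℝ} (ht : 0 ≤ t) : S.HSBall t (0 : Matrix κ κ X) := by
  obtain ⟨s, -, a, ha, -⟩ := hS.exists_mem_ball (0 : Matrix κ κ X) (by simp)
  exact ⟨κ, inferInstance, inferInstance, 0, a, ha, by simp [sand_zero_right], by simpa using ht⟩

theorem HSBall.of_mem_ball {a : Matrix κ κ X} (ha : a ∈ S.ball κ) :
    S.HSBall (∑ p : κ × κ, ‖(1 : Matrix κ κ ℂ) p.1 p.2‖ ^ 2) a :=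
  ⟨κ, inferInstance, inferInstance, 1, a, ha, by simp [one_sand_one], le_rfl⟩

/-- The nonnegativity behind the extension. Factoring `γ` and `δ` into contractions times invertible
`κ × κ` matrices `g`, `k` writes `x` as `gᴴ y k` with `y` dominated by `1`. The pairing is then a
form of `amp F y` at vectors of almost the prescribed norms. As `y` is again `κ × κ`, the bound on
`F` is needed at size `κ` only. -/
theorem two_mul_norm_pairing_le {F : X →ₗ[ℂ] Matrix κ κ ℂ}
    (hF : ∀ x : Matrix κ κ X, S.Dom 1 x → ‖amp F x‖ ≤ 1) {s t : ℝ} {c d x : Matrix κ κ X}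
    (hc : S.HSBall s c) (hd : S.HSBall t d)
    (h : Matrix.fromBlocks c x xᴴ d ∈ S.cone (κ ⊕ κ)) : 2 * ‖pairing F x‖ ≤ s + t := by
  obtain ⟨m, _, _, γ, a, ha, rfl, hγ⟩ := hc
  obtain ⟨n, _, _, δ, b, hb, rfl, hδ⟩ := hd
  refine le_of_forall_pos_le_add fun ε hε => ?_
  -- Each of the two factorizations costs `η * card κ`; the `+ 1` covers empty `κ`.
  set η : ℝ := ε / (2 * Fintype.card κ + 1) with hη
  have hη0 : 0 < η := by positivity
  have hηε : 2 * (η * Fintype.card κ) ≤ ε := by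
    have h1 : η * (2 * Fintype.card κ + 1) = ε := by rw [hη]; field_simp
    nlinarith
  obtain ⟨g, g', hg1, hg2, hg3, hg4⟩ := exists_factorization γ hη0
  obtain ⟨k, k', hk1, hk2, hk3, hk4⟩ := exists_factorization δ hη0
  have hx : x = sand gᴴ (sand g'ᴴ x k') k := by
    rw [sand_sand, ← Matrix.conjTranspose_mul, hg1, hk1, Matrix.conjTranspose_one, one_sand_one]
  have hdom : S.Dom 1 (sand g'ᴴ x k') := by
    refine ⟨_, S.compress _ hg3 ha, _, S.compress _ hk3 hb, ?_⟩
    have h := sand_mem_cone (Matrix.fromBlocks g' 0 0 k') h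
    simp only [Matrix.fromBlocks_conjTranspose, Matrix.conjTranspose_zero,
      fromBlocks_sand_fromBlocks, sand_sand] at h
    simpa [conjTranspose_sand, Matrix.conjTranspose_mul] using h
  rw [hx, pairing_sand]
  have := two_mul_norm_dotProduct_mulVec_le (hF _ hdom) (fun p : κ × κ => g p.1 p.2)
    (fun p : κ × κ => k p.1 p.2)
  rw [hg4, hk4] at this
  linarith

theorem herm_eq {c : Matrix κ κ X} (hc : cᴴ = c) : (2⁻¹ : ℂ) • (c + cᴴ) = c := by
  rw [hc, ← two_smul ℂ c, smul_smul]; norm_num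

variable (κ) in
/-- The cone of the extension problem. -/
def extensionCone (hS : S.Absorbing) :
    PointedCone ℝ (Matrix κ κ X × Matrix κ κ X × Matrix κ κ X × ℝ) where
  -- Self-adjoint parts are taken so that the real space can be all of `M_κ(X)`. The last coordinate
  -- pays for the Hilbert–Schmidt sizes of the correction terms `c`, `d`.
  carrier := {w | ∃ s t c d, S.HSBall s c ∧ S.HSBall t d ∧ s + t ≤ w.2.2.2 ∧
    Matrix.fromBlocks ((2⁻¹ : ℂ) • (w.1 + w.1ᴴ) + c) w.2.2.1 w.2.2.1ᴴ
      ((2⁻¹ : ℂ) • (w.2.1 + w.2.1ᴴ) + d) ∈ S.cone (κ ⊕ κ)}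
  add_mem' := by
    rintro w w' ⟨s, t, c, d, hc, hd, hst, h⟩ ⟨s', t', c', d', hc', hd', hst', h'⟩
    refine ⟨s + s', t + t', c + c', d + d', hc.add hc', hd.add hd', ?_, ?_⟩
    · simp only [Prod.snd_add]; linarith
    · convert add_mem_cone h h' using 1
      rw [Matrix.fromBlocks_add]
      simp only [Prod.fst_add, Prod.snd_add, Matrix.conjTranspose_add, smul_add]
      congr 1 <;> abel
  zero_mem' := by
    refine ⟨0, 0, 0, 0, hsBall_zero hS le_rfl, hsBall_zero hS le_rfl, by simp, ?_⟩
    simpa using hS.zero_mem_cone (ι := κ ⊕ κ)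
  smul_mem' := by
    rintro ⟨r, hr⟩ w ⟨s, t, c, d, hc, hd, hst, h⟩
    refine ⟨r * s, r * t, _, _, hc.smul hr, hd.smul hr, ?_, ?_⟩
    · have := mul_le_mul_of_nonneg_left hst hr
      rw [mul_add] at this
      exact this
    · have e : ∀ y : Matrix κ κ X, (⟨r, hr⟩ : NNReal) • y = (r : ℂ) • y := fun y => rfl
      convert smul_mem_cone hr h using 1
      simp only [Prod.smul_fst, Prod.smul_snd, e, Matrix.fromBlocks_smul,
        Matrix.conjTranspose_smul, RCLike.star_def, Complex.conj_ofReal, smul_add,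
        smul_comm (r : ℂ)]

/-- A map into a matrix algebra that is completely contractive with respect to a ball system is
the corner of a completely positive map whose diagonal entries are completely contractive. -/
theorem exists_posMap_corner (hS : S.Absorbing) (F : X →ₗ[ℂ] Matrix κ κ ℂ)
    (hF : ∀ x : Matrix κ κ X, S.Dom 1 x → ‖amp F x‖ ≤ 1) :
    ∃ U U' : X →ₗ[ℂ] Matrix κ κ ℂ, S.PosMap (blockMap U F (adjMap F) U') ∧
      S.BoundedBy 1 U ∧ S.BoundedBy 1 U' := by
  -- On the subspace where the diagonal coordinates vanish the functional is dictated by `F`. Its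
  -- values on the diagonal coordinates, found by extension, become `U` and `U'`.
  let f₀ : Matrix κ κ X × Matrix κ κ X × Matrix κ κ X × ℝ →ₗ[ℝ] ℝ :=
    { toFun := fun w => w.2.2.2 + 2 * (pairing F w.2.2.1).re
      map_add' := fun w w' => by simp; ring
      map_smul' := fun r w => by
        have e : pairing F (r • w.2.2.1) = r * pairing F w.2.2.1 := by
          rw [← Complex.coe_smul, map_smul, smul_eq_mul]
        simp only [Prod.smul_snd, Prod.smul_fst, e, Complex.re_ofReal_mul, smul_eq_mul,
          RingHom.id_apply]
        ring }
  let D : Submodule ℝ (Matrix κ κ X × Matrix κ κ X × Matrix κ κ X × ℝ) :=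
    { carrier := {w | w.1 = 0 ∧ w.2.1 = 0}
      add_mem' := by rintro w w' ⟨h1, h2⟩ ⟨h3, h4⟩; simp [h1, h2, h3, h4]
      zero_mem' := by simp
      smul_mem' := by rintro r w ⟨h1, h2⟩; simp [h1, h2] }
  have hnonneg : ∀ w : (⟨D, f₀.domRestrict D⟩ : _ →ₗ.[ℝ] ℝ).domain,
      (w : Matrix κ κ X × Matrix κ κ X × Matrix κ κ X × ℝ) ∈ extensionCone κ hS →
      0 ≤ (⟨D, f₀.domRestrict D⟩ : _ →ₗ.[ℝ] ℝ) w := by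
    rintro ⟨⟨y, y', x, t⟩, h1, h2⟩ ⟨s, s', c, d, hc, hd, hst, h⟩
    simp only at h1 h2 hst
    subst h1 h2
    have h := two_mul_norm_pairing_le hF hc hd (x := x) (by simpa using h)
    change 0 ≤ t + 2 * (pairing F x).re
    have := (abs_le.1 (Complex.abs_re_le_norm (pairing F x))).1
    linarith
  have hdense : ∀ w, ∃ w' : (⟨D, f₀.domRestrict D⟩ : _ →ₗ.[ℝ] ℝ).domain,
      (w' : Matrix κ κ X × Matrix κ κ X × Matrix κ κ X × ℝ) + w ∈ extensionCone κ hS := by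
    rintro ⟨y, y', x, t⟩
    have hh : ∀ y : Matrix κ κ X, ((2⁻¹ : ℂ) • (y + yᴴ))ᴴ = (2⁻¹ : ℂ) • (y + yᴴ) := by
      intro y
      rw [Matrix.conjTranspose_smul, Matrix.conjTranspose_add, Matrix.conjTranspose_conjTranspose,
        add_comm]
      simp
    obtain ⟨s, hs, a, ha, h1⟩ := hS.exists_mem_ball _ (hh y)
    obtain ⟨s', hs', a', ha', h2⟩ := hS.exists_mem_ball _ (hh y')
    set q := ∑ p : κ × κ, ‖(1 : Matrix κ κ ℂ) p.1 p.2‖ ^ 2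
    -- The off-diagonal entry is cancelled, the diagonal entries are made positive by absorption,
    -- and the real coordinate is raised to the cost of these corrections.
    refine ⟨⟨(0, 0, -x, s * q + s' * q - t), by simp [D]⟩, s * q, s' * q, (s : ℂ) • a,
      (s' : ℂ) • a', (HSBall.of_mem_ball ha).smul hs, (HSBall.of_mem_ball ha').smul hs', ?_, ?_⟩
    · simp
    · have := fromBlocks_mem_cone h1 h2
      simpa [add_comm, -Complex.coe_smul] using this
  obtain ⟨g, hg1, hg2⟩ := riesz_extension (extensionCone κ hS) _ hnonneg hdense
  have hgD : ∀ x t, g (0, 0, x, t) = t + 2 * (pairing F x).re := fun x t =>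
    hg1 ⟨(0, 0, x, t), by simp [D]⟩
  let σ : Module.Dual ℝ (Matrix κ κ X) := g.comp (LinearMap.inl ℝ _ _)
  let τ : Module.Dual ℝ (Matrix κ κ X) :=
    g.comp ((LinearMap.inr ℝ _ _).comp (LinearMap.inl ℝ _ _))
  have hg : ∀ y y' x t, g (y, y', x, t) = σ y + τ y' + (t + 2 * (pairing F x).re) := by
    intro y y' x t
    rw [← hgD x t]
    simp only [σ, τ, LinearMap.comp_apply, LinearMap.inl_apply, LinearMap.inr_apply]
    rw [← map_add, ← map_add]
    congr 1
    simp
  have hpos : ∀ s t c d y y' x, S.HSBall s c → S.HSBall t d →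
      Matrix.fromBlocks ((2⁻¹ : ℂ) • (y + yᴴ) + c) x xᴴ ((2⁻¹ : ℂ) • (y' + y'ᴴ) + d)
        ∈ S.cone (κ ⊕ κ) → 0 ≤ σ y + τ y' + (s + t + 2 * (pairing F x).re) := by
    intro s t c d y y' x hc hd h
    rw [← hg]
    exact hg2 (y, y', x, s + t) ⟨s, t, c, d, hc, hd, le_rfl, h⟩
  have h00 : S.HSBall 0 (0 : Matrix κ κ X) := hsBall_zero hS le_rfl
  have hz := hS.zero_mem_cone (ι := κ ⊕ κ)
  -- For skew-adjoint `y` the self-adjoint part is zero, so both signs of `y` lie in the cone.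
  have hσ : ∀ y : Matrix κ κ X, yᴴ = -y → σ y = 0 := by
    intro y hy
    have h1 := hpos 0 0 0 0 y 0 0 h00 h00 (by simpa [hy] using hz)
    have h2 := hpos 0 0 0 0 (-y) 0 0 h00 h00 (by simpa [hy] using hz)
    simp at h1 h2
    linarith
  have hτ : ∀ y : Matrix κ κ X, yᴴ = -y → τ y = 0 := by
    intro y hy
    have h1 := hpos 0 0 0 0 0 y 0 h00 h00 (by simpa [hy] using hz)
    have h2 := hpos 0 0 0 0 0 (-y) 0 h00 h00 (by simpa [hy] using hz)
    simp at h1 h2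
    linarith
  -- The complexification takes the real value `σ c` at self-adjoint `c`, because `σ` vanishes at
  -- the skew-adjoint `i c`.
  obtain ⟨U, hU⟩ := exists_pairing_eq (σ.extendRCLike (𝕜 := ℂ))
  obtain ⟨U', hU'⟩ := exists_pairing_eq (τ.extendRCLike (𝕜 := ℂ))
  have hUc : ∀ c : Matrix κ κ X, cᴴ = c → pairing U c = (σ c : ℂ) := by
    intro c hc
    rw [hU, Module.Dual.extendRCLike_apply, hσ (RCLike.I • c)]
    · simp
    · simp [Matrix.conjTranspose_smul, hc]
  have hUc' : ∀ c : Matrix κ κ X, cᴴ = c → pairing U' c = (τ c : ℂ) := by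
    intro c hc
    rw [hU', Module.Dual.extendRCLike_apply, hτ (RCLike.I • c)]
    · simp
    · simp [Matrix.conjTranspose_smul, hc]
  refine ⟨U, U', ?_, ?_, ?_⟩
  · intro ι _ _ a ha
    refine posSemidef_of_form fun ξ => ?_
    let α : Matrix ι κ ℂ := Matrix.of fun i k => ξ (i, Sum.inl k)
    let β : Matrix ι κ ℂ := Matrix.of fun i k => ξ (i, Sum.inr k)
    have haa := conjTranspose_eq_of_mem_cone ha
    have e : star ξ ⬝ᵥ amp (blockMap U F (adjMap F) U') a *ᵥ ξ =
        pairing U (sand αᴴ a α) + pairing F (sand αᴴ a β) +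
        (pairing (adjMap F) (sand βᴴ a α) + pairing U' (sand βᴴ a β)) := by
      simp only [pairing_sand]
      simp only [dotProduct, Matrix.mulVec, Fintype.sum_prod_type, Fintype.sum_sum_type,
        amp_apply, blockMap_apply, Matrix.fromBlocks_apply₁₁, Matrix.fromBlocks_apply₁₂,
        Matrix.fromBlocks_apply₂₁, Matrix.fromBlocks_apply₂₂, Finset.sum_add_distrib, mul_add,
        α, β, Matrix.of_apply, Pi.star_apply]
      ring
    have e2 : sand βᴴ a α = (sand αᴴ a β)ᴴ := by
      rw [conjTranspose_sand, haa, Matrix.conjTranspose_conjTranspose]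
    have hc1 : (sand αᴴ a α)ᴴ = sand αᴴ a α := by
      rw [conjTranspose_sand, haa, Matrix.conjTranspose_conjTranspose]
    have hc2 : (sand βᴴ a β)ᴴ = sand βᴴ a β := by
      rw [conjTranspose_sand, haa, Matrix.conjTranspose_conjTranspose]
    have h1 := sand_mem_cone (Matrix.fromCols α β) ha
    rw [Matrix.conjTranspose_fromCols_eq_fromRows_conjTranspose, fromRows_sand_fromCols, e2] at h1
    have h2 := hpos 0 0 0 0 (sand αᴴ a α) (sand βᴴ a β) (sand αᴴ a β) h00 h00
      (by rw [herm_eq hc1, herm_eq hc2]; simpa using h1)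
    rw [e, e2, pairing_adjMap, hUc _ hc1, hUc' _ hc2, Complex.le_def]
    simp only [Complex.add_re, Complex.add_im, Complex.ofReal_re, Complex.ofReal_im,
      RCLike.star_def, Complex.conj_re, Complex.conj_im, Complex.zero_re, Complex.zero_im]
    constructor <;> linarith
  · intro ι _ _ a ha
    refine posSemidef_of_form fun ξ => ?_
    let α : Matrix ι κ ℂ := Matrix.of fun i k => ξ (i, k)
    have hc1 : (sand αᴴ a α)ᴴ = sand αᴴ a α := by
      rw [conjTranspose_sand, S.conjTranspose_eq ha, Matrix.conjTranspose_conjTranspose]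
    -- The diagonal entry `-αᴴ a α` is cancelled by the correction `αᴴ a α` of cost `‖ξ‖²`. This
    -- gives `σ (αᴴ a α) ≤ ‖ξ‖²`.
    have h2 := hpos (∑ p, ‖ξ p‖ ^ 2) 0 (sand αᴴ a α) 0 (-sand αᴴ a α) 0 0
      ⟨ι, inferInstance, inferInstance, α, a, ha, rfl, le_rfl⟩ h00
      (by rw [herm_eq (by rw [Matrix.conjTranspose_neg, hc1])]; simpa using hz)
    have e : star ξ ⬝ᵥ amp U a *ᵥ ξ = pairing U (sand αᴴ a α) := (pairing_sand U α α a).symm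
    rw [Matrix.sub_mulVec, dotProduct_sub, e, hUc _ hc1, Matrix.smul_mulVec, Matrix.one_mulVec,
      dotProduct_smul, star_dotProduct_self, Complex.ofReal_one, one_smul, ← Complex.ofReal_sub,
      Complex.zero_le_real]
    simp at h2
    linarith
  · intro ι _ _ a ha
    refine posSemidef_of_form fun ξ => ?_
    let α : Matrix ι κ ℂ := Matrix.of fun i k => ξ (i, k)
    have hc1 : (sand αᴴ a α)ᴴ = sand αᴴ a α := by
      rw [conjTranspose_sand, S.conjTranspose_eq ha, Matrix.conjTranspose_conjTranspose]
    have h2 := hpos 0 (∑ p, ‖ξ p‖ ^ 2) 0 (sand αᴴ a α) 0 (-sand αᴴ a α) 0 h00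
      ⟨ι, inferInstance, inferInstance, α, a, ha, rfl, le_rfl⟩
      (by rw [herm_eq (c := -sand αᴴ a α) (by rw [Matrix.conjTranspose_neg, hc1])]
          simpa using hz)
    have e : star ξ ⬝ᵥ amp U' a *ᵥ ξ = pairing U' (sand αᴴ a α) := (pairing_sand U' α α a).symm
    rw [Matrix.sub_mulVec, dotProduct_sub, e, hUc' _ hc1, Matrix.smul_mulVec, Matrix.one_mulVec,
      dotProduct_smul, star_dotProduct_self, Complex.ofReal_one, one_smul, ← Complex.ofReal_sub,
      Complex.zero_le_real]
    simp at h2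
    linarith

end BallSystem

/-! ### More on scalar matrices -/

section Scalar

theorem norm_le_of_unit_form {ι : Type*} [Fintype ι] [DecidableEq ι] {A : Matrix ι ι ℂ} {r : ℝ}
    (hr : 0 ≤ r) (h : ∀ ξ η : ι → ℂ, ∑ i, ‖ξ i‖ ^ 2 ≤ 1 → ∑ i, ‖η i‖ ^ 2 ≤ 1 →
      ‖star ξ ⬝ᵥ A *ᵥ η‖ ≤ r) : ‖A‖ ≤ r := by
  refine norm_le_of_form hr fun ξ η => ?_
  set a := ∑ i, ‖ξ i‖ ^ 2 with ha
  set b := ∑ i, ‖η i‖ ^ 2 with hb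
  have ha0 : 0 ≤ a := Finset.sum_nonneg fun i _ => by positivity
  have hb0 : 0 ≤ b := Finset.sum_nonneg fun i _ => by positivity
  -- The `ε` allows normalising vectors that may vanish.
  have key : ∀ ε > 0, ‖star ξ ⬝ᵥ A *ᵥ η‖ ≤ r * ((a + ε) + (b + ε)) / 2 := by
    intro ε hε
    have hs : 0 < √(a + ε) := Real.sqrt_pos.2 (by linarith)
    have ht : 0 < √(b + ε) := Real.sqrt_pos.2 (by linarith)
    have hn : ∀ (ξ : ι → ℂ) (s : ℝ), 0 < s → ∑ i, ‖ξ i‖ ^ 2 ≤ s ^ 2 →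
        ∑ i, ‖(((s⁻¹ : ℝ) : ℂ) • ξ) i‖ ^ 2 ≤ 1 := by
      intro ξ s hs h
      simp only [Pi.smul_apply, norm_smul, mul_pow, ← Finset.mul_sum, Complex.norm_real,
        Real.norm_of_nonneg (inv_nonneg.2 hs.le), inv_pow]
      rw [inv_mul_le_iff₀ (by positivity)]
      linarith
    have h1 := h _ _ (hn ξ _ hs (by rw [Real.sq_sqrt (by linarith)]; linarith))
      (hn η _ ht (by rw [Real.sq_sqrt (by linarith)]; linarith))
    rw [star_smul, smul_dotProduct, Matrix.mulVec_smul, dotProduct_smul, smul_smul, norm_smul,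
      norm_mul, RCLike.star_def, Complex.conj_ofReal, Complex.norm_real, Complex.norm_real,
      Real.norm_of_nonneg (inv_nonneg.2 hs.le), Real.norm_of_nonneg (inv_nonneg.2 ht.le),
      ← mul_inv, inv_mul_le_iff₀ (by positivity)] at h1
    have h2 := two_mul_le_add_sq √(a + ε) √(b + ε)
    rw [Real.sq_sqrt (by linarith), Real.sq_sqrt (by linarith)] at h2
    nlinarith
  have h3 : 2 * ‖star ξ ⬝ᵥ A *ᵥ η‖ ≤ r * (a + b) := by
    refine le_of_forall_pos_le_add fun ε hε => ?_
    have h4 := key (ε / (2 * (r + 1))) (by positivity)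
    have h5 : r * (ε / (2 * (r + 1))) * 2 ≤ ε := by
      rw [mul_div_assoc', div_mul_eq_mul_div, div_le_iff₀ (by positivity)]
      nlinarith
    nlinarith
  linarith [Complex.re_le_norm (star ξ ⬝ᵥ A *ᵥ η)]

theorem posSemidef_fromBlocks_diagonal {ι κ : Type*} [Fintype ι] [Fintype κ] {A : Matrix ι ι ℂ}
    {D : Matrix κ κ ℂ} (hA : A.PosSemidef) (hD : D.PosSemidef) :
    (Matrix.fromBlocks A 0 0 D).PosSemidef := by
  refine Matrix.PosSemidef.of_dotProduct_mulVec_nonneg ?_ fun x => ?_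
  · simp [Matrix.IsHermitian, Matrix.fromBlocks_conjTranspose, hA.1.eq, hD.1.eq]
  · obtain ⟨ξ, η, rfl⟩ : ∃ ξ η, x = Sum.elim ξ η := ⟨x ∘ Sum.inl, x ∘ Sum.inr, by simp⟩
    have es : star (Sum.elim ξ η) = Sum.elim (star ξ) (star η) := by
      ext i; rcases i with i | i <;> simp
    rw [Matrix.fromBlocks_mulVec, es, sumElim_dotProduct_sumElim]
    simpa using add_nonneg (hA.dotProduct_mulVec_nonneg ξ) (hD.dotProduct_mulVec_nonneg η)

theorem contractive_fromBlocks {ι κ m n : Type*} [Fintype ι] [Fintype κ] [DecidableEq ι]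
    [DecidableEq κ] [Fintype m] [Fintype n] {γ : Matrix m ι ℂ} {δ : Matrix n κ ℂ}
    (hγ : (1 - γᴴ * γ).PosSemidef) (hδ : (1 - δᴴ * δ).PosSemidef) :
    (1 - (Matrix.fromBlocks γ 0 0 δ)ᴴ * Matrix.fromBlocks γ 0 0 δ).PosSemidef := by
  convert posSemidef_fromBlocks_diagonal hγ hδ using 1
  rw [Matrix.fromBlocks_conjTranspose, Matrix.fromBlocks_multiply, ← Matrix.fromBlocks_one,
    sub_eq_add_neg, Matrix.fromBlocks_neg, Matrix.fromBlocks_add]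
  simp [sub_eq_add_neg]

theorem contractive_submatrix {ι κ m : Type*} [Fintype ι] [DecidableEq ι]
    [Fintype κ] [Fintype m] {γ : Matrix κ ι ℂ} (hγ : (1 - γᴴ * γ).PosSemidef) (e : m ≃ κ) :
    (1 - (γ.submatrix e id)ᴴ * γ.submatrix e id).PosSemidef := by
  rwa [Matrix.conjTranspose_submatrix, Matrix.submatrix_mul_equiv, Matrix.submatrix_id_id]

theorem contractive_mul {ι κ m : Type*} [Fintype ι] [DecidableEq ι]
    [Fintype κ] [DecidableEq κ] [Fintype m] {γ : Matrix κ ι ℂ} {δ : Matrix m κ ℂ}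
    (hγ : (1 - γᴴ * γ).PosSemidef) (hδ : (1 - δᴴ * δ).PosSemidef) :
    (1 - (δ * γ)ᴴ * (δ * γ)).PosSemidef := by
  rw [← norm_le_one_iff_posSemidef] at *
  exact (Matrix.l2_opNorm_mul δ γ).trans (mul_le_one₀ hδ (norm_nonneg _) hγ)

theorem contractive_one {ι : Type*} [Fintype ι] [DecidableEq ι] :
    (1 - (1 : Matrix ι ι ℂ)ᴴ * (1 : Matrix ι ι ℂ)).PosSemidef := by
  simpa using Matrix.PosSemidef.zero

theorem contractive_one_submatrix {ι κ : Type*} [Fintype ι] [DecidableEq ι] [Fintype κ]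
    [DecidableEq κ] {f : ι → κ} (hf : Function.Injective f) :
    (1 - ((1 : Matrix κ κ ℂ).submatrix id f)ᴴ * (1 : Matrix κ κ ℂ).submatrix id f).PosSemidef := by
  have e1 : ((1 : Matrix κ κ ℂ).submatrix id f)ᴴ * (1 : Matrix κ κ ℂ).submatrix id f = 1 := by
    rw [Matrix.conjTranspose_submatrix, Matrix.conjTranspose_one]
    ext i j
    simp [Matrix.mul_apply, Matrix.one_apply, hf.eq_iff]
  rw [e1, sub_self]
  exact Matrix.PosSemidef.zero

end Scalar

/-! ### Matrix structures given by ball systems -/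

/-- The norms of a matrix structure are the domination gauges of a ball system. -/
structure Gauge {X : Type*} [AddCommGroup X] [Module ℂ X] [StarAddMonoid X] [StarModule ℂ X]
    [MatrixStructure X] (S : BallSystem X) : Prop where
  matNorm_nonneg {n : ℕ} (x : Matrix (Fin n) (Fin n) X) : 0 ≤ matNorm x
  dom_of_lt {n : ℕ} (x : Matrix (Fin n) (Fin n) X) {r : ℝ} (hr : 0 < r) : matNorm x < r → S.Dom r x
  le_of_dom {n : ℕ} (x : Matrix (Fin n) (Fin n) X) {r : ℝ} (hr : 0 ≤ r) : S.Dom r x → matNorm x ≤ r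

/-- The map `x ↦ [f_ij(x)]` for a matrix of functionals with an arbitrary index set. -/
def functionalMap {X ι : Type*} [AddCommGroup X] [Module ℂ X] [MatrixStructure X]
    (f : Matrix ι ι (dualSpace X)) : X →ₗ[ℂ] Matrix ι ι ℂ where
  toFun v := Matrix.of fun i j => (f i j : X →ₗ[ℂ] ℂ) v
  map_add' v w := by ext i j; simp
  map_smul' c v := by ext i j; simp

theorem norm_amp_submatrix {X : Type*} [AddCommGroup X] [Module ℂ X] {ι κ μ : Type*} [Fintype ι]
    [Fintype κ] [Fintype μ] [DecidableEq ι] [DecidableEq κ] [DecidableEq μ]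
    (F : X →ₗ[ℂ] Matrix κ κ ℂ) (x : Matrix ι ι X) (e : μ ≃ ι) :
    ‖amp F (x.submatrix e e)‖ = ‖amp F x‖ :=
  norm_reindex_self (Equiv.prodCongr e.symm (Equiv.refl κ)) (amp F x)

namespace Gauge

variable {X : Type*} [AddCommGroup X] [Module ℂ X] [StarAddMonoid X] [StarModule ℂ X]
  [MatrixStructure X] {S : BallSystem X}

theorem absorbing (hS : Gauge S) : S.Absorbing := by
  intro x
  have h := hS.dom_of_lt (Matrix.of fun _ _ : Fin 1 => x) (by
    linarith [hS.matNorm_nonneg (Matrix.of fun _ _ : Fin 1 => x)]) (lt_add_one _)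
  exact ⟨_, by linarith [hS.matNorm_nonneg (Matrix.of fun _ _ : Fin 1 => x)],
    h.submatrix (Equiv.ofUnique Unit (Fin 1))⟩

/-- Boundedness on dominated matrices gives complete boundedness. -/
theorem norm_amp_le (hS : Gauge S) {κ : Type*} [Fintype κ] [DecidableEq κ] {F : X →ₗ[ℂ] Matrix κ κ ℂ} {r : ℝ}
    (hr : 0 ≤ r) {n : ℕ}
    (h : ∀ x : Matrix (Fin n) (Fin n) X, S.Dom 1 x → ‖amp F x‖ ≤ r)
    (x : Matrix (Fin n) (Fin n) X) : ‖amp F x‖ ≤ r * matNorm x := by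
  have key : ∀ ε > 0, ‖amp F x‖ ≤ r * (matNorm x + ε) := by
    intro ε hε
    have ht : 0 < matNorm x + ε := by linarith [hS.matNorm_nonneg x]
    have h1 := (hS.dom_of_lt x ht (by linarith)).smul (inv_nonneg.2 ht.le)
    rw [inv_mul_cancel₀ ht.ne'] at h1
    have h2 := h _ h1
    rw [amp_smul, norm_smul, Complex.norm_real, Real.norm_of_nonneg (inv_nonneg.2 ht.le),
      inv_mul_le_iff₀ ht] at h2
    linarith
  refine le_of_forall_pos_le_add fun ε hε => ?_
  have h4 := key (ε / (r + 1)) (by positivity)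
  have h5 : r * (ε / (r + 1)) ≤ ε := by
    rw [mul_div_assoc', div_le_iff₀ (by positivity)]
    nlinarith
  linarith

theorem cbNorm_le (hS : Gauge S) {k : ℕ} {F : X →ₗ[ℂ] Matrix (Fin k) (Fin k) ℂ} {r : ℝ} (hr : 0 ≤ r)
    (h : ∀ (n : ℕ) (x : Matrix (Fin n) (Fin n) X), S.Dom 1 x → ‖amp F x‖ ≤ r) :
    cbNorm F ≤ r := by
  refine Real.sSup_le ?_ hr
  rintro _ ⟨n, x, hx, rfl⟩
  refine (hS.norm_amp_le hr (h n) x).trans ?_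
  nlinarith

theorem norm_amp_le_cbNorm (hS : Gauge S) {k : ℕ} {F : X →ₗ[ℂ] Matrix (Fin k) (Fin k) ℂ}
    (hF : IsCompletelyBounded F) {ι : Type} [Fintype ι] [DecidableEq ι] {x : Matrix ι ι X} {t : ℝ}
    (ht : 0 < t) (hx : S.Dom t x) : ‖amp F x‖ ≤ cbNorm F * t := by
  have h1 := (hx.submatrix (Fintype.equivFin ι).symm).smul (inv_nonneg.2 ht.le)
  rw [inv_mul_cancel₀ ht.ne'] at h1
  have h2 := hS.le_of_dom _ zero_le_one h1
  obtain ⟨C, hC⟩ := hF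
  -- `cbNorm` is an `sSup`, which is `0` on unbounded sets; complete boundedness is needed before it
  -- dominates anything.
  have hb : BddAbove {r : ℝ | ∃ (n : ℕ) (v : Matrix (Fin n) (Fin n) X), matNorm v ≤ 1 ∧
      r = ‖amp F v‖} := by
    refine ⟨|C|, ?_⟩
    rintro _ ⟨n, v, hv, rfl⟩
    have := hC n v
    nlinarith [hS.matNorm_nonneg v, le_abs_self C, abs_nonneg C]
  have h3 : ‖amp F _‖ ≤ cbNorm F := le_csSup hb ⟨_, _, h2, rfl⟩
  rw [amp_smul, norm_smul, Complex.norm_real, Real.norm_of_nonneg (inv_nonneg.2 ht.le),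
      inv_mul_le_iff₀ ht, norm_amp_submatrix] at h3
  linarith

/-- Bounded functionals are completely bounded. -/
theorem norm_map_le (hS : Gauge S) {f : X →ₗ[ℂ] ℂ} {C : ℝ}
    (hf : ∀ v : X, ‖f v‖ ≤ C * matNorm (n := 1) (Matrix.of fun _ _ => v)) (hC : 0 ≤ C)
    {ι : Type} [Fintype ι] [DecidableEq ι] {x : Matrix ι ι X} {t : ℝ} (ht : 0 ≤ t)
    (hx : S.Dom t x) : ‖(x.map f : Matrix ι ι ℂ)‖ ≤ C * t := by
  refine norm_le_of_unit_form (mul_nonneg hC ht) fun ξ η hξ hη => ?_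
  -- A vector in the unit ball is a contractive column, so the form at two such vectors is `f` at a
  -- compression of `x` to size one. Scalar functionals thus need no amplification.
  have hcon : ∀ ξ : ι → ℂ, ∑ i, ‖ξ i‖ ^ 2 ≤ 1 →
      (1 - (Matrix.replicateCol (Fin 1) ξ)ᴴ * Matrix.replicateCol (Fin 1) ξ).PosSemidef := by
    intro ξ hξ
    have e : 1 - (Matrix.replicateCol (Fin 1) ξ)ᴴ * Matrix.replicateCol (Fin 1) ξ =
        ((1 - ∑ i, ‖ξ i‖ ^ 2 : ℝ) : ℂ) • (1 : Matrix (Fin 1) (Fin 1) ℂ) := by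
      ext i j
      have := star_dotProduct_self ξ
      simp only [dotProduct, Pi.star_apply] at this
      rw [Subsingleton.elim i 0, Subsingleton.elim j 0]
      simp only [Matrix.sub_apply, Matrix.one_apply_eq, Matrix.mul_apply, Matrix.smul_apply,
        Matrix.conjTranspose_apply, Matrix.replicateCol_apply, this, smul_eq_mul, mul_one,
        Complex.ofReal_sub, Complex.ofReal_one]
    rw [e]
    exact Matrix.PosSemidef.one.smul (by exact_mod_cast sub_nonneg.2 hξ)
  have h1 := hS.le_of_dom _ ht (hx.sand _ _ (hcon ξ hξ) (hcon η hη))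
  have e : star ξ ⬝ᵥ (x.map f : Matrix ι ι ℂ) *ᵥ η =
      f (sand (Matrix.replicateCol (Fin 1) ξ)ᴴ x (Matrix.replicateCol (Fin 1) η) 0 0) := by
    simp only [dotProduct, Matrix.mulVec, sand_apply, map_sum, map_smul, Finset.mul_sum]
    refine Finset.sum_congr rfl fun p _ => Finset.sum_congr rfl fun q _ => ?_
    simp
    ring
  rw [e]
  refine (hf _).trans (mul_le_mul_of_nonneg_left ?_ hC)
  refine le_of_eq_of_le (congrArg _ ?_) h1
  ext i j
  rw [Subsingleton.elim i 0, Subsingleton.elim j 0]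
  rfl

/-- A map into a matrix algebra with bounded entries is completely bounded. -/
theorem exists_norm_amp_functionalMap_le (hS : Gauge S) {κ : Type*} [Fintype κ] [DecidableEq κ]
    (f : Matrix κ κ (dualSpace X)) : ∃ C : ℝ, 0 ≤ C ∧ ∀ (ι : Type) [Fintype ι] [DecidableEq ι]
      (x : Matrix ι ι X) (t : ℝ), 0 ≤ t → S.Dom t x → ‖amp (functionalMap f) x‖ ≤ C * t := by
  have hf : ∀ i j, ∃ C : ℝ, 0 ≤ C ∧ ∀ v : X,
      ‖(f i j).1 v‖ ≤ C * matNorm (n := 1) (Matrix.of fun _ _ => v) := by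
    intro i j
    obtain ⟨C, hC⟩ := (f i j).2
    exact ⟨|C|, abs_nonneg C, fun v => (hC v).trans
      (mul_le_mul_of_nonneg_right (le_abs_self C) (hS.matNorm_nonneg _))⟩
  choose C hC0 hC using hf
  have hsum : 0 ≤ ∑ i, ∑ j, C i j := Finset.sum_nonneg fun i _ => Finset.sum_nonneg fun j _ => hC0 i j
  refine ⟨∑ i, ∑ j, C i j, hsum, fun ι _ _ x t ht hx => ?_⟩
  refine norm_le_of_form (mul_nonneg hsum ht) fun ξ η => ?_
  have e : star ξ ⬝ᵥ amp (functionalMap f) x *ᵥ η = ∑ i, ∑ j,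
      (star fun p => ξ (p, i)) ⬝ᵥ (x.map (f i j).1 : Matrix ι ι ℂ) *ᵥ (fun p => η (p, j)) := by
    simp only [dotProduct, Matrix.mulVec, Fintype.sum_prod_type, amp_apply, functionalMap,
      Finset.mul_sum, Pi.star_apply]
    rw [Finset.sum_comm]
    refine Finset.sum_congr rfl fun i _ => ?_
    conv_rhs => rw [Finset.sum_comm]
    refine Finset.sum_congr rfl fun p _ => ?_
    rw [Finset.sum_comm]
    rfl
  rw [e, Complex.re_sum, Finset.mul_sum, Finset.sum_mul, Finset.sum_mul]
  refine Finset.sum_le_sum fun i _ => ?_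
  rw [Complex.re_sum, Finset.mul_sum, Finset.sum_mul, Finset.sum_mul]
  refine Finset.sum_le_sum fun j _ => ?_
  have h1 := two_mul_norm_dotProduct_mulVec_le (hS.norm_map_le (hC i j) (hC0 i j) ht hx)
    (fun p => ξ (p, i)) (fun p => η (p, j))
  have h2 : ∀ (ξ : ι × κ → ℂ) (i : κ), ∑ p, ‖ξ (p, i)‖ ^ 2 ≤ ∑ p, ‖ξ p‖ ^ 2 := by
    intro ξ i
    rw [Fintype.sum_prod_type]
    exact Finset.sum_le_sum fun p _ => Finset.single_le_sum (f := fun j => ‖ξ (p, j)‖ ^ 2)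
      (fun j _ => by positivity) (Finset.mem_univ i)
  have h3 := Complex.re_le_norm ((star fun p => ξ (p, i)) ⬝ᵥ
    (x.map (f i j).1 : Matrix ι ι ℂ) *ᵥ (fun p => η (p, j)))
  have h4 := mul_le_mul_of_nonneg_left (add_le_add (h2 ξ i) (h2 η j)) (mul_nonneg (hC0 i j) ht)
  linarith

theorem isCompletelyBounded (hS : Gauge S) {n : ℕ} (f : Matrix (Fin n) (Fin n) (dualSpace X)) :
    IsCompletelyBounded (dualMatrixMap f) := by
  obtain ⟨C, hC, h⟩ := hS.exists_norm_amp_functionalMap_le f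
  exact ⟨C, fun m x => hS.norm_amp_le hC (fun x hx => by
    rw [← mul_one C]; exact h _ x 1 zero_le_one hx) x⟩

/-- Completely contractive maps on the dual and matrices of functionals over any index set. -/
theorem norm_amp_le_of_isCompletelyContractive (hS : Gauge S) {k : ℕ}
    {φ : dualSpace X →ₗ[ℂ] Matrix (Fin k) (Fin k) ℂ} (hφ : IsCompletelyContractive φ)
    {ι : Type} [Fintype ι] [DecidableEq ι] (A : Matrix ι ι (dualSpace X)) {r : ℝ} (hr : 0 ≤ r)
    (h : ∀ (m : ℕ) (x : Matrix (Fin m) (Fin m) X), S.Dom 1 x → ‖amp (functionalMap A) x‖ ≤ r) :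
    ‖amp φ A‖ ≤ r := by
  let e := (Fintype.equivFin ι).symm
  rw [← norm_amp_submatrix φ A e]
  refine (hφ _ _).trans (hS.cbNorm_le hr fun m x hx => ?_)
  refine le_of_eq_of_le ?_ (h m x hx)
  exact norm_reindex_self (Equiv.prodCongr (Equiv.refl _) e.symm) (amp (functionalMap A) x)

/-- After reindexing by `Fin`, the matrix `A` lies in the dual cone: its positivity is the
hypothesis, and its complete boundedness is automatic for bounded entries. -/
theorem posSemidef_amp_of_isCompletelyPositive (hS : Gauge S) {k : ℕ}
    {φ : dualSpace X →ₗ[ℂ] Matrix (Fin k) (Fin k) ℂ} (hφ : IsCompletelyPositive φ)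
    {ι : Type} [Fintype ι] [DecidableEq ι] (A : Matrix ι ι (dualSpace X))
    (h : ∀ (m : ℕ), ∀ x ∈ matCone X m, (amp (functionalMap A) x).PosSemidef) :
    (amp φ A).PosSemidef := by
  let e := (Fintype.equivFin ι).symm
  have h1 := hφ _ (A.submatrix e e) ⟨hS.isCompletelyBounded _, fun m x hx =>
    (h m x hx).submatrix (Prod.map id e)⟩
  convert h1.submatrix (Prod.map e.symm id) using 1
  ext p q
  simp [amp_apply]

end Gauge

/-! ### The ball system of a matrix regular operator space -/

section PosBall

variable {V : Type*} [AddCommGroup V] [Module ℂ V] [StarAddMonoid V] [StarModule ℂ V]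
  [MatrixStructure V]

section Ordered

variable [MatrixOrderedOperatorSpace V]

theorem matCone_sand {m n : ℕ} (γ : Matrix (Fin m) (Fin n) ℂ) {x : Matrix (Fin m) (Fin m) V}
    (hx : x ∈ matCone V m) : sand γᴴ x γ ∈ matCone V n :=
  MatrixOrderedOperatorSpace.sandwich_mem γ hx

theorem matNorm_sand_le {m n : ℕ} {α β : Matrix (Fin m) (Fin n) ℂ} {x : Matrix (Fin m) (Fin m) V}
    (hα : (1 - αᴴ * α).PosSemidef) (hβ : (1 - βᴴ * β).PosSemidef) :
    matNorm (sand αᴴ x β) ≤ matNorm x := by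
  rw [← norm_le_one_iff_posSemidef] at hα hβ
  rw [← Matrix.l2_opNorm_conjTranspose] at hα
  have h0 := OperatorSpace.matNorm_nonneg x
  calc _ ≤ ‖αᴴ‖ * matNorm x * ‖β‖ := OperatorSpace.matNorm_sandwich_le αᴴ x β
    _ ≤ 1 * matNorm x * 1 := by gcongr
    _ = _ := by ring

/-- The cones have no direct sum axiom: `x ⊕ y` is the sum of `x ⊕ 0` and `0 ⊕ y`, and each of these
is a compression. -/
theorem matCone_directSum {m n : ℕ} {x : Matrix (Fin m) (Fin m) V} {y : Matrix (Fin n) (Fin n) V}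
    (hx : x ∈ matCone V m) (hy : y ∈ matCone V n) :
    (Matrix.fromBlocks x 0 0 y).submatrix finSumFinEquiv.symm finSumFinEquiv.symm
      ∈ matCone V (m + n) := by
  have h1 := matCone_sand ((Matrix.fromCols (1 : Matrix (Fin m) (Fin m) ℂ)
    (0 : Matrix (Fin m) (Fin n) ℂ)).submatrix id finSumFinEquiv.symm) hx
  have h2 := matCone_sand ((Matrix.fromCols (0 : Matrix (Fin n) (Fin m) ℂ)
    (1 : Matrix (Fin n) (Fin n) ℂ)).submatrix id finSumFinEquiv.symm) hy
  convert MatrixOrderedOperatorSpace.add_mem h1 h2 using 1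
  ext i j
  simp only [Matrix.submatrix_apply, Matrix.add_apply, sand_apply, Matrix.conjTranspose_submatrix,
    Matrix.conjTranspose_fromCols_eq_fromRows_conjTranspose]
  generalize finSumFinEquiv.symm i = i
  generalize finSumFinEquiv.symm j = j
  rcases i with i | i <;> rcases j with j | j <;> simp [Matrix.one_apply]

/-- The positive parts of the open unit balls, over arbitrary finite index sets. -/
def posBall (V : Type*) [AddCommGroup V] [Module ℂ V] [StarAddMonoid V] [StarModule ℂ V]
    [MatrixStructure V] [MatrixOrderedOperatorSpace V] : BallSystem V where
  ball ι _ _ := {a | ∃ (n : ℕ) (b : Matrix (Fin n) (Fin n) V) (γ : Matrix (Fin n) ι ℂ),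
    b ∈ matCone V n ∧ matNorm b < 1 ∧ (1 - γᴴ * γ).PosSemidef ∧ a = sand γᴴ b γ}
  conjTranspose_eq := by
    rintro ι _ _ _ ⟨n, b, γ, hb, -, -, rfl⟩
    rw [conjTranspose_sand, MatrixOrderedOperatorSpace.conjTranspose_eq_of_mem hb,
      Matrix.conjTranspose_conjTranspose]
  compress := by
    rintro ι κ _ _ _ _ δ _ hδ ⟨n, b, γ, hb, hb1, hγ, rfl⟩
    exact ⟨n, b, γ * δ, hb, hb1, contractive_mul hδ hγ, by
      rw [sand_sand, Matrix.conjTranspose_mul]⟩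
  directSum := by
    rintro ι κ _ _ _ _ _ _ ⟨n, b, γ, hb, hb1, hγ, rfl⟩ ⟨m, c, δ, hc, hc1, hδ, rfl⟩
    refine ⟨n + m, _, (Matrix.fromBlocks γ 0 0 δ).submatrix finSumFinEquiv.symm id,
      matCone_directSum hb hc, ?_, contractive_submatrix (contractive_fromBlocks hγ hδ) _, ?_⟩
    · have := OperatorSpace.matNorm_directSum b c
      rw [Matrix.reindex_apply] at this
      rw [this]
      exact max_lt hb1 hc1
    · have h := fromBlocks_sand_fromBlocks γᴴ δᴴ b 0 0 c γ δ
      rw [sand_zero, sand_zero] at h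
      rw [← h]
      ext i j
      simp only [sand_apply, Matrix.submatrix_apply, Matrix.conjTranspose_submatrix, id_eq,
        Matrix.fromBlocks_conjTranspose, Matrix.conjTranspose_zero]
      rw [← Equiv.sum_comp finSumFinEquiv]
      refine Finset.sum_congr rfl fun p _ => ?_
      rw [← Equiv.sum_comp finSumFinEquiv]
      simp

theorem mem_posBall_iff {n : ℕ} {a : Matrix (Fin n) (Fin n) V} :
    a ∈ (posBall V).ball (Fin n) ↔ a ∈ matCone V n ∧ matNorm a < 1 := by
  constructor
  · rintro ⟨m, b, γ, hb, hb1, hγ, rfl⟩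
    exact ⟨matCone_sand γ hb, (matNorm_sand_le hγ hγ).trans_lt hb1⟩
  · rintro ⟨h1, h2⟩
    exact ⟨n, a, 1, h1, h2, contractive_one, by simp [one_sand_one]⟩

theorem mem_cone_posBall_iff {n : ℕ} {a : Matrix (Fin n) (Fin n) V} :
    a ∈ (posBall V).cone (Fin n) ↔ a ∈ matCone V n := by
  constructor
  · rintro ⟨t, ht, a, ha, rfl⟩
    exact MatrixOrderedOperatorSpace.smul_mem t ht (mem_posBall_iff.1 ha).1
  · intro ha
    have h0 := OperatorSpace.matNorm_nonneg a
    have h1 : 0 < matNorm a + 1 := by linarith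
    refine ⟨matNorm a + 1, h1.le, (((matNorm a + 1)⁻¹ : ℝ) : ℂ) • a, mem_posBall_iff.2
      ⟨MatrixOrderedOperatorSpace.smul_mem _ (inv_nonneg.2 h1.le) ha, ?_⟩, ?_⟩
    · rw [OperatorSpace.matNorm_smul, Complex.norm_real, Real.norm_of_nonneg (inv_nonneg.2 h1.le),
        inv_mul_lt_iff₀ h1]
      linarith
    · rw [smul_smul, ← Complex.ofReal_mul, mul_inv_cancel₀ h1.ne']
      simp

end Ordered

variable [MatrixRegularOperatorSpace V]

/-- Compression by the unitary `diag(1, -1)`. -/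
theorem fromBlocks_neg_mem_cone {X : Type*} [AddCommGroup X] [Module ℂ X] [StarAddMonoid X]
    [StarModule ℂ X] {S : BallSystem X} {ι : Type} [Fintype ι] [DecidableEq ι]
    {a b c d : Matrix ι ι X} (h : Matrix.fromBlocks a b c d ∈ S.cone (ι ⊕ ι)) :
    Matrix.fromBlocks a (-b) (-c) d ∈ S.cone (ι ⊕ ι) := by
  have h1 := BallSystem.sand_mem_cone
    (Matrix.fromBlocks (1 : Matrix ι ι ℂ) 0 0 (-1 : Matrix ι ι ℂ)) h
  have e1 : ∀ (α : Matrix ι ι ℂ) (x : Matrix ι ι X), sand (-1) x α = -sand 1 x α :=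
    fun α x => by rw [← neg_one_smul ℂ (1 : Matrix ι ι ℂ), smul_sand, neg_one_smul]
  have e2 : ∀ (α : Matrix ι ι ℂ) (x : Matrix ι ι X), sand α x (-1) = -sand α x 1 :=
    fun α x => by rw [← neg_one_smul ℂ (1 : Matrix ι ι ℂ), sand_smul_right, neg_one_smul]
  simp only [Matrix.fromBlocks_conjTranspose, Matrix.conjTranspose_zero,
    fromBlocks_sand_fromBlocks, Matrix.conjTranspose_one, Matrix.conjTranspose_neg] at h1
  simpa only [e1, e2, one_sand_one, neg_neg] using h1

/-- The norms of a matrix regular operator space are given by `2 × 2` positive matrices. -/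
theorem gauge_posBall (V : Type*) [AddCommGroup V] [Module ℂ V] [StarAddMonoid V] [StarModule ℂ V]
    [MatrixStructure V] [MatrixRegularOperatorSpace V] : Gauge (posBall V) where
  matNorm_nonneg := OperatorSpace.matNorm_nonneg
  dom_of_lt {n} x r hr hx := by
    let e : Fin (n + n) ≃ Fin n ⊕ Fin n := finSumFinEquiv.symm
    suffices h : ∀ x : Matrix (Fin n) (Fin n) V, matNorm x < 1 → (posBall V).Dom 1 x by
      have h1 := (h (((r⁻¹ : ℝ) : ℂ) • x) (by
        rw [OperatorSpace.matNorm_smul, Complex.norm_real, Real.norm_of_nonneg (inv_nonneg.2 hr.le),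
          inv_mul_lt_iff₀ hr]
        linarith)).smul hr.le
      rwa [mul_one, smul_smul, ← Complex.ofReal_mul, mul_inv_cancel₀ hr.ne', Complex.ofReal_one,
        one_smul] at h1
    intro x hx
    -- The regularity axioms concern self-adjoint elements; this dilation of `x` is one.
    let v := (Matrix.fromBlocks 0 x xᴴ 0).submatrix e e
    have hv : vᴴ = v := by
      simp [v, Matrix.conjTranspose_submatrix, Matrix.fromBlocks_conjTranspose]
    have hv1 : matNorm v < 1 := by
      have h1 := OperatorSpace.matNorm_directSum x xᴴ
      rw [MatrixOrderedOperatorSpace.matNorm_conjTranspose, max_self] at h1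
      refine lt_of_le_of_lt ?_ (h1.le.trans_lt hx)
      -- The dilation is `x ⊕ xᴴ` with its two block columns exchanged.
      have h2 := matNorm_sand_le (x := Matrix.reindex finSumFinEquiv finSumFinEquiv
        (Matrix.fromBlocks x 0 0 xᴴ)) (α := 1) (β := (1 : Matrix _ _ ℂ).submatrix id
          (finSumFinEquiv ∘ Sum.swap ∘ e)) contractive_one (contractive_one_submatrix
          (finSumFinEquiv.injective.comp ((Equiv.sumComm _ _).injective.comp e.injective)))
      refine le_of_eq_of_le (congrArg _ ?_) h2
      rw [Matrix.conjTranspose_one]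
      have h3 := submatrix_eq_sand (Matrix.reindex finSumFinEquiv finSumFinEquiv
        (Matrix.fromBlocks x 0 0 xᴴ)) id (finSumFinEquiv ∘ Sum.swap ∘ e)
      rw [Matrix.submatrix_id_id] at h3
      rw [← h3]
      ext i j
      simp only [v, Matrix.submatrix_apply, Matrix.reindex_apply, Function.comp_apply, id_eq,
        Equiv.symm_apply_apply, e]
      generalize finSumFinEquiv.symm i = i
      generalize finSumFinEquiv.symm j = j
      rcases i with i | i <;> rcases j with j | j <;> simp
    obtain ⟨u, hu, hu1, hp, hm⟩ := MatrixRegularOperatorSpace.exists_dominating v hv hv1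
    have hU := BallSystem.submatrix_mem_ball (mem_posBall_iff.2 ⟨hu, hu1⟩) e.symm
    have hp' := BallSystem.submatrix_mem_cone (mem_cone_posBall_iff.2 hp) e.symm
    have hm' := BallSystem.submatrix_mem_cone (mem_cone_posBall_iff.2 hm) e.symm
    have hv' : v.submatrix e.symm e.symm = Matrix.fromBlocks 0 x xᴴ 0 := by simp [v]
    rw [Matrix.submatrix_add, Pi.add_apply, Pi.add_apply, hv'] at hp'
    rw [Matrix.submatrix_sub, Pi.sub_apply, Pi.sub_apply, hv'] at hm'
    generalize u.submatrix e.symm e.symm = U at hU hp' hm'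
    obtain ⟨a, b, c, d, rfl⟩ : ∃ a b c d, U = Matrix.fromBlocks a b c d :=
      ⟨_, _, _, _, (Matrix.fromBlocks_toBlocks U).symm⟩
    rw [sub_eq_add_neg, Matrix.fromBlocks_neg, Matrix.fromBlocks_add] at hm'
    rw [Matrix.fromBlocks_add] at hp'
    -- Averaging `u + v` with the `diag(1, -1)` conjugate of `u - v` cancels the off-diagonal blocks
    -- of `u` and keeps `x`.
    have h1 := BallSystem.smul_mem_cone (t := 2⁻¹) (by norm_num)
      (BallSystem.add_mem_cone hp' (fromBlocks_neg_mem_cone hm'))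
    have ha := (posBall V).compress _ (contractive_one_submatrix Sum.inl_injective) hU
    have hd := (posBall V).compress _ (contractive_one_submatrix Sum.inr_injective) hU
    rw [Matrix.conjTranspose_submatrix, Matrix.conjTranspose_one, ← submatrix_eq_sand] at ha hd
    refine ⟨a, ha, d, hd, ?_⟩
    convert h1 using 1
    have e2 : ∀ y : Matrix (Fin n) (Fin n) V, (2⁻¹ : ℂ) • (y + y) = y := fun y => by
      rw [← two_smul ℂ y, smul_smul]; norm_num
    rw [Matrix.fromBlocks_add, Matrix.fromBlocks_smul]
    simp only [Complex.ofReal_inv, Complex.ofReal_ofNat, Complex.ofReal_one, one_smul, zero_add,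
      neg_zero, add_zero, neg_add_rev, neg_neg, e2]
    congr 1
    · rw [show x + b + (x + -b) = x + x by abel, e2]
    · rw [show xᴴ + c + (xᴴ + -c) = xᴴ + xᴴ by abel, e2]
  le_of_dom {n} x r hr hx := by
    let e : Fin (n + n) ≃ Fin n ⊕ Fin n := finSumFinEquiv.symm
    obtain ⟨a, ha, d, hd, h⟩ := hx
    have h' := fromBlocks_neg_mem_cone h
    let v := (Matrix.fromBlocks 0 x xᴴ 0).submatrix e e
    let w := (Matrix.fromBlocks a 0 0 d).submatrix e e
    let u := (r : ℂ) • w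
    have hv : vᴴ = v := by
      simp [v, Matrix.conjTranspose_submatrix, Matrix.fromBlocks_conjTranspose]
    have hw := mem_posBall_iff.1
      (BallSystem.submatrix_mem_ball ((posBall V).directSum ha hd) e)
    have hu : u ∈ matCone V (n + n) := MatrixOrderedOperatorSpace.smul_mem r hr hw.1
    have hu1 : matNorm u ≤ r := by
      rw [OperatorSpace.matNorm_smul, Complex.norm_real, Real.norm_of_nonneg hr]
      exact mul_le_of_le_one_right hr hw.2.le
    have e1 : v + u = (Matrix.fromBlocks ((r : ℂ) • a) x xᴴ ((r : ℂ) • d)).submatrix e e := by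
      ext i j
      simp only [v, u, w, Matrix.add_apply, Matrix.smul_apply, Matrix.submatrix_apply]
      rcases e i with i | i <;> rcases e j with j | j <;> simp
    have e2 : u - v = (Matrix.fromBlocks ((r : ℂ) • a) (-x) (-xᴴ) ((r : ℂ) • d)).submatrix e e := by
      ext i j
      simp only [v, u, w, Matrix.sub_apply, Matrix.smul_apply, Matrix.submatrix_apply]
      rcases e i with i | i <;> rcases e j with j | j <;> simp
    have h2 := MatrixRegularOperatorSpace.matNorm_le v u hv hu
      (by rw [e1]; exact mem_cone_posBall_iff.1 (BallSystem.submatrix_mem_cone h e))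
      (by rw [e2]; exact mem_cone_posBall_iff.1 (BallSystem.submatrix_mem_cone h' e))
    refine le_trans ?_ (h2.trans hu1)
    -- The block `x` is cut out of its dilation by two different contractions.
    have h3 := matNorm_sand_le (x := v) (α := (1 : Matrix _ _ ℂ).submatrix id (e.symm ∘ Sum.inl))
      (β := (1 : Matrix _ _ ℂ).submatrix id (e.symm ∘ Sum.inr))
      (contractive_one_submatrix (e.symm.injective.comp Sum.inl_injective))
      (contractive_one_submatrix (e.symm.injective.comp Sum.inr_injective))
    rw [Matrix.conjTranspose_submatrix, Matrix.conjTranspose_one, ← submatrix_eq_sand] at h3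
    refine le_of_eq_of_le (congrArg _ ?_) h3
    ext i j
    simp [v]

end PosBall

/-! ### The ball system of the maximal tensor product -/

theorem sand_kroneckerTMul_sand {E F ι κ μ ν ι' κ' μ' ν' : Type*} [AddCommGroup E] [Module ℂ E]
    [AddCommGroup F] [Module ℂ F] [Fintype κ] [Fintype μ] [Fintype κ'] [Fintype μ']
    (α : Matrix ι κ ℂ) (x : Matrix κ μ E) (β : Matrix μ ν ℂ)
    (α' : Matrix ι' κ' ℂ) (y : Matrix κ' μ' F) (β' : Matrix μ' ν' ℂ) :
    Matrix.kroneckerTMul ℂ (sand α x β) (sand α' y β') =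
      sand (α ⊗ₖ α') (Matrix.kroneckerTMul ℂ x y) (β ⊗ₖ β') := by
  ext ⟨i, i'⟩ ⟨j, j'⟩
  simp only [Matrix.kroneckerTMul, Matrix.kroneckerMap_apply, sand_apply, TensorProduct.sum_tmul,
    TensorProduct.tmul_sum, TensorProduct.smul_tmul_smul, Fintype.sum_prod_type]
  calc _ = ∑ p' : κ', ∑ p : κ, ∑ q' : μ', ∑ q : μ,
        (α i p * β q j * (α' i' p' * β' q' j')) • x p q ⊗ₜ[ℂ] y p' q' :=
        Finset.sum_congr rfl fun _ _ => Finset.sum_comm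
    _ = ∑ p : κ, ∑ p' : κ', ∑ q' : μ', ∑ q : μ,
        (α i p * β q j * (α' i' p' * β' q' j')) • x p q ⊗ₜ[ℂ] y p' q' := Finset.sum_comm
    _ = _ := by
        refine Finset.sum_congr rfl fun p _ => Finset.sum_congr rfl fun p' _ => ?_
        rw [Finset.sum_comm]
        refine Finset.sum_congr rfl fun q _ => Finset.sum_congr rfl fun q' _ => ?_
        rw [mul_mul_mul_comm]

theorem posSemidef_kronecker {ι κ : Type*} [Fintype ι] [Fintype κ] {x : Matrix ι ι ℂ}
    {y : Matrix κ κ ℂ} (hx : x.PosSemidef) (hy : y.PosSemidef) : (x ⊗ₖ y).PosSemidef :=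
  hx.kronecker hy

/-- With `p = γᴴ γ` and `q = δᴴ δ`, `1 ⊗ 1 - p ⊗ q = (1 - p) ⊗ 1 + p ⊗ (1 - q)`. -/
theorem contractive_kronecker {ι κ m n : Type*} [Fintype ι] [Fintype κ] [DecidableEq ι]
    [DecidableEq κ] [Fintype m] [Fintype n] {γ : Matrix m ι ℂ} {δ : Matrix n κ ℂ}
    (hγ : (1 - γᴴ * γ).PosSemidef) (hδ : (1 - δᴴ * δ).PosSemidef) :
    (1 - (γ ⊗ₖ δ)ᴴ * (γ ⊗ₖ δ)).PosSemidef := by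
  have h := (posSemidef_kronecker hγ (Matrix.PosSemidef.one (n := κ) (R := ℂ))).add
    (posSemidef_kronecker (Matrix.posSemidef_conjTranspose_mul_self γ) hδ)
  convert h using 1
  rw [Matrix.conjTranspose_kronecker, ← Matrix.mul_kronecker_mul, ← Matrix.one_kronecker_one]
  ext ⟨i, i'⟩ ⟨j, j'⟩
  simp only [Matrix.sub_apply, Matrix.add_apply, Matrix.kroneckerMap_apply]
  ring

section MaxBall

variable {V W : Type*} [AddCommGroup V] [Module ℂ V] [StarAddMonoid V] [StarModule ℂ V]
  [MatrixStructure V] [AddCommGroup W] [Module ℂ W] [StarAddMonoid W] [StarModule ℂ W]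
  [MatrixStructure W]

/-- The structure of `V ⊗_Δ W` on the algebraic tensor product. -/
@[reducible] noncomputable def maxStructure (V W : Type*) [AddCommGroup V] [Module ℂ V] [StarAddMonoid V]
    [StarModule ℂ V] [MatrixStructure V] [AddCommGroup W] [Module ℂ W] [StarAddMonoid W]
    [StarModule ℂ W] [MatrixStructure W] : MatrixStructure (V ⊗[ℂ] W) :=
  maxTensorMatrixStructure V W

attribute [local instance] maxStructure

variable (V W) in
/-- The compressions of elementary tensors of positive elements of norm less than one. -/
def maxBallSet (ι : Type) [Fintype ι] [DecidableEq ι] : Set (Matrix ι ι (V ⊗[ℂ] W)) :=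
  {a | ∃ (k l : ℕ) (v : Matrix (Fin k) (Fin k) V) (w : Matrix (Fin l) (Fin l) W)
    (α : Matrix (Fin k × Fin l) ι ℂ), v ∈ matCone V k ∧ matNorm v < 1 ∧ w ∈ matCone W l ∧
    matNorm w < 1 ∧ (1 - αᴴ * α).PosSemidef ∧ a = sand αᴴ (Matrix.kroneckerTMul ℂ v w) α}

theorem conjTranspose_kroneckerTMul {ι κ : Type*} (v : Matrix ι ι V) (w : Matrix κ κ W) :
    (Matrix.kroneckerTMul ℂ v w)ᴴ = Matrix.kroneckerTMul ℂ vᴴ wᴴ := by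
  ext p q; simp [Matrix.kroneckerTMul]

theorem sand_mem_maxBallSet {ι κ : Type} [Fintype ι] [DecidableEq ι] [Fintype κ] [DecidableEq κ]
    {δ : Matrix κ ι ℂ} (hδ : (1 - δᴴ * δ).PosSemidef) {a : Matrix κ κ (V ⊗[ℂ] W)}
    (ha : a ∈ maxBallSet V W κ) : sand δᴴ a δ ∈ maxBallSet V W ι := by
  obtain ⟨k, l, v, w, α, hv, hv1, hw, hw1, hα, rfl⟩ := ha
  exact ⟨k, l, v, w, α * δ, hv, hv1, hw, hw1, contractive_mul hδ hα, by
    rw [sand_sand, Matrix.conjTranspose_mul]⟩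

section Ordered

variable [MatrixOrderedOperatorSpace V] [MatrixOrderedOperatorSpace W]

theorem kroneckerTMul_mem_maxBallSet {ι κ : Type} [Fintype ι] [DecidableEq ι] [Fintype κ]
    [DecidableEq κ] {v : Matrix ι ι V} {w : Matrix κ κ W} (hv : v ∈ (posBall V).ball ι)
    (hw : w ∈ (posBall W).ball κ) : Matrix.kroneckerTMul ℂ v w ∈ maxBallSet V W (ι × κ) := by
  obtain ⟨m, b, γ, hb, hb1, hγ, rfl⟩ := hv
  obtain ⟨n, c, δ, hc, hc1, hδ, rfl⟩ := hw
  exact ⟨m, n, b, c, γ ⊗ₖ δ, hb, hb1, hc, hc1, contractive_kronecker hγ hδ, by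
    rw [sand_kroneckerTMul_sand, Matrix.conjTranspose_kronecker]⟩

/-- The ball system that defines `V ⊗_Δ W`. -/
def maxBall (V W : Type*) [AddCommGroup V] [Module ℂ V] [StarAddMonoid V] [StarModule ℂ V]
    [MatrixStructure V] [AddCommGroup W] [Module ℂ W] [StarAddMonoid W] [StarModule ℂ W]
    [MatrixStructure W] [MatrixOrderedOperatorSpace V] [MatrixOrderedOperatorSpace W] :
    BallSystem (V ⊗[ℂ] W) where
  ball ι _ _ := maxBallSet V W ι
  conjTranspose_eq := by
    rintro ι _ _ _ ⟨k, l, v, w, α, hv, -, hw, -, -, rfl⟩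
    rw [conjTranspose_sand, conjTranspose_kroneckerTMul,
      MatrixOrderedOperatorSpace.conjTranspose_eq_of_mem hv,
      MatrixOrderedOperatorSpace.conjTranspose_eq_of_mem hw, Matrix.conjTranspose_conjTranspose]
  compress _ _ hδ ha := sand_mem_maxBallSet hδ ha
  directSum := by
    rintro ι κ _ _ _ _ _ _ ⟨k, l, v, w, α, hv, hv1, hw, hw1, hα, rfl⟩
      ⟨k', l', v', w', α', hv', hv1', hw', hw1', hα', rfl⟩
    -- `(v ⊗ w) ⊕ (v' ⊗ w')` is a principal submatrix of `(v ⊕ v') ⊗ (w ⊕ w')`, a single elementary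
    -- tensor.
    have h1 := kroneckerTMul_mem_maxBallSet
      ((posBall V).directSum (mem_posBall_iff.2 ⟨hv, hv1⟩) (mem_posBall_iff.2 ⟨hv', hv1'⟩))
      ((posBall W).directSum (mem_posBall_iff.2 ⟨hw, hw1⟩) (mem_posBall_iff.2 ⟨hw', hw1'⟩))
    let f : (Fin k × Fin l) ⊕ (Fin k' × Fin l') → (Fin k ⊕ Fin k') × (Fin l ⊕ Fin l') :=
      Sum.elim (Prod.map Sum.inl Sum.inl) (Prod.map Sum.inr Sum.inr)
    have hf : Function.Injective f := by
      rintro (⟨i, j⟩ | ⟨i, j⟩) (⟨i', j'⟩ | ⟨i', j'⟩) <;> simp [f]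
    have h2 := sand_mem_maxBallSet (contractive_one_submatrix hf) h1
    rw [Matrix.conjTranspose_submatrix, Matrix.conjTranspose_one, ← submatrix_eq_sand] at h2
    have h3 := sand_mem_maxBallSet (contractive_fromBlocks hα hα') h2
    convert h3 using 1
    have e : (Matrix.kroneckerTMul ℂ (Matrix.fromBlocks v 0 0 v')
        (Matrix.fromBlocks w 0 0 w')).submatrix f f = Matrix.fromBlocks
          (Matrix.kroneckerTMul ℂ v w) 0 0 (Matrix.kroneckerTMul ℂ v' w') := by
      ext (⟨i, j⟩ | ⟨i, j⟩) (⟨i', j'⟩ | ⟨i', j'⟩) <;> simp [f, Matrix.kroneckerTMul]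
    rw [e]
    simp only [Matrix.fromBlocks_conjTranspose, Matrix.conjTranspose_zero,
      fromBlocks_sand_fromBlocks, sand_zero]

theorem kroneckerTMul_mem_ball {ι κ : Type} [Fintype ι] [DecidableEq ι] [Fintype κ]
    [DecidableEq κ] {v : Matrix ι ι V} {w : Matrix κ κ W} (hv : v ∈ (posBall V).ball ι)
    (hw : w ∈ (posBall W).ball κ) : Matrix.kroneckerTMul ℂ v w ∈ (maxBall V W).ball (ι × κ) :=
  kroneckerTMul_mem_maxBallSet hv hw

theorem smul_kroneckerTMul_smul {ι κ : Type*} (s t : ℂ) (v : Matrix ι ι V) (w : Matrix κ κ W) :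
    Matrix.kroneckerTMul ℂ (s • v) (t • w) = (s * t) • Matrix.kroneckerTMul ℂ v w := by
  ext p q; simp only [Matrix.kroneckerTMul, Matrix.kroneckerMap_apply, Matrix.smul_apply,
    TensorProduct.smul_tmul_smul]

theorem kroneckerTMul_mem_cone {ι κ : Type} [Fintype ι] [DecidableEq ι] [Fintype κ]
    [DecidableEq κ] {v : Matrix ι ι V} {w : Matrix κ κ W} (hv : v ∈ (posBall V).cone ι)
    (hw : w ∈ (posBall W).cone κ) : Matrix.kroneckerTMul ℂ v w ∈ (maxBall V W).cone (ι × κ) := by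
  obtain ⟨s, hs, a, ha, rfl⟩ := hv
  obtain ⟨t, ht, b, hb, rfl⟩ := hw
  exact ⟨s * t, mul_nonneg hs ht, _, kroneckerTMul_mem_ball ha hb, by
    rw [smul_kroneckerTMul_smul]; push_cast; rfl⟩

theorem mem_cone_maxBall_iff {ι : Type} [Fintype ι] [DecidableEq ι]
    {z : Matrix ι ι (V ⊗[ℂ] W)} : z ∈ (maxBall V W).cone ι ↔ z ∈ maxPreCone V W ι := by
  constructor
  · rintro ⟨t, ht, _, ⟨k, l, v, w, α, hv, -, hw, -, -, rfl⟩, rfl⟩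
    refine ⟨k, l, (t : ℂ) • v, w, αᴴ, MatrixOrderedOperatorSpace.smul_mem t ht hv, hw, ?_⟩
    have := smul_kroneckerTMul_smul (t : ℂ) 1 v w
    rw [one_smul, mul_one] at this
    rw [this, sandwich_eq_sand, sand_smul, Matrix.conjTranspose_conjTranspose]
  · rintro ⟨k, l, v, w, α, hv, hw, rfl⟩
    have := BallSystem.sand_mem_cone αᴴ (kroneckerTMul_mem_cone (mem_cone_posBall_iff.2 hv)
      (mem_cone_posBall_iff.2 hw))
    rwa [Matrix.conjTranspose_conjTranspose] at this

/-- Take the tensor product of the two dominating block matrices and keep the indices with equal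
block labels. This gives the subcross property of the Δ-norms. -/
theorem BallSystem.Dom.kroneckerTMul {ι κ : Type} [Fintype ι] [DecidableEq ι] [Fintype κ]
    [DecidableEq κ] {v : Matrix ι ι V} {w : Matrix κ κ W} {s t : ℝ} (hv : (posBall V).Dom s v)
    (hw : (posBall W).Dom t w) : (maxBall V W).Dom (s * t) (Matrix.kroneckerTMul ℂ v w) := by
  obtain ⟨a, ha, b, hb, h⟩ := hv
  obtain ⟨a', ha', b', hb', h'⟩ := hw
  refine ⟨_, kroneckerTMul_mem_ball ha ha', _, kroneckerTMul_mem_ball hb hb', ?_⟩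
  have h1 := BallSystem.submatrix_mem_cone (kroneckerTMul_mem_cone h h')
    (Sum.elim (Prod.map Sum.inl Sum.inl) (Prod.map Sum.inr Sum.inr) :
      (ι × κ) ⊕ (ι × κ) → (ι ⊕ ι) × (κ ⊕ κ))
  convert h1 using 1
  push_cast
  rw [← smul_kroneckerTMul_smul, ← smul_kroneckerTMul_smul, conjTranspose_kroneckerTMul]
  ext (p | p) (q | q) <;> rfl

theorem exists_smul_of_maxModulus_lt {n : ℕ} {u : Matrix (Fin n) (Fin n) (V ⊗[ℂ] W)}
    (hu : u ∈ maxPreCone V W (Fin n)) {r : ℝ} (h : maxModulus u < r) :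
    ∃ a ∈ (maxBall V W).ball (Fin n), u = (r : ℂ) • a := by
  obtain ⟨_, ⟨k, l, v, w, α, hv, hw, rfl, rfl⟩, hlt⟩ := exists_lt_of_csInf_lt
    (by obtain ⟨k, l, v, w, α, hv, hw, rfl⟩ := hu
        exact ⟨_, k, l, v, w, α, hv, hw, rfl, rfl⟩) h
  have hv0 := OperatorSpace.matNorm_nonneg v
  have hw0 := OperatorSpace.matNorm_nonneg w
  -- The slack makes all three factors positive, so they can be divided out, while their product
  -- stays below `r`.
  obtain ⟨δ, hδ0, hδ⟩ : ∃ δ > 0, (‖α‖ ^ 2 + δ) * (matNorm v + δ) * (matNorm w + δ) < r := by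
    have hc : Filter.Tendsto (fun δ : ℝ => (‖α‖ ^ 2 + δ) * (matNorm v + δ) * (matNorm w + δ))
        (nhdsWithin 0 (Set.Ioi 0)) (nhds ((‖α‖ ^ 2 + 0) * (matNorm v + 0) * (matNorm w + 0))) :=
      ((by fun_prop : Continuous fun δ : ℝ =>
        (‖α‖ ^ 2 + δ) * (matNorm v + δ) * (matNorm w + δ)).tendsto 0).mono_left nhdsWithin_le_nhds
    simp only [add_zero] at hc
    obtain ⟨δ, h1, h2⟩ := ((hc.eventually_lt_const hlt).and self_mem_nhdsWithin).exists
    exact ⟨δ, h2, h1⟩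
  set A := ‖α‖ ^ 2 + δ
  set B := matNorm v + δ
  set C := matNorm w + δ
  have hA : 0 < A := by positivity
  have hB : 0 < B := by positivity
  have hC : 0 < C := by positivity
  have hA1 : (1 - ((((√A)⁻¹ : ℝ) : ℂ) • αᴴ)ᴴ * ((((√A)⁻¹ : ℝ) : ℂ) • αᴴ)).PosSemidef := by
    rw [← norm_le_one_iff_posSemidef, norm_smul, Complex.norm_real,
      Real.norm_of_nonneg (by positivity), inv_mul_le_iff₀ (by positivity), mul_one,
      Matrix.l2_opNorm_conjTranspose]
    exact Real.le_sqrt_of_sq_le (by linarith)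
  have hv1 : matNorm (((B⁻¹ : ℝ) : ℂ) • v) < 1 := by
    rw [OperatorSpace.matNorm_smul, Complex.norm_real, Real.norm_of_nonneg (by positivity),
      inv_mul_lt_iff₀ hB]
    linarith
  have hw1 : matNorm (((C⁻¹ : ℝ) : ℂ) • w) < 1 := by
    rw [OperatorSpace.matNorm_smul, Complex.norm_real, Real.norm_of_nonneg (by positivity),
      inv_mul_lt_iff₀ hC]
    linarith
  refine BallSystem.exists_eq_smul_of_le (s := A * B * C) (by positivity) hδ.le
    (a := sand ((((√A)⁻¹ : ℝ) : ℂ) • αᴴ)ᴴ (Matrix.kroneckerTMul ℂ (((B⁻¹ : ℝ) : ℂ) • v)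
      (((C⁻¹ : ℝ) : ℂ) • w)) ((((√A)⁻¹ : ℝ) : ℂ) • αᴴ))
    ⟨k, l, _, _, _, MatrixOrderedOperatorSpace.smul_mem _ (by positivity) hv, hv1,
      MatrixOrderedOperatorSpace.smul_mem _ (by positivity) hw, hw1, hA1, rfl⟩ ?_
  rw [smul_kroneckerTMul_smul, Matrix.conjTranspose_smul, Matrix.conjTranspose_conjTranspose,
    sand_smul, smul_sand, sand_smul_right, sandwich_eq_sand, smul_smul, smul_smul, smul_smul]
  have h1 : ((A * B * C : ℝ) : ℂ) * ((((B⁻¹ : ℝ) : ℂ) * ((C⁻¹ : ℝ) : ℂ)) *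
      (star (((√A)⁻¹ : ℝ) : ℂ) * (((√A)⁻¹ : ℝ) : ℂ))) = 1 := by
    rw [RCLike.star_def, Complex.conj_ofReal]
    norm_cast
    have : √A * √A = A := Real.mul_self_sqrt hA.le
    field_simp
    rw [sq, this]
  rw [mul_assoc, mul_assoc, h1, one_smul]

theorem maxModulus_smul_le {n : ℕ} {a : Matrix (Fin n) (Fin n) (V ⊗[ℂ] W)}
    (ha : a ∈ (maxBall V W).ball (Fin n)) {r : ℝ} (hr : 0 ≤ r) :
    maxModulus ((r : ℂ) • a) ≤ r := by
  obtain ⟨k, l, v, w, α, hv, hv1, hw, hw1, hα, rfl⟩ := ha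
  refine csInf_le_of_le ⟨0, ?_⟩ ⟨k, l, (r : ℂ) • v, w, αᴴ,
    MatrixOrderedOperatorSpace.smul_mem r hr hv, hw, ?_, rfl⟩ ?_
  · rintro _ ⟨k, l, v, w, α, -, -, -, rfl⟩
    have hv0 := OperatorSpace.matNorm_nonneg v
    have hw0 := OperatorSpace.matNorm_nonneg w
    positivity
  · have := smul_kroneckerTMul_smul (r : ℂ) 1 v w
    rw [one_smul, mul_one] at this
    rw [this, sandwich_eq_sand, sand_smul, Matrix.conjTranspose_conjTranspose]
  · rw [← norm_le_one_iff_posSemidef] at hα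
    rw [OperatorSpace.matNorm_smul, Complex.norm_real, Real.norm_of_nonneg hr,
      Matrix.l2_opNorm_conjTranspose]
    have hv0 := OperatorSpace.matNorm_nonneg v
    have hw0 := OperatorSpace.matNorm_nonneg w
    calc ‖α‖ ^ 2 * (r * matNorm v) * matNorm w ≤ 1 ^ 2 * (r * 1) * 1 := by gcongr
      _ = r := by ring

end Ordered

theorem maxModulus_nonneg [OperatorSpace V] [OperatorSpace W] {n : ℕ}
    (u : Matrix (Fin n) (Fin n) (V ⊗[ℂ] W)) : 0 ≤ maxModulus u := by
  refine Real.sInf_nonneg ?_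
  rintro _ ⟨k, l, v, w, α, -, -, -, rfl⟩
  have hv0 := OperatorSpace.matNorm_nonneg v
  have hw0 := OperatorSpace.matNorm_nonneg w
  positivity

variable [MatrixRegularOperatorSpace V] [MatrixRegularOperatorSpace W]

theorem absorbing_maxBall (V W : Type*) [AddCommGroup V] [Module ℂ V] [StarAddMonoid V]
    [StarModule ℂ V] [MatrixStructure V] [AddCommGroup W] [Module ℂ W] [StarAddMonoid W]
    [StarModule ℂ W] [MatrixStructure W] [MatrixRegularOperatorSpace V]
    [MatrixRegularOperatorSpace W] : (maxBall V W).Absorbing := by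
  intro x
  suffices h : ∃ c d, Matrix.fromBlocks c (Matrix.of fun _ _ : Unit => x)
      (Matrix.of fun _ _ : Unit => x)ᴴ d ∈ (maxBall V W).cone (Unit ⊕ Unit) by
    obtain ⟨c, d, h⟩ := h
    exact BallSystem.exists_dom_of_mem_cone h
  have htmul : ∀ (v : V) (w : W), ∃ c d, Matrix.fromBlocks c (Matrix.of fun _ _ : Unit => v ⊗ₜ[ℂ] w)
      (Matrix.of fun _ _ : Unit => v ⊗ₜ[ℂ] w)ᴴ d ∈ (maxBall V W).cone (Unit ⊕ Unit) := by
    intro v w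
    obtain ⟨s, hs, hv⟩ := (gauge_posBall V).absorbing v
    obtain ⟨t, ht, hw⟩ := (gauge_posBall W).absorbing w
    obtain ⟨a, -, b, -, h⟩ := (hv.kroneckerTMul hw).submatrix (Equiv.punitProd Unit).symm
    exact ⟨_, _, h⟩
  induction x with
  | zero =>
    have := htmul 0 0
    rwa [TensorProduct.zero_tmul] at this
  | tmul v w => exact htmul v w
  | add x y hx hy =>
    obtain ⟨c, d, h⟩ := hx
    obtain ⟨c', d', h'⟩ := hy
    refine ⟨c + c', d + d', ?_⟩
    have h1 := BallSystem.add_mem_cone h h'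
    rw [Matrix.fromBlocks_add, ← Matrix.conjTranspose_add] at h1
    exact h1

/-- The norms of `V ⊗_Δ W` are the gauges of its ball system. -/
theorem gauge_maxBall (V W : Type*) [AddCommGroup V] [Module ℂ V] [StarAddMonoid V]
    [StarModule ℂ V] [MatrixStructure V] [AddCommGroup W] [Module ℂ W] [StarAddMonoid W]
    [StarModule ℂ W] [MatrixStructure W] [MatrixRegularOperatorSpace V]
    [MatrixRegularOperatorSpace W] : Gauge (maxBall V W) where
  matNorm_nonneg x := by
    refine Real.sInf_nonneg ?_
    rintro _ ⟨u, u', -, rfl⟩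
    exact (maxModulus_nonneg u).trans (le_max_left _ _)
  dom_of_lt {n} x r hr hx := by
    -- Absorption makes the set in the infimum nonempty, which excludes the default value of `sInf`.
    obtain ⟨_, ⟨u, u', h, rfl⟩, hlt⟩ := exists_lt_of_csInf_lt (by
      obtain ⟨t, ht, a, ha, b, hb, h⟩ := (absorbing_maxBall V W).exists_dom x
      exact ⟨_, _, _, mem_cone_maxBall_iff.1 h, rfl⟩) hx
    have h' := mem_cone_maxBall_iff.2 h
    have hu : u ∈ maxPreCone V W (Fin n) :=
      mem_cone_maxBall_iff.1 (BallSystem.submatrix_mem_cone h' Sum.inl)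
    have hu' : u' ∈ maxPreCone V W (Fin n) :=
      mem_cone_maxBall_iff.1 (BallSystem.submatrix_mem_cone h' Sum.inr)
    obtain ⟨a, ha, rfl⟩ := exists_smul_of_maxModulus_lt hu ((le_max_left _ _).trans_lt hlt)
    obtain ⟨b, hb, rfl⟩ := exists_smul_of_maxModulus_lt hu' ((le_max_right _ _).trans_lt hlt)
    exact ⟨a, ha, b, hb, h'⟩
  le_of_dom {n} x r hr hx := by
    obtain ⟨a, ha, b, hb, h⟩ := hx
    refine csInf_le_of_le ⟨0, ?_⟩ ⟨_, _, mem_cone_maxBall_iff.1 h, rfl⟩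
      (max_le (maxModulus_smul_le ha hr) (maxModulus_smul_le hb hr))
    rintro _ ⟨u, u', -, rfl⟩
    exact (maxModulus_nonneg u).trans (le_max_left _ _)

end MaxBall

attribute [local instance] maxStructure

theorem norm_entry_le {ι : Type*} [Fintype ι] [DecidableEq ι] (A : Matrix ι ι ℂ) (i j : ι) :
    ‖A i j‖ ≤ ‖A‖ := by
  have h := two_mul_norm_dotProduct_mulVec_le (le_refl ‖A‖) (Pi.single i 1) (Pi.single j 1)
  have e : ∀ i : ι, ∑ p, ‖(Pi.single i (1 : ℂ) : ι → ℂ) p‖ ^ 2 = 1 := by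
    intro i
    rw [Finset.sum_eq_single i] <;> simp +contextual
  rw [e, e] at h
  have e2 : star (Pi.single i (1 : ℂ) : ι → ℂ) = Pi.single i 1 := by
    rw [← Pi.single_star]; simp
  rw [e2] at h
  simp only [Matrix.mulVec_single_one, single_one_dotProduct, Matrix.col_apply] at h
  linarith

/-- The extension theorem for `r⁻¹ F`, rescaled. -/
theorem BallSystem.exists_posMap_corner_of_le {X : Type*} [AddCommGroup X] [Module ℂ X]
    [StarAddMonoid X] [StarModule ℂ X] {S : BallSystem X} {κ : Type} [Fintype κ] [DecidableEq κ]
    (hS : S.Absorbing) (F : X →ₗ[ℂ] Matrix κ κ ℂ) {r : ℝ} (hr : 0 < r)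
    (hF : ∀ x : Matrix κ κ X, S.Dom 1 x → ‖amp F x‖ ≤ r) :
    ∃ U U' : X →ₗ[ℂ] Matrix κ κ ℂ, S.PosMap (blockMap U F (adjMap F) U') ∧
      S.BoundedBy r U ∧ S.BoundedBy r U' := by
  have hrc : (r : ℂ) ≠ 0 := by exact_mod_cast hr.ne'
  obtain ⟨U, U', h, hU, hU'⟩ := exists_posMap_corner hS (((r⁻¹ : ℝ) : ℂ) • F) (fun x hx => by
    rw [smul_amp, norm_smul, Complex.norm_real, Real.norm_of_nonneg (inv_nonneg.2 hr.le),
      inv_mul_le_iff₀ hr, mul_one]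
    exact hF x hx)
  have hb : ∀ U : X →ₗ[ℂ] Matrix κ κ ℂ, S.BoundedBy 1 U → S.BoundedBy r ((r : ℂ) • U) := by
    intro U hU ι _ _ a ha
    have h1 := (hU ι a ha).smul (a := (r : ℂ)) (by exact_mod_cast hr.le)
    rwa [Complex.ofReal_one, one_smul, smul_sub, ← smul_amp] at h1
  refine ⟨(r : ℂ) • U, (r : ℂ) • U', fun ι _ _ a ha => ?_, hb U hU, hb U' hU'⟩
  have h1 := (h ι a ha).smul (a := (r : ℂ)) (by exact_mod_cast hr.le)
  rw [← smul_amp] at h1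
  convert h1 using 2
  ext x : 1
  simp only [blockMap_apply, LinearMap.smul_apply, Matrix.fromBlocks_smul, adjMap_apply,
    Matrix.conjTranspose_smul, smul_smul]
  congr 1
  · rw [← Complex.ofReal_mul, mul_inv_cancel₀ hr.ne', Complex.ofReal_one, one_smul]
  · rw [RCLike.star_def, Complex.conj_ofReal, ← Complex.ofReal_mul, mul_inv_cancel₀ hr.ne',
      Complex.ofReal_one, one_smul]

/-! ### Tensor products of completely positive maps -/

section TensorMap

variable {V W : Type*} [AddCommGroup V] [Module ℂ V] [StarAddMonoid V] [StarModule ℂ V]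
  [MatrixStructure V] [AddCommGroup W] [Module ℂ W] [StarAddMonoid W] [StarModule ℂ W]
  [MatrixStructure W]

theorem tensorMap_tmul {E F κ ν : Type*} [AddCommGroup E] [Module ℂ E] [AddCommGroup F]
    [Module ℂ F] (φ : E →ₗ[ℂ] Matrix κ κ ℂ) (ψ : F →ₗ[ℂ] Matrix ν ν ℂ) (v : E) (w : F) :
    tensorMap φ ψ (v ⊗ₜ w) = φ v ⊗ₖ ψ w := by
  rfl

theorem amp_tensorMap_kroneckerTMul {E F κ ν ι μ : Type*} [AddCommGroup E] [Module ℂ E]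
    [AddCommGroup F] [Module ℂ F] (φ : E →ₗ[ℂ] Matrix κ κ ℂ) (ψ : F →ₗ[ℂ] Matrix ν ν ℂ)
    (v : Matrix ι ι E) (w : Matrix μ μ F) :
    amp (tensorMap φ ψ) (Matrix.kroneckerTMul ℂ v w) =
      (amp φ v ⊗ₖ amp ψ w).submatrix (Equiv.prodProdProdComm ι μ κ ν)
        (Equiv.prodProdProdComm ι μ κ ν) := by
  ext p q
  simp [amp_apply, tensorMap_tmul, Matrix.kroneckerTMul]

variable [MatrixOrderedOperatorSpace V] [MatrixOrderedOperatorSpace W]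

/-- Positivity of a map on `V ⊗_Δ W` has to be checked on elementary tensors only. -/
theorem posMap_maxBall_of_kroneckerTMul {κ : Type*} [Fintype κ] [DecidableEq κ]
    {F : V ⊗[ℂ] W →ₗ[ℂ] Matrix κ κ ℂ}
    (h : ∀ (k l : ℕ) (v : Matrix (Fin k) (Fin k) V) (w : Matrix (Fin l) (Fin l) W),
      v ∈ matCone V k → w ∈ matCone W l → (amp F (Matrix.kroneckerTMul ℂ v w)).PosSemidef) :
    (maxBall V W).PosMap F := by
  refine BallSystem.PosMap.of_ball ?_
  rintro ι _ _ _ ⟨k, l, v, w, α, hv, -, hw, -, -, rfl⟩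
  rw [amp_sand]
  have := (h k l v w hv hw).conjTranspose_mul_mul_same (α ⊗ₖ (1 : Matrix κ κ ℂ))
  rwa [Matrix.conjTranspose_kronecker, Matrix.conjTranspose_one] at this

theorem boundedBy_maxBall_of_kroneckerTMul {κ : Type*} [Fintype κ] [DecidableEq κ]
    {F : V ⊗[ℂ] W →ₗ[ℂ] Matrix κ κ ℂ} {r : ℝ} (hr : 0 ≤ r)
    (h : ∀ (k l : ℕ) (v : Matrix (Fin k) (Fin k) V) (w : Matrix (Fin l) (Fin l) W),
      v ∈ (posBall V).ball (Fin k) → w ∈ (posBall W).ball (Fin l) →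
      ((r : ℂ) • 1 - amp F (Matrix.kroneckerTMul ℂ v w)).PosSemidef) :
    (maxBall V W).BoundedBy r F := by
  rintro ι _ _ _ ⟨k, l, v, w, α, hv, hv1, hw, hw1, hα, rfl⟩
  rw [amp_sand]
  have h1 := (h k l v w (mem_posBall_iff.2 ⟨hv, hv1⟩)
    (mem_posBall_iff.2 ⟨hw, hw1⟩)).conjTranspose_mul_mul_same (α ⊗ₖ (1 : Matrix κ κ ℂ))
  have h2 := (contractive_kronecker hα (contractive_one (ι := κ))).smul (a := (r : ℂ))
    (by exact_mod_cast hr)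
  convert h1.add h2 using 1
  rw [Matrix.conjTranspose_kronecker, Matrix.conjTranspose_one, Matrix.mul_sub, Matrix.sub_mul,
    smul_sub, Matrix.mul_smul, Matrix.smul_mul, Matrix.mul_one]
  abel

theorem posMap_tensorMap {κ ν : Type*} [Fintype κ] [DecidableEq κ] [Fintype ν] [DecidableEq ν]
    {φ : V →ₗ[ℂ] Matrix κ κ ℂ} {ψ : W →ₗ[ℂ] Matrix ν ν ℂ} (hφ : (posBall V).PosMap φ)
    (hψ : (posBall W).PosMap ψ) : (maxBall V W).PosMap (tensorMap φ ψ) := by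
  refine posMap_maxBall_of_kroneckerTMul fun k l v w hv hw => ?_
  rw [amp_tensorMap_kroneckerTMul]
  exact (posSemidef_kronecker (hφ _ _ (mem_cone_posBall_iff.2 hv))
    (hψ _ _ (mem_cone_posBall_iff.2 hw))).submatrix _

theorem boundedBy_tensorMap {κ ν : Type*} [Fintype κ] [DecidableEq κ] [Fintype ν] [DecidableEq ν]
    {φ : V →ₗ[ℂ] Matrix κ κ ℂ} {ψ : W →ₗ[ℂ] Matrix ν ν ℂ} (hφ : (posBall V).PosMap φ)
    {r s : ℝ} (hr : 0 ≤ r) (hs : 0 ≤ s)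
    (hφr : (posBall V).BoundedBy r φ) (hψs : (posBall W).BoundedBy s ψ) :
    (maxBall V W).BoundedBy (r * s) (tensorMap φ ψ) := by
  refine boundedBy_maxBall_of_kroneckerTMul (mul_nonneg hr hs) fun k l v w hv hw => ?_
  rw [amp_tensorMap_kroneckerTMul]
  -- With `P`, `Q` the values of the two amplified maps, `r s - P ⊗ Q = (r - P) ⊗ s + P ⊗ (s - Q)`.
  have h1 := posSemidef_kronecker (hφr _ _ hv)
    ((Matrix.PosSemidef.one (n := Fin l × ν) (R := ℂ)).smul (a := (s : ℂ)) (by exact_mod_cast hs))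
  have h2 := posSemidef_kronecker (hφ _ _ (BallSystem.mem_cone_of_mem_ball hv)) (hψs _ _ hw)
  convert (h1.add h2).submatrix (Equiv.prodProdProdComm (Fin k) (Fin l) κ ν) using 1
  have e : (1 : Matrix ((Fin k × Fin l) × κ × ν) ((Fin k × Fin l) × κ × ν) ℂ) =
      ((1 : Matrix (Fin k × κ) (Fin k × κ) ℂ) ⊗ₖ (1 : Matrix (Fin l × ν) (Fin l × ν) ℂ)).submatrix
        (Equiv.prodProdProdComm (Fin k) (Fin l) κ ν)
        (Equiv.prodProdProdComm (Fin k) (Fin l) κ ν) := by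
    rw [Matrix.one_kronecker_one, Matrix.submatrix_one_equiv]
  rw [e]
  ext p q
  simp only [Matrix.sub_apply, Matrix.smul_apply, Matrix.submatrix_apply, Matrix.add_apply,
    Matrix.kroneckerMap_apply, smul_eq_mul, Complex.ofReal_mul]
  ring

end TensorMap

/-! ### The canonical map -/

section Canonical

variable {V W : Type*} [AddCommGroup V] [Module ℂ V] [StarAddMonoid V] [StarModule ℂ V]
  [MatrixStructure V] [AddCommGroup W] [Module ℂ W] [StarAddMonoid W] [StarModule ℂ W]
  [MatrixStructure W] [MatrixRegularOperatorSpace V] [MatrixRegularOperatorSpace W]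

/-- A bounded functional is a corner of a bounded completely positive map. -/
theorem exists_functional_corner {X : Type*} [AddCommGroup X] [Module ℂ X] [StarAddMonoid X]
    [StarModule ℂ X] [MatrixStructure X] {S : BallSystem X} (hS : Gauge S) (f : dualSpace X) :
    ∃ r : ℝ, 0 < r ∧ ∃ U U' : X →ₗ[ℂ] Matrix Unit Unit ℂ,
      S.PosMap (blockMap U (functionalMap (Matrix.of fun _ _ : Unit => f))
        (adjMap (functionalMap (Matrix.of fun _ _ : Unit => f))) U') ∧
      S.BoundedBy r U ∧ S.BoundedBy r U' := by
  obtain ⟨C, hC, h⟩ := hS.exists_norm_amp_functionalMap_le (Matrix.of fun _ _ : Unit => f)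
  exact ⟨C + 1, by positivity, BallSystem.exists_posMap_corner_of_le hS.absorbing _
    (by positivity) fun x hx => (h Unit x 1 zero_le_one hx).trans (by linarith)⟩

/-- The tensor product of bounded functionals is bounded on `V ⊗_Δ W`. -/
theorem dualDistrib_tmul_mem_dualSpace (f : dualSpace V) (g : dualSpace W) :
    TensorProduct.dualDistrib ℂ V W (f.1 ⊗ₜ g.1) ∈ dualSpace (V ⊗[ℂ] W) := by
  obtain ⟨r, hr, P, P', hP, hP1, hP2⟩ := exists_functional_corner (gauge_posBall V) f
  obtain ⟨s, hs, Q, Q', hQ, hQ1, hQ2⟩ := exists_functional_corner (gauge_posBall W) g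
  set F := functionalMap (Matrix.of fun _ _ : Unit => f) with hF
  set G := functionalMap (Matrix.of fun _ _ : Unit => g) with hG
  have h1 := posMap_tensorMap hP hQ
  -- The tensor product of the two c.p. block maps, restricted to equal block labels, is a c.p.
  -- block map with corner `F ⊗ G`. Boundedness of `f ⊗ g` follows from its diagonal.
  let φ : (Unit × Unit) ⊕ (Unit × Unit) → (Unit ⊕ Unit) × (Unit ⊕ Unit) :=
    Sum.elim (Prod.map Sum.inl Sum.inl) (Prod.map Sum.inr Sum.inr)
  have e : ∀ x, blockMap (tensorMap P Q) (tensorMap F G) (adjMap (tensorMap F G))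
      (tensorMap P' Q') x = (tensorMap (blockMap P F (adjMap F) P')
        (blockMap Q G (adjMap G) Q') x).submatrix φ φ := by
    intro x
    induction x with
    | zero => simp
    | tmul v w =>
      ext (p | p) (q | q) <;>
      simp [blockMap_apply, tensorMap_tmul, φ, adjMap_apply]
    | add x y hx hy => rw [map_add, hx, hy, map_add]; rfl
  have h2 : (maxBall V W).PosMap (blockMap (tensorMap P Q) (tensorMap F G)
      (adjMap (tensorMap F G)) (tensorMap P' Q')) := by
    intro ι _ _ a ha
    convert (h1 ι a ha).submatrix (Prod.map id φ : ι × _ → ι × _) using 1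
    ext p q
    simp [amp_apply, e]
  have h3 := fun x : Matrix (Fin 1) (Fin 1) (V ⊗[ℂ] W) => (gauge_maxBall V W).norm_amp_le
    (F := tensorMap F G) (r := r * s) (by positivity) (fun x hx => by
      simpa using h2.norm_amp_corner_le (mul_nonneg hr.le hs.le)
        (boundedBy_tensorMap hP.blockMap_left hr.le hs.le hP1 hQ1)
        (boundedBy_tensorMap hP.blockMap_right hr.le hs.le hP2 hQ2) zero_le_one hx) x
  refine ⟨r * s, fun x => le_trans ?_ (h3 _)⟩
  refine le_of_eq_of_le ?_ (norm_entry_le _ (0, ((), ())) (0, ((), ())))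
  congr 1
  rw [amp_apply, Matrix.of_apply]
  induction x with
  | zero => simp
  | tmul v w => simp [tensorMap_tmul, F, G, functionalMap]
  | add x y hx hy => rw [map_add, hx, hy, map_add]; rfl

variable (V W) in
/-- The canonical map `V^* ⊗ W^* → (V ⊗_Δ W)^*`. -/
noncomputable def canonicalMap : dualSpace V ⊗[ℂ] dualSpace W →ₗ[ℂ] dualSpace (V ⊗[ℂ] W) :=
  LinearMap.codRestrict _ (TensorProduct.dualDistrib ℂ V W ∘ₗ
    TensorProduct.map (dualSpace V).subtype (dualSpace W).subtype) fun z => by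
      induction z with
      | zero => rw [map_zero]; exact Submodule.zero_mem _
      | tmul f g => exact dualDistrib_tmul_mem_dualSpace f g
      | add x y hx hy => rw [map_add]; exact Submodule.add_mem _ hx hy

theorem canonicalMap_tmul (f : dualSpace V) (g : dualSpace W) (v : V) (w : W) :
    (canonicalMap V W (f ⊗ₜ g)).1 (v ⊗ₜ w) = f.1 v * g.1 w := rfl

theorem star_canonicalMap (z : dualSpace V ⊗[ℂ] dualSpace W) (x : V ⊗[ℂ] W) :
    (canonicalMap V W (star z)).1 x = star ((canonicalMap V W z).1 (star x)) := by
  induction z with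
  | zero => simp
  | tmul f g =>
    induction x with
    | zero => simp
    | tmul v w => simp [canonicalMap_tmul, dualStar_apply]
    | add x y hx hy => rw [map_add, hx, hy, star_add, map_add, star_add]
  | add y z hy hz =>
    rw [star_add, map_add, map_add, Submodule.coe_add, Submodule.coe_add, LinearMap.add_apply,
      LinearMap.add_apply, hy, hz, star_add]

/-! ### Bijectivity of the canonical map -/

theorem mem_dualSpace_of_finiteDimensional [FiniteDimensional ℂ V] (f : V →ₗ[ℂ] ℂ) :
    f ∈ dualSpace V := by
  let : Norm V := ⟨fun v => matNorm (n := 1) (Matrix.of fun _ _ => v)⟩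
  have core : NormedSpace.Core ℂ V :=
    { norm_nonneg := fun v => OperatorSpace.matNorm_nonneg _
      norm_smul := fun c v => OperatorSpace.matNorm_smul c (Matrix.of fun _ _ : Fin 1 => v)
      norm_triangle := fun v w => OperatorSpace.matNorm_add_le
        (Matrix.of fun _ _ : Fin 1 => v) (Matrix.of fun _ _ : Fin 1 => w)
      norm_eq_zero_iff := fun v => by
        refine (OperatorSpace.matNorm_eq_zero_iff (Matrix.of fun _ _ : Fin 1 => v)).trans ?_
        refine ⟨fun h => congrFun (congrFun h 0) 0, fun h => ?_⟩
        rw [h]; rfl }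
  let := NormedAddCommGroup.ofCore core
  let := NormedSpace.ofCore core
  exact ⟨‖f.toContinuousLinearMap‖, fun v => f.toContinuousLinearMap.le_opNorm v⟩

/-- The `+ 1` leaves room for the strict inequality required to dominate `v`. The factor of `w` is
exact, by a limit, because slices must be bounded linearly in `w`. -/
theorem matNorm_tmul_le (v : V) (w : W) :
    matNorm (n := 1) (Matrix.of fun _ _ => v ⊗ₜ[ℂ] w) ≤
      (matNorm (n := 1) (Matrix.of fun _ _ => v) + 1) *
        matNorm (n := 1) (Matrix.of fun _ _ => w) := by
  have hv0 := OperatorSpace.matNorm_nonneg (n := 1) (Matrix.of fun _ _ => v)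
  have hw0 := OperatorSpace.matNorm_nonneg (n := 1) (Matrix.of fun _ _ => w)
  have hv := (gauge_posBall V).dom_of_lt (n := 1) (Matrix.of fun _ _ => v) (by linarith)
    (lt_add_one _)
  have key : ∀ t, matNorm (n := 1) (Matrix.of fun _ _ => w) < t →
      matNorm (n := 1) (Matrix.of fun _ _ => v ⊗ₜ[ℂ] w) ≤
        (matNorm (n := 1) (Matrix.of fun _ _ => v) + 1) * t := by
    intro t ht
    have hw := (gauge_posBall W).dom_of_lt (n := 1) (Matrix.of fun _ _ => w) (by linarith) ht
    exact (gauge_maxBall V W).le_of_dom _ (by nlinarith)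
      ((hv.kroneckerTMul hw).submatrix (Equiv.prodUnique (Fin 1) (Fin 1)).symm)
  refine ge_of_tendsto (x := nhdsWithin (matNorm (n := 1) (Matrix.of fun _ _ => w)) (Set.Ioi _))
    (f := fun t => (matNorm (n := 1) (Matrix.of fun _ _ => v) + 1) * t) ?_
    (Filter.eventually_of_mem self_mem_nhdsWithin key)
  exact ((continuous_const.mul continuous_id).tendsto _).mono_left nhdsWithin_le_nhds

theorem matNorm_tmul_le' (v : V) (w : W) :
    matNorm (n := 1) (Matrix.of fun _ _ => v ⊗ₜ[ℂ] w) ≤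
      (matNorm (n := 1) (Matrix.of fun _ _ => w) + 1) *
        matNorm (n := 1) (Matrix.of fun _ _ => v) := by
  have hv0 := OperatorSpace.matNorm_nonneg (n := 1) (Matrix.of fun _ _ => v)
  have hw0 := OperatorSpace.matNorm_nonneg (n := 1) (Matrix.of fun _ _ => w)
  have hw := (gauge_posBall W).dom_of_lt (n := 1) (Matrix.of fun _ _ => w) (by linarith)
    (lt_add_one _)
  have key : ∀ t, matNorm (n := 1) (Matrix.of fun _ _ => v) < t →
      matNorm (n := 1) (Matrix.of fun _ _ => v ⊗ₜ[ℂ] w) ≤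
        (matNorm (n := 1) (Matrix.of fun _ _ => w) + 1) * t := by
    intro t ht
    have hv := (gauge_posBall V).dom_of_lt (n := 1) (Matrix.of fun _ _ => v) (by linarith) ht
    rw [mul_comm]
    exact (gauge_maxBall V W).le_of_dom _ (by nlinarith)
      ((hv.kroneckerTMul hw).submatrix (Equiv.prodUnique (Fin 1) (Fin 1)).symm)
  refine ge_of_tendsto (x := nhdsWithin (matNorm (n := 1) (Matrix.of fun _ _ => v)) (Set.Ioi _))
    (f := fun t => (matNorm (n := 1) (Matrix.of fun _ _ => w) + 1) * t) ?_
    (Filter.eventually_of_mem self_mem_nhdsWithin key)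
  exact ((continuous_const.mul continuous_id).tendsto _).mono_left nhdsWithin_le_nhds

variable (W) in
/-- The slice `F ↦ F(v ⊗ ·)`. -/
noncomputable def sliceLeft (v : V) : dualSpace (V ⊗[ℂ] W) →ₗ[ℂ] dualSpace W where
  toFun F := ⟨F.1 ∘ₗ TensorProduct.mk ℂ V W v, by
    obtain ⟨C, hC⟩ := F.2
    refine ⟨|C| * (matNorm (n := 1) (Matrix.of fun _ _ => v) + 1), fun w => ?_⟩
    refine (hC (v ⊗ₜ w)).trans ?_
    rw [mul_assoc]
    exact mul_le_mul (le_abs_self C) (matNorm_tmul_le v w) ((gauge_maxBall V W).matNorm_nonneg _)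
      (abs_nonneg C)⟩
  map_add' F G := rfl
  map_smul' c F := rfl

variable (V) in
/-- The slice `F ↦ F(· ⊗ w)`. -/
noncomputable def sliceRight (w : W) : dualSpace (V ⊗[ℂ] W) →ₗ[ℂ] dualSpace V where
  toFun F := ⟨F.1 ∘ₗ (TensorProduct.mk ℂ V W).flip w, by
    obtain ⟨C, hC⟩ := F.2
    refine ⟨|C| * (matNorm (n := 1) (Matrix.of fun _ _ => w) + 1), fun v => ?_⟩
    refine (hC (v ⊗ₜ w)).trans ?_
    rw [mul_assoc]
    exact mul_le_mul (le_abs_self C) (matNorm_tmul_le' v w) ((gauge_maxBall V W).matNorm_nonneg _)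
      (abs_nonneg C)⟩
  map_add' F G := rfl
  map_smul' c F := rfl

/-- With a basis `b i` of the finite dimensional factor and its coordinates `c i`, the inverse is `F
↦ ∑ c i ⊗ F(b i ⊗ ·)`, or its mirror image. -/
theorem canonicalMap_bijective (hfin : FiniteDimensional ℂ V ∨ FiniteDimensional ℂ W) :
    Function.Bijective (canonicalMap V W) := by
  suffices h : ∃ L : dualSpace (V ⊗[ℂ] W) →ₗ[ℂ] dualSpace V ⊗[ℂ] dualSpace W,
      L ∘ₗ canonicalMap V W = LinearMap.id ∧ canonicalMap V W ∘ₗ L = LinearMap.id by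
    obtain ⟨L, h1, h2⟩ := h
    exact Function.bijective_iff_has_inverse.2
      ⟨L, fun z => LinearMap.congr_fun h1 z, fun F => LinearMap.congr_fun h2 F⟩
  rcases hfin with h | h
  · let b := Module.finBasis ℂ V
    let c : Fin (Module.finrank ℂ V) → dualSpace V := fun i =>
      ⟨b.coord i, mem_dualSpace_of_finiteDimensional _⟩
    refine ⟨∑ i, TensorProduct.mk ℂ (dualSpace V) (dualSpace W) (c i) ∘ₗ sliceLeft W (b i), ?_, ?_⟩
    · refine TensorProduct.ext' fun f g => ?_
      have e1 : ∀ i, sliceLeft W (b i) (canonicalMap V W (f ⊗ₜ g)) = f.1 (b i) • g := fun i => rfl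
      have e2 : ∑ i, f.1 (b i) • c i = f := by
        refine Subtype.ext (b.ext fun j => ?_)
        simp [c]
      simp only [LinearMap.comp_apply, LinearMap.sum_apply, e1, TensorProduct.mk_apply,
        TensorProduct.tmul_smul, LinearMap.id_apply]
      simp only [TensorProduct.smul_tmul']
      rw [← TensorProduct.sum_tmul, e2]
    · refine LinearMap.ext fun F => Subtype.ext (TensorProduct.ext' fun v w => ?_)
      simp only [LinearMap.comp_apply, LinearMap.sum_apply, map_sum, TensorProduct.mk_apply,
        LinearMap.id_apply, Submodule.coe_sum, canonicalMap_tmul]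
      have e1 : ∀ i, (sliceLeft W (b i) F).1 w = F.1 (b i ⊗ₜ w) := fun i => rfl
      have e2 : ∀ i, (c i).1 v = b.repr v i := fun i => rfl
      conv_rhs => rw [← b.sum_repr v, TensorProduct.sum_tmul, map_sum]
      refine Finset.sum_congr rfl fun i _ => ?_
      rw [← TensorProduct.smul_tmul', map_smul, smul_eq_mul]
      rfl
  · let b := Module.finBasis ℂ W
    let c : Fin (Module.finrank ℂ W) → dualSpace W := fun i =>
      ⟨b.coord i, mem_dualSpace_of_finiteDimensional _⟩
    refine ⟨∑ i, (TensorProduct.mk ℂ (dualSpace V) (dualSpace W)).flip (c i) ∘ₗ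
      sliceRight V (b i), ?_, ?_⟩
    · refine TensorProduct.ext' fun f g => ?_
      have e1 : ∀ i, sliceRight V (b i) (canonicalMap V W (f ⊗ₜ g)) = g.1 (b i) • f := fun i =>
        Subtype.ext (LinearMap.ext fun v => mul_comm _ _)
      have e2 : ∑ i, g.1 (b i) • c i = g := by
        refine Subtype.ext (b.ext fun j => ?_)
        simp [c]
      simp only [LinearMap.comp_apply, LinearMap.sum_apply, e1, LinearMap.flip_apply,
        TensorProduct.mk_apply, LinearMap.id_apply]
      simp only [TensorProduct.smul_tmul]
      rw [← TensorProduct.tmul_sum, e2]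
    · refine LinearMap.ext fun F => Subtype.ext (TensorProduct.ext' fun v w => ?_)
      simp only [LinearMap.comp_apply, LinearMap.sum_apply, map_sum, LinearMap.flip_apply,
        TensorProduct.mk_apply, LinearMap.id_apply, Submodule.coe_sum, canonicalMap_tmul]
      have e1 : ∀ i, (sliceRight V (b i) F).1 v = F.1 (v ⊗ₜ b i) := fun i => rfl
      have e2 : ∀ i, (c i).1 w = b.repr w i := fun i => rfl
      simp only [e1, e2]
      conv_rhs => rw [← b.sum_repr w, TensorProduct.tmul_sum, map_sum]
      simp [mul_comm]

end Canonical

/-! ### Evaluation maps on the dual space -/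

section Evaluation

variable {V : Type*} [AddCommGroup V] [Module ℂ V] [MatrixStructure V]

/-- The map `f ↦ [f(v_ij)]` on the dual space. -/
def evalMap {k : ℕ} (v : Matrix (Fin k) (Fin k) V) :
    dualSpace V →ₗ[ℂ] Matrix (Fin k) (Fin k) ℂ where
  toFun f := v.map f.1
  map_add' _ _ := rfl
  map_smul' _ _ := rfl

/-- Evaluating `f` at `v` and applying the map `f` to `v` give the same matrix up to the order of
the two indices. -/
theorem amp_evalMap {k : ℕ} {ι : Type*} (v : Matrix (Fin k) (Fin k) V)
    (f : Matrix ι ι (dualSpace V)) :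
    amp (evalMap v) f = (amp (functionalMap f) v).submatrix Prod.swap Prod.swap := rfl

theorem norm_amp_evalMap {k : ℕ} {ι : Type*} [Fintype ι] [DecidableEq ι]
    (v : Matrix (Fin k) (Fin k) V) (f : Matrix ι ι (dualSpace V)) :
    ‖amp (evalMap v) f‖ = ‖amp (functionalMap f) v‖ := by
  rw [amp_evalMap]
  exact norm_reindex_self (Equiv.prodComm (Fin k) ι) (amp (functionalMap f) v)

theorem isCompletelyPositive_evalMap {k : ℕ} {v : Matrix (Fin k) (Fin k) V}
    (hv : v ∈ matCone V k) : IsCompletelyPositive (evalMap v) := by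
  intro n f hf
  rw [amp_evalMap]
  exact (hf.2 k v hv).submatrix _

variable [StarAddMonoid V] [StarModule ℂ V]

theorem Gauge.norm_amp_evalMap_le {S : BallSystem V} (hS : Gauge S) {k n : ℕ}
    {v : Matrix (Fin k) (Fin k) V} {t : ℝ} (ht : 0 < t) (hv : matNorm v < t)
    (f : Matrix (Fin n) (Fin n) (dualSpace V)) : ‖amp (evalMap v) f‖ ≤ t * matNorm f := by
  rw [norm_amp_evalMap, mul_comm]
  exact hS.norm_amp_le_cbNorm (hS.isCompletelyBounded f) ht (hS.dom_of_lt v ht hv)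

theorem Gauge.isBoundedMap_evalMap {S : BallSystem V} (hS : Gauge S) {k : ℕ}
    (v : Matrix (Fin k) (Fin k) V) : IsBoundedMap (evalMap v) := by
  refine ⟨matNorm v + 1, fun f => ?_⟩
  refine le_trans ?_ (hS.norm_amp_evalMap_le (by linarith [hS.matNorm_nonneg v])
    (lt_add_one (matNorm v)) (Matrix.of fun _ _ : Fin 1 => f))
  exact norm_submatrix_equiv_le (Equiv.uniqueProd (Fin k) (Fin 1)).symm
    (amp (evalMap v) (Matrix.of fun _ _ : Fin 1 => f)) |>.trans_eq' rfl

theorem Gauge.isCompletelyContractive_evalMap {S : BallSystem V} (hS : Gauge S) {k : ℕ}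
    {v : Matrix (Fin k) (Fin k) V} (hv : matNorm v < 1) : IsCompletelyContractive (evalMap v) :=
  fun _ f => by simpa using hS.norm_amp_evalMap_le zero_lt_one hv f

end Evaluation

/-! ### Positivity and norms of elements of `V^* ⊗ W^*` -/

section Canonical

variable {V W : Type*} [AddCommGroup V] [Module ℂ V] [StarAddMonoid V] [StarModule ℂ V]
  [MatrixStructure V] [AddCommGroup W] [Module ℂ W] [StarAddMonoid W] [StarModule ℂ W]
  [MatrixStructure W] [MatrixRegularOperatorSpace V] [MatrixRegularOperatorSpace W]

/-- The slice `f ⊗ g ↦ φ(f)_pq • g`. -/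
noncomputable def dualSlice {k : ℕ} (φ : dualSpace V →ₗ[ℂ] Matrix (Fin k) (Fin k) ℂ)
    (p q : Fin k) : dualSpace V ⊗[ℂ] dualSpace W →ₗ[ℂ] dualSpace W :=
  (TensorProduct.lid ℂ (dualSpace W)).toLinearMap ∘ₗ
    LinearMap.rTensor (dualSpace W) (Matrix.entryLinearMap ℂ ℂ p q ∘ₗ φ)

theorem tensorMap_eq_dualSlice {k l : ℕ} (φ : dualSpace V →ₗ[ℂ] Matrix (Fin k) (Fin k) ℂ)
    (ψ : dualSpace W →ₗ[ℂ] Matrix (Fin l) (Fin l) ℂ) (y : dualSpace V ⊗[ℂ] dualSpace W)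
    (p q : Fin k) (a b : Fin l) :
    tensorMap φ ψ y (p, a) (q, b) = ψ (dualSlice φ p q y) a b := by
  induction y with
  | zero => simp
  | tmul f g => simp [tensorMap_tmul, dualSlice]
  | add x y hx hy => rw [map_add, map_add, map_add, Matrix.add_apply, hx, hy]; rfl

/-- Fubini for functionals: applying `φ` in the first variable commutes with evaluation at `w` in
the second. -/
theorem dualSlice_apply {k : ℕ} (φ : dualSpace V →ₗ[ℂ] Matrix (Fin k) (Fin k) ℂ)
    (y : dualSpace V ⊗[ℂ] dualSpace W) (p q : Fin k) (w : W) :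
    (dualSlice φ p q y).1 w = φ (sliceRight V w (canonicalMap V W y)) p q := by
  induction y with
  | zero => simp
  | tmul f g =>
    have e : sliceRight V w (canonicalMap V W (f ⊗ₜ g)) = g.1 w • f :=
      Subtype.ext (LinearMap.ext fun v => mul_comm _ _)
    simp [e, dualSlice, mul_comm]
  | add x y hx hy =>
    simp only [map_add, Submodule.coe_add, LinearMap.add_apply, Matrix.add_apply, hx, hy]

theorem tensorMap_evalMap {k l : ℕ} (v : Matrix (Fin k) (Fin k) V) (w : Matrix (Fin l) (Fin l) W)
    (y : dualSpace V ⊗[ℂ] dualSpace W) (p q : Fin k) (a b : Fin l) :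
    tensorMap (evalMap v) (evalMap w) y (p, a) (q, b) =
      (canonicalMap V W y).1 (v p q ⊗ₜ w a b) := by
  rw [tensorMap_eq_dualSlice]
  exact dualSlice_apply (evalMap v) y p q (w a b)

variable {ι : Type} [Fintype ι] [DecidableEq ι] {z : Matrix ι ι (dualSpace V ⊗[ℂ] dualSpace W)}

/-- Separates the variables: `φ ⊗ ψ` at `z` is `ψ` alone at a matrix over `W^*` that already
contains `φ`. -/
theorem amp_tensorMap_eq {k l : ℕ} (φ : dualSpace V →ₗ[ℂ] Matrix (Fin k) (Fin k) ℂ)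
    (ψ : dualSpace W →ₗ[ℂ] Matrix (Fin l) (Fin l) ℂ)
    (z : Matrix ι ι (dualSpace V ⊗[ℂ] dualSpace W)) :
    amp (tensorMap φ ψ) z = (amp ψ (Matrix.of fun i j : ι × Fin k =>
      dualSlice φ i.2 j.2 (z i.1 j.1))).submatrix
        (Equiv.prodAssoc ι (Fin k) (Fin l)).symm (Equiv.prodAssoc ι (Fin k) (Fin l)).symm := by
  ext p q
  exact tensorMap_eq_dualSlice φ ψ (z p.1 q.1) p.2.1 q.2.1 p.2.2 q.2.2

theorem amp_functionalMap_dualSlice {k m : ℕ} (φ : dualSpace V →ₗ[ℂ] Matrix (Fin k) (Fin k) ℂ)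
    (z : Matrix ι ι (dualSpace V ⊗[ℂ] dualSpace W)) (w : Matrix (Fin m) (Fin m) W) :
    amp (functionalMap (Matrix.of fun i j : ι × Fin k => dualSlice φ i.2 j.2 (z i.1 j.1))) w =
      (amp φ (Matrix.of fun i j : Fin m × ι =>
        sliceRight V (w i.1 j.1) (canonicalMap V W (z i.2 j.2)))).submatrix
        (Equiv.prodAssoc (Fin m) ι (Fin k)).symm (Equiv.prodAssoc (Fin m) ι (Fin k)).symm := by
  ext p q
  exact dualSlice_apply φ (z p.2.1 q.2.1) p.2.2 q.2.2 (w p.1 q.1)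

theorem amp_functionalMap_sliceRight {m n : ℕ} (z : Matrix ι ι (dualSpace V ⊗[ℂ] dualSpace W))
    (v : Matrix (Fin n) (Fin n) V) (w : Matrix (Fin m) (Fin m) W) :
    amp (functionalMap (Matrix.of fun i j : Fin m × ι =>
      sliceRight V (w i.1 j.1) (canonicalMap V W (z i.2 j.2)))) v =
      (amp (functionalMap (z.map (canonicalMap V W))) (Matrix.kroneckerTMul ℂ v w)).submatrix
        (Equiv.prodAssoc (Fin n) (Fin m) ι).symm (Equiv.prodAssoc (Fin n) (Fin m) ι).symm := rfl

/-- The norm of `(φ ⊗ ψ)(z)` is bounded by the norm of the map on `V ⊗_Δ W` given by `z`. -/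
theorem norm_amp_tensorMap_le {k l : ℕ} {φ : dualSpace V →ₗ[ℂ] Matrix (Fin k) (Fin k) ℂ}
    {ψ : dualSpace W →ₗ[ℂ] Matrix (Fin l) (Fin l) ℂ} (hφ : IsCompletelyContractive φ)
    (hψ : IsCompletelyContractive ψ) {r : ℝ} (hr : 0 ≤ r)
    (h : ∀ (κ : Type) [Fintype κ] [DecidableEq κ] (x : Matrix κ κ (V ⊗[ℂ] W)),
      (maxBall V W).Dom 1 x → ‖amp (functionalMap (z.map (canonicalMap V W))) x‖ ≤ r) :
    ‖amp (tensorMap φ ψ) z‖ ≤ r := by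
  rw [amp_tensorMap_eq, norm_reindex_self]
  refine (gauge_posBall W).norm_amp_le_of_isCompletelyContractive hψ _ hr fun m w hw => ?_
  rw [amp_functionalMap_dualSlice, norm_reindex_self]
  refine (gauge_posBall V).norm_amp_le_of_isCompletelyContractive hφ _ hr fun n v hv => ?_
  rw [amp_functionalMap_sliceRight, norm_reindex_self]
  exact h _ _ (by simpa using hv.kroneckerTMul hw)

/-- Slicing reduces `ψ` to test matrices `w ≥ 0`, then `φ` to test matrices `v ≥ 0`; what is left is
positivity at `v ⊗ w`. -/
theorem mem_minPreCone_of_posMap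
    (h : (maxBall V W).PosMap (functionalMap (z.map (canonicalMap V W)))) :
    z ∈ minPreCone (dualSpace V) (dualSpace W) ι := by
  intro k l φ ψ _ hφ _ hψ
  rw [amp_tensorMap_eq]
  refine ((gauge_posBall W).posSemidef_amp_of_isCompletelyPositive hψ _ fun m w hw => ?_).submatrix _
  rw [amp_functionalMap_dualSlice]
  refine ((gauge_posBall V).posSemidef_amp_of_isCompletelyPositive hφ _ fun n v hv => ?_).submatrix _
  rw [amp_functionalMap_sliceRight]
  exact (h _ _ (kroneckerTMul_mem_cone (mem_cone_posBall_iff.2 hv)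
    (mem_cone_posBall_iff.2 hw))).submatrix _

theorem amp_functionalMap_kroneckerTMul {m n : ℕ} (z : Matrix ι ι (dualSpace V ⊗[ℂ] dualSpace W))
    (v : Matrix (Fin n) (Fin n) V) (w : Matrix (Fin m) (Fin m) W) :
    amp (functionalMap (z.map (canonicalMap V W))) (Matrix.kroneckerTMul ℂ v w) =
      (amp (tensorMap (evalMap v) (evalMap w)) z).submatrix Prod.swap Prod.swap := by
  ext p q
  exact (tensorMap_evalMap v w (z p.2 q.2) p.1.1 q.1.1 p.1.2 q.1.2).symm

/-- Evaluations at positive matrices are among the c.p. maps that test δ-positivity. -/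
theorem posMap_of_mem_minPreCone (h : z ∈ minPreCone (dualSpace V) (dualSpace W) ι) :
    (maxBall V W).PosMap (functionalMap (z.map (canonicalMap V W))) := by
  refine posMap_maxBall_of_kroneckerTMul fun k l v w hv hw => ?_
  rw [amp_functionalMap_kroneckerTMul]
  exact (h k l _ _ ((gauge_posBall V).isBoundedMap_evalMap v) (isCompletelyPositive_evalMap hv)
    ((gauge_posBall W).isBoundedMap_evalMap w) (isCompletelyPositive_evalMap hw)).submatrix _

theorem boundedBy_minModulus {n : ℕ} {z : Matrix (Fin n) (Fin n) (dualSpace V ⊗[ℂ] dualSpace W)}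
    (h : (maxBall V W).PosMap (functionalMap (z.map (canonicalMap V W)))) :
    (maxBall V W).BoundedBy (minModulus z) (functionalMap (z.map (canonicalMap V W))) := by
  have h0 : 0 ≤ minModulus z := by
    refine Real.sSup_nonneg ?_
    rintro _ ⟨k, l, φ, ψ, -, -, -, -, rfl⟩
    exact norm_nonneg _
  refine boundedBy_maxBall_of_kroneckerTMul h0 fun k l v w hv hw => ?_
  refine (PosSemidef.norm_le_iff (h _ _ (kroneckerTMul_mem_cone (BallSystem.mem_cone_of_mem_ball hv)
    (BallSystem.mem_cone_of_mem_ball hw))) h0).1 ?_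
  rw [amp_functionalMap_kroneckerTMul]
  -- Evaluations at the positive balls are admissible in the supremum; its finiteness comes from the
  -- complete boundedness of the map induced by `z`.
  refine (norm_submatrix_equiv_le (Equiv.prodComm _ _) _).trans (le_csSup ?_ ?_)
  · obtain ⟨C, hC, hC2⟩ := (gauge_maxBall V W).exists_norm_amp_functionalMap_le
      (z.map (canonicalMap V W))
    refine ⟨C, ?_⟩
    rintro _ ⟨k, l, φ, ψ, -, hφ, -, hψ, rfl⟩
    exact norm_amp_tensorMap_le hφ hψ hC fun κ _ _ x hx => by simpa using hC2 κ x 1 zero_le_one hx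
  · rw [mem_posBall_iff] at hv hw
    exact ⟨k, l, _, _, isCompletelyPositive_evalMap hv.1,
      (gauge_posBall V).isCompletelyContractive_evalMap hv.2, isCompletelyPositive_evalMap hw.1,
      (gauge_posBall W).isCompletelyContractive_evalMap hw.2, rfl⟩

theorem functionalMap_fromBlocks (u z u' : Matrix ι ι (dualSpace V ⊗[ℂ] dualSpace W)) :
    functionalMap ((Matrix.fromBlocks u z zᴴ u').map (canonicalMap V W)) =
      blockMap (functionalMap (u.map (canonicalMap V W))) (functionalMap (z.map (canonicalMap V W)))
        (adjMap (functionalMap (z.map (canonicalMap V W))))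
        (functionalMap (u'.map (canonicalMap V W))) := by
  refine LinearMap.ext fun x => ?_
  ext (i | i) (j | j)
  · rfl
  · rfl
  · exact star_canonicalMap (z j i) x
  · rfl

end Canonical

/-! ### Positive maps with bounds -/

theorem posSemidef_of_forall_exists_norm_sub_lt {ι : Type*} [Fintype ι] [DecidableEq ι]
    {A : Matrix ι ι ℂ} (h : ∀ ε > 0, ∃ B : Matrix ι ι ℂ, B.PosSemidef ∧ ‖A - B‖ < ε) :
    A.PosSemidef := by
  have e : {A : Matrix ι ι ℂ | A.PosSemidef} =
      ⋂ x : ι → ℂ, {A : Matrix ι ι ℂ | 0 ≤ star x ⬝ᵥ A *ᵥ x} := by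
    ext A
    simp only [Set.mem_ofPred_eq, Set.mem_iInter]
    exact ⟨fun h x => h.dotProduct_mulVec_nonneg x, posSemidef_of_form⟩
  have hc : IsClosed {A : Matrix ι ι ℂ | A.PosSemidef} := by
    rw [e]
    exact isClosed_iInter fun x => isClosed_le continuous_const (by fun_prop)
  refine hc.closure_subset (Metric.mem_closure_iff.2 fun ε hε => ?_)
  obtain ⟨B, hB, hAB⟩ := h ε hε
  exact ⟨B, hB, by rwa [dist_eq_norm]⟩

section Bounds

variable {X : Type*} [AddCommGroup X] [Module ℂ X] [StarAddMonoid X] [StarModule ℂ X]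
  {S : BallSystem X} {κ : Type*} [Fintype κ] [DecidableEq κ] {F : X →ₗ[ℂ] Matrix κ κ ℂ} {r : ℝ}

theorem BallSystem.BoundedBy.mono (h : S.BoundedBy r F) {s : ℝ} (hrs : r ≤ s) :
    S.BoundedBy s F := by
  intro ι _ _ a ha
  have h1 := (Matrix.PosSemidef.one (n := ι × κ) (R := ℂ)).smul (a := ((s - r : ℝ) : ℂ))
    (by exact_mod_cast sub_nonneg.2 hrs)
  convert (h ι a ha).add h1 using 1
  rw [Complex.ofReal_sub, sub_smul]
  abel

/-- A c.p. map sends the dominating block matrix to a positive one, so a bound on the positive ball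
bounds everything dominated by it. -/
theorem BallSystem.PosMap.norm_amp_le_of_dom (h : S.PosMap F) (hr : 0 ≤ r) (hF : S.BoundedBy r F)
    {ι : Type} [Fintype ι] [DecidableEq ι] {x : Matrix ι ι X} {t : ℝ} (ht : 0 ≤ t)
    (hx : S.Dom t x) : ‖amp F x‖ ≤ r * t := by
  obtain ⟨a, ha, b, hb, hab⟩ := hx
  have h1 := (h _ _ hab).submatrix
    (Sum.elim (Prod.map Sum.inl id) (Prod.map Sum.inr id) : (ι × κ) ⊕ (ι × κ) → (ι ⊕ ι) × κ)
  have e : (amp F (Matrix.fromBlocks ((t : ℂ) • a) x xᴴ ((t : ℂ) • b))).submatrix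
      (Sum.elim (Prod.map Sum.inl id) (Prod.map Sum.inr id) : (ι × κ) ⊕ (ι × κ) → (ι ⊕ ι) × κ)
      (Sum.elim (Prod.map Sum.inl id) (Prod.map Sum.inr id) : (ι × κ) ⊕ (ι × κ) → (ι ⊕ ι) × κ) =
      Matrix.fromBlocks (amp F ((t : ℂ) • a)) (amp F x) (amp F xᴴ) (amp F ((t : ℂ) • b)) := by
    ext (p | p) (q | q) <;> rfl
  rw [e] at h1
  rw [← (Matrix.isHermitian_fromBlocks_iff.1 h1.isHermitian).2.1] at h1
  have hbound : ∀ {a : Matrix ι ι X}, a ∈ S.ball ι → ‖amp F ((t : ℂ) • a)‖ ≤ r * t := by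
    intro a ha
    rw [amp_smul, norm_smul, Complex.norm_real, Real.norm_of_nonneg ht, mul_comm]
    exact mul_le_mul_of_nonneg_right (h.norm_amp_le hr hF ha) ht
  exact norm_le_of_posSemidef_fromBlocks (mul_nonneg hr ht) h1 (hbound ha) (hbound hb)

theorem Gauge.exists_functionalMap_eq [MatrixStructure X] (hS : Gauge S) (h : S.PosMap F)
    (hr : 0 ≤ r) (hF : S.BoundedBy r F) :
    ∃ f : Matrix κ κ (dualSpace X), functionalMap f = F := by
  refine ⟨Matrix.of fun i j => ⟨Matrix.entryLinearMap ℂ ℂ i j ∘ₗ F, r, fun x => ?_⟩, rfl⟩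
  refine le_trans ?_ (hS.norm_amp_le hr (fun y hy => by
    simpa using h.norm_amp_le_of_dom hr hF zero_le_one hy) _)
  exact norm_entry_le (amp F (Matrix.of fun _ _ : Fin 1 => x)) (0, i) (0, j)

end Bounds

section Canonical

variable {V W : Type*} [AddCommGroup V] [Module ℂ V] [StarAddMonoid V] [StarModule ℂ V]
  [MatrixStructure V] [AddCommGroup W] [Module ℂ W] [StarAddMonoid W] [StarModule ℂ W]
  [MatrixStructure W]

theorem minModulus_nonneg {n : ℕ} (z : Matrix (Fin n) (Fin n) (V ⊗[ℂ] W)) :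
    0 ≤ minModulus z := by
  refine Real.sSup_nonneg ?_
  rintro _ ⟨k, l, φ, ψ, -, -, -, -, rfl⟩
  exact norm_nonneg _

theorem cbNorm_nonneg {k : ℕ} (F : V →ₗ[ℂ] Matrix (Fin k) (Fin k) ℂ) : 0 ≤ cbNorm F := by
  refine Real.sSup_nonneg ?_
  rintro _ ⟨n, v, -, rfl⟩
  exact norm_nonneg _

variable [MatrixRegularOperatorSpace V] [MatrixRegularOperatorSpace W]

/-! ### The canonical map is completely isometric -/

theorem minModulus_le {n : ℕ} {u : Matrix (Fin n) (Fin n) (dualSpace V ⊗[ℂ] dualSpace W)} {r : ℝ}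
    (hr : 0 ≤ r) (h : (maxBall V W).PosMap (functionalMap (u.map (canonicalMap V W))))
    (hu : (maxBall V W).BoundedBy r (functionalMap (u.map (canonicalMap V W)))) :
    minModulus u ≤ r := by
  refine Real.sSup_le ?_ hr
  rintro _ ⟨k, l, φ, ψ, -, hφ, -, hψ, rfl⟩
  exact norm_amp_tensorMap_le hφ hψ hr fun κ _ _ x hx => by
    simpa using h.norm_amp_le_of_dom hr hu zero_le_one hx

/-- The extension theorem on `V ⊗_Δ W` gives the diagonal maps; surjectivity lifts them to matrices
over `V^* ⊗ W^*`, and slicing turns positivity and bounds into their δ-versions. -/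
theorem exists_mem_minPreCone_of_cbNorm_le (hT : Function.Surjective (canonicalMap V W)) {n : ℕ}
    (z : Matrix (Fin n) (Fin n) (dualSpace V ⊗[ℂ] dualSpace W)) {r : ℝ} (hr : 0 < r)
    (hz : cbNorm (dualMatrixMap (z.map (canonicalMap V W))) ≤ r) :
    ∃ u u' : Matrix (Fin n) (Fin n) (dualSpace V ⊗[ℂ] dualSpace W),
      Matrix.fromBlocks u z zᴴ u' ∈ minPreCone (dualSpace V) (dualSpace W) (Fin n ⊕ Fin n) ∧
      max (minModulus u) (minModulus u') ≤ r := by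
  obtain ⟨U, U', h, hU, hU'⟩ := BallSystem.exists_posMap_corner_of_le (absorbing_maxBall V W)
    (functionalMap (z.map (canonicalMap V W))) hr fun x hx => by
      have h1 := (gauge_maxBall V W).norm_amp_le_cbNorm
        ((gauge_maxBall V W).isCompletelyBounded (z.map (canonicalMap V W))) zero_lt_one hx
      rw [mul_one] at h1
      exact h1.trans hz
  have lift : ∀ U : V ⊗[ℂ] W →ₗ[ℂ] Matrix (Fin n) (Fin n) ℂ, (maxBall V W).PosMap U →
      (maxBall V W).BoundedBy r U →
      ∃ u : Matrix (Fin n) (Fin n) (dualSpace V ⊗[ℂ] dualSpace W),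
        functionalMap (u.map (canonicalMap V W)) = U := by
    intro U h hU
    obtain ⟨f, rfl⟩ := (gauge_maxBall V W).exists_functionalMap_eq h hr.le hU
    choose u hu using fun i j => hT (f i j)
    exact ⟨Matrix.of u, congrArg functionalMap (Matrix.ext hu)⟩
  obtain ⟨u, rfl⟩ := lift U h.blockMap_left hU
  obtain ⟨u', rfl⟩ := lift U' h.blockMap_right hU'
  refine ⟨u, u', mem_minPreCone_of_posMap ?_, max_le (minModulus_le hr.le h.blockMap_left hU)
    (minModulus_le hr.le h.blockMap_right hU')⟩
  rw [functionalMap_fromBlocks]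
  exact h

theorem cbNorm_canonicalMap (hT : Function.Surjective (canonicalMap V W)) {n : ℕ}
    (z : Matrix (Fin n) (Fin n) (dualSpace V ⊗[ℂ] dualSpace W)) :
    cbNorm (dualMatrixMap (z.map (canonicalMap V W))) = minNorm z := by
  -- The goals are: the infimum is over a nonempty set, a corner is bounded by the diagonal, and the
  -- extension theorem with slack `ε`, which keeps the bound positive.
  refine le_antisymm (le_csInf ?_ ?_) (le_of_forall_pos_le_add fun ε hε => ?_)
  · obtain ⟨u, u', h, -⟩ := exists_mem_minPreCone_of_cbNorm_le hT z
      (add_pos_of_nonneg_of_pos (cbNorm_nonneg _) one_pos) (le_add_of_nonneg_right zero_le_one)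
    exact ⟨_, u, u', h, rfl⟩
  · rintro _ ⟨u, u', h, rfl⟩
    have h1 := posMap_of_mem_minPreCone h
    rw [functionalMap_fromBlocks] at h1
    have h0 := (minModulus_nonneg u).trans (le_max_left _ (minModulus u'))
    refine (gauge_maxBall V W).cbNorm_le h0 fun m x hx => ?_
    have h2 := h1.norm_amp_corner_le h0
      ((boundedBy_minModulus h1.blockMap_left).mono (le_max_left _ _))
      ((boundedBy_minModulus h1.blockMap_right).mono (le_max_right _ _)) zero_le_one hx
    rwa [mul_one] at h2
  · obtain ⟨u, u', h, hle⟩ := exists_mem_minPreCone_of_cbNorm_le hT z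
      (add_pos_of_nonneg_of_pos (cbNorm_nonneg _) hε) (le_add_of_nonneg_right hε.le)
    refine csInf_le_of_le ⟨0, ?_⟩ ⟨u, u', h, rfl⟩ hle
    rintro _ ⟨u, u', -, rfl⟩
    exact (minModulus_nonneg u).trans (le_max_left _ _)

/-! ### The canonical map is a complete order isomorphism -/

theorem Gauge.matNorm_zero {X : Type*} [AddCommGroup X] [Module ℂ X] [StarAddMonoid X]
    [StarModule ℂ X] [MatrixStructure X] {S : BallSystem X} (hS : Gauge S) (n : ℕ) :
    matNorm (0 : Matrix (Fin n) (Fin n) X) = 0 := by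
  obtain ⟨t, ht, h⟩ := hS.absorbing.exists_dom (0 : Matrix (Fin n) (Fin n) X)
  have h1 := h.smul le_rfl
  rw [zero_mul, smul_zero] at h1
  exact le_antisymm (hS.le_of_dom _ le_rfl h1) (hS.matNorm_nonneg _)

theorem minNorm_zero (hT : Function.Surjective (canonicalMap V W)) (n : ℕ) :
    minNorm (0 : Matrix (Fin n) (Fin n) (dualSpace V ⊗[ℂ] dualSpace W)) = 0 := by
  rw [← cbNorm_canonicalMap hT]
  refine le_antisymm ((gauge_maxBall V W).cbNorm_le le_rfl fun m x _ => ?_) (cbNorm_nonneg _)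
  refine le_of_eq (norm_eq_zero.2 ?_)
  ext p q
  simp [amp_apply, dualMatrixMap]

theorem mem_minPreCone_of_isCompletelyPositive {n : ℕ}
    {z : Matrix (Fin n) (Fin n) (dualSpace V ⊗[ℂ] dualSpace W)}
    (h : IsCompletelyPositive (dualMatrixMap (z.map (canonicalMap V W)))) :
    z ∈ minPreCone (dualSpace V) (dualSpace W) (Fin n) := by
  refine mem_minPreCone_of_posMap fun ι _ _ a ha => ?_
  let e := (Fintype.equivFin ι).symm
  have h1 := mem_cone_maxBall_iff.1 (BallSystem.submatrix_mem_cone ha e)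
  have h2 := h _ (a.submatrix e e) fun ε hε => ⟨_, h1, by
    rw [sub_self]
    exact ((gauge_maxBall V W).matNorm_zero _).trans_lt hε⟩
  convert h2.submatrix (Prod.map e.symm id) using 1
  ext p q
  simp [amp_apply]
  rfl

/-- The cone of `V ⊗_Δ W` is a norm closure. Positivity passes to it because the induced map is
completely bounded and positive matrices form a closed set. -/
theorem isCompletelyPositive_of_mem_minPreCone {n : ℕ}
    {z : Matrix (Fin n) (Fin n) (dualSpace V ⊗[ℂ] dualSpace W)}
    (hz : z ∈ minPreCone (dualSpace V) (dualSpace W) (Fin n)) :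
    IsCompletelyPositive (dualMatrixMap (z.map (canonicalMap V W))) := by
  intro m v hv
  obtain ⟨C, hC⟩ := (gauge_maxBall V W).isCompletelyBounded (z.map (canonicalMap V W))
  refine posSemidef_of_forall_exists_norm_sub_lt fun ε hε => ?_
  obtain ⟨y, hy, hvy⟩ := hv (ε / (|C| + 1)) (by positivity)
  refine ⟨_, posMap_of_mem_minPreCone hz _ y (mem_cone_maxBall_iff.2 hy), ?_⟩
  have h1 : ‖amp (dualMatrixMap (z.map (canonicalMap V W))) (v - y)‖ ≤ C * matNorm (v - y) :=
    hC m (v - y)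
  have h0 : 0 ≤ matNorm (v - y) := (gauge_maxBall V W).matNorm_nonneg _
  have h2 : matNorm (v - y) * (|C| + 1) < ε := (lt_div_iff₀ (by positivity)).1 hvy
  rw [amp_sub] at h1
  refine h1.trans_lt ?_
  nlinarith [le_abs_self C]

theorem canonicalMap_mem_matCone_iff (hT : Function.Surjective (canonicalMap V W)) {n : ℕ}
    (z : Matrix (Fin n) (Fin n) (dualSpace V ⊗[ℂ] dualSpace W)) :
    z.map (canonicalMap V W) ∈ matCone (dualSpace (V ⊗[ℂ] W)) n ↔
      ∀ ε > 0, ∃ y ∈ minPreCone (dualSpace V) (dualSpace W) (Fin n), minNorm (z - y) < ε := by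
  constructor
  · rintro ⟨-, h⟩ ε hε
    -- No approximation is needed: a matrix with c.p. image already lies in the cone before closure.
    refine ⟨z, mem_minPreCone_of_isCompletelyPositive h, ?_⟩
    rw [show z - z = 0 from sub_self z, minNorm_zero hT]
    exact hε
  · intro h
    refine ⟨(gauge_maxBall V W).isCompletelyBounded _, fun m v hv => ?_⟩
    refine posSemidef_of_forall_exists_norm_sub_lt fun ε hε => ?_
    have h0 := (gauge_maxBall V W).matNorm_nonneg v
    have h1 : 0 < matNorm v + 1 := by linarith
    obtain ⟨y, hy, hzy⟩ := h (ε / (matNorm v + 1)) (by positivity)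
    refine ⟨_, isCompletelyPositive_of_mem_minPreCone hy m v hv, ?_⟩
    have h2 := (gauge_maxBall V W).norm_amp_le_cbNorm
      ((gauge_maxBall V W).isCompletelyBounded ((z - y).map (canonicalMap V W))) h1
      ((gauge_maxBall V W).dom_of_lt v h1 (lt_add_one _))
    rw [cbNorm_canonicalMap hT] at h2
    have e : amp (dualMatrixMap (z.map (canonicalMap V W))) v -
        amp (dualMatrixMap (y.map (canonicalMap V W))) v =
        amp (dualMatrixMap ((z - y).map (canonicalMap V W))) v := by
      ext p q
      simp [amp_apply, dualMatrixMap]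
    rw [e]
    exact h2.trans_lt ((lt_div_iff₀ h1).1 hzy)

end Canonical

end OperatorSpaces

/-! ### The main theorem. -/

theorem mainTheorem7 {V W : Type*}
    [AddCommGroup V] [Module ℂ V] [StarAddMonoid V] [StarModule ℂ V] [MatrixStructure V]
    [AddCommGroup W] [Module ℂ W] [StarAddMonoid W] [StarModule ℂ W] [MatrixStructure W]
    [MatrixRegularOperatorSpace V] [MatrixRegularOperatorSpace W]
    (hfin : FiniteDimensional ℂ V ∨ FiniteDimensional ℂ W) :
    ∃ e : MinTensor (dualSpace V) (dualSpace W) ≃ₗ[ℂ] dualSpace (MaxTensor V W),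
      (∀ (f : dualSpace V) (g : dualSpace W) (v : V) (w : W),
        (e (MinTensor.tmul f g)).1 (MaxTensor.tmul v w) = f.1 v * g.1 w) ∧
      (∀ (n : ℕ) (z : Matrix (Fin n) (Fin n) (MinTensor (dualSpace V) (dualSpace W))),
        matNorm (z.map e) = matNorm z) ∧
      (∀ (n : ℕ) (z : Matrix (Fin n) (Fin n) (MinTensor (dualSpace V) (dualSpace W))),
        z.map e ∈ matCone (dualSpace (MaxTensor V W)) n ↔
          z ∈ matCone (MinTensor (dualSpace V) (dualSpace W)) n) := by
  have hT := canonicalMap_bijective (V := V) (W := W) hfin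
  exact ⟨LinearEquiv.ofBijective (canonicalMap V W) hT, fun f g v w => rfl,
    fun n z => cbNorm_canonicalMap hT.2 z, fun n z => canonicalMap_mem_matCone_iff hT.2 z⟩
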